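/- Let $n\ge 0$ be an integer, let $\mathcal D$ be the ring of germs at $0\in\mathbb C^n$ of linear differential operators with coefficients in $\mathbb C\{x_1,\dots,x_n\}$, and let $(u,v)\in\mathbb Z^{2n}$ be an admissible weight vector ($u_i+v_i\ge 0$ and $u_i\le 0$ for all $i$) with $(u,v)\ne(0,\dots,0,1,\dots,1)$. For $P=\sum a_{\alpha,\beta}x^\alpha\partial^\beta\in\mathcal D$ say $P\in F_d(\mathcal D)$ if $|\beta|\le d$ whenever $a_{\alpha,\beta}\ne 0$, say $P\in V_k(\mathcal D)$ if $\sum_i u_i\alpha_i+\sum_i v_i\beta_i\le k$ whenever $a_{\alpha,\beta}\neq 0$, and put $F_{d,k}(\mathcal D)=F_d(\mathcal D)\cap V_k(\mathcal D)$. For a bifiltered module $M$ put $F_d(M)=\bigcup_k F_{d,k}(M)$, $V_k(M)=\bigcup_d F_{d,k}(M)$, $$\operatorname{bigr}M=\bigoplus_{d,k}\frac{F_{d,k}(M)}{F_{d-1,k}(M)+F_{d,k-1}(M)},\qquad \operatorname{gr}^V(\mathbf R(M))=\bigoplus_{d,k}\frac{F_{d,k}(M)}{F_{d,k-1}(M)},$$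 which are bigraded modules over the bigraded rings $\operatorname{bigr}\mathcal D$ and $\operatorname{gr}^V(\mathbf R(\mathcal D))$ respectively. For $A$ one of these two rings let $\mathfrak m\subset A$ be the two-sided ideal generated by the classes of $x_1,\dots,x_n$ in $A_{0,u_i}$ and by $\bigoplus_k A_{1,k}$. A minimal bigraded free resolution of a bigraded $A$-module $N$ is an exact sequence of bigraded maps $\cdots\to\mathcal L_1\xrightarrow{\phi_1}\mathcal L_0\to N\to 0$ with $\mathcal L_i=A^{r_i}[\mathbf n^{(i)}][\mathbf m^{(i)}]$ (where $(A^r[\mathbf n][\mathbf m])_{d,k}=\bigoplus_j A_{d-n_j,k-m_j}$) and $\operatorname{im}\phi_i\subset\mathfrak m\mathcal L_{i-1}$ for $i\ge 1$. A bifiltered free resolution of $M$ is an exact sequence of $\mathcal D$-modules $\cdots\to\mathcal L_1\to\mathcal L_0\to M\to 0$ with $\mathcal L_i=\mathcal D^{r_i}[\mathbf n^{(i)}][\mathbf m^{(i)}]$ (where $F_{d,k}(\mathcal D^r[\mathbf n][\mathbf m])=\bigoplus_j F_{d-n_j,k-m_j}(\mathcal D)$) such that $\cdots\to F_{d,k}(\mathcal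 L_1)\to F_{d,k}(\mathcal L_0)\to F_{d,k}(M)\to 0$ is exact for all $d,k\in\mathbb Z$; it is minimal if it induces a minimal bigraded free resolution of $\operatorname{gr}^V(\mathbf R(M))$. Betti numbers and shifts are the $r_i$ and the $(\mathbf n^{(i)},\mathbf m^{(i)})$ of a minimal resolution. Let $M$ be a left $\mathcal D$-module with a good bifiltration, i.e. there are finitely many $f_i\in M$ and $n_i,m_i\in\mathbb Z$ with $F_{d,k}(M)=\sum_i F_{d-n_i,k-m_i}(\mathcal D)f_i$ for all $d,k\in\mathbb Z$, and suppose that $F_{d,k}(M)=F_d(M)\cap V_k(M)$ for all $d,k\in\mathbb Z$. Then: 1. The ring $\operatorname{bigr}\mathcal D$ is commutative and $\operatorname{bigr}M$ is a finitely generated $\operatorname{bigr}\mathcal D$-module. 2. There is a bifiltered free resolution $\cdots\to\mathcal L_1\to\mathcal L_0\to M\to 0$ that induces a minimal bigraded free resolution $\cdots\to\operatorname{bigr}\mathcal L_1\to\operatorname{bigr}\mathcal L_0\to\operatorname{bigr}M\to 0$, and it is unique up to bifiltered isomorphism of resolutions over the identity of $M$. 3. A bifiltered free resolution of $M$ induces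 a minimal bigraded free resolution of $\operatorname{bigr}M$ if and only if it is a minimal bifiltered free resolution of $M$. 4. Consequently, for every minimal bifiltered free resolution of $M$ and every minimal bigraded free resolution of $\operatorname{bigr}M$, the Betti numbers agree, and in each homological degree the shifts $(n_j,m_j)$ agree up to permutation. -/

import Mathlib

set_option maxSynthPendingDepth 3

open scoped DirectSum

noncomputable section

namespace BifilteredD

/-- A formal power series is convergent if it converges absolutely on some polydisc around `0`. -/
def IsConvergent {n : ℕ} (f : MvPowerSeries (Fin n) ℂ) : Prop :=
  ∃ r : ℝ, 0 < r ∧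
    Summable fun α : Fin n →₀ ℕ => ‖MvPowerSeries.coeff α f‖ * r ^ (α.degree)

theorem summable_of_le {n : ℕ} {f : MvPowerSeries (Fin n) ℂ} {r s : ℝ} (hs : 0 < s) (hsr : s ≤ r)
    (h : Summable fun α : Fin n →₀ ℕ => ‖MvPowerSeries.coeff α f‖ * r ^ (α.degree)) :
    Summable fun α : Fin n →₀ ℕ => ‖MvPowerSeries.coeff α f‖ * s ^ (α.degree) := by
  refine Summable.of_nonneg_of_le (fun α => by positivity) (fun α => ?_) h
  gcongr

theorem IsConvergent.add {n : ℕ} {f g : MvPowerSeries (Fin n) ℂ} (hf : IsConvergent f)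
    (hg : IsConvergent g) : IsConvergent (f + g) := by
  obtain ⟨r, hr, hf⟩ := hf
  obtain ⟨s, hs, hg⟩ := hg
  have hm : 0 < min r s := lt_min hr hs
  refine ⟨min r s, hm, Summable.of_nonneg_of_le (fun α => by positivity) (fun α => ?_)
    ((summable_of_le hm (min_le_left _ _) hf).add (summable_of_le hm (min_le_right _ _) hg))⟩
  rw [map_add, ← add_mul]
  gcongr
  exact norm_add_le _ _

theorem norm_coeff_mul_le {n : ℕ} (f g : MvPowerSeries (Fin n) ℂ) {r : ℝ} (hr : 0 < r)
    (α : Fin n →₀ ℕ) :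
    ‖MvPowerSeries.coeff α (f * g)‖ * r ^ (α.degree) ≤
      ∑ kl ∈ Finset.HasAntidiagonal.antidiagonal α,
        (‖MvPowerSeries.coeff kl.1 f‖ * r ^ (kl.1.degree)) *
          (‖MvPowerSeries.coeff kl.2 g‖ * r ^ (kl.2.degree)) := by
  rw [MvPowerSeries.coeff_mul]
  refine (mul_le_mul_of_nonneg_right (norm_sum_le _ _) (by positivity)).trans ?_
  rw [Finset.sum_mul]
  refine Finset.sum_le_sum fun kl hkl => le_of_eq ?_
  have h : kl.1 + kl.2 = α := Finset.HasAntidiagonal.mem_antidiagonal.1 hkl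
  rw [← h, norm_mul, map_add, pow_add]
  ring

theorem summable_cauchy {n : ℕ} {a b : (Fin n →₀ ℕ) → ℝ} (ha : ∀ α, 0 ≤ a α) (hb : ∀ α, 0 ≤ b α)
    (hf : Summable a) (hg : Summable b) :
    Summable fun α => ∑ kl ∈ Finset.HasAntidiagonal.antidiagonal α, a kl.1 * b kl.2 :=
  summable_sum_mul_antidiagonal_of_summable_mul (hf.mul_of_nonneg hg ha hb)

theorem IsConvergent.mul {n : ℕ} {f g : MvPowerSeries (Fin n) ℂ} (hf : IsConvergent f)
    (hg : IsConvergent g) : IsConvergent (f * g) := by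
  obtain ⟨r, hr, hf⟩ := hf
  obtain ⟨s, hs, hg⟩ := hg
  have hm : 0 < min r s := lt_min hr hs
  have hf := summable_of_le hm (min_le_left _ _) hf
  have hg := summable_of_le hm (min_le_right _ _) hg
  have h0 : ∀ (p : MvPowerSeries (Fin n) ℂ) (α : Fin n →₀ ℕ),
      0 ≤ ‖MvPowerSeries.coeff α p‖ * min r s ^ (α.degree) := fun p α => by positivity
  have hsum := summable_cauchy (h0 f) (h0 g) hf hg
  refine ⟨min r s, hm, ?_⟩
  exact Summable.of_nonneg_of_le (h0 (f * g)) (norm_coeff_mul_le f g hm) hsum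

theorem isConvergent_C {n : ℕ} (c : ℂ) :
    IsConvergent (MvPowerSeries.C (σ := Fin n) c) := by
  classical
  refine ⟨1, one_pos, summable_of_ne_finset_zero (s := {0}) fun α hα => ?_⟩
  rw [MvPowerSeries.coeff_C, if_neg (by simpa using hα)]
  simp

theorem isConvergent_X {n : ℕ} (i : Fin n) :
    IsConvergent (MvPowerSeries.X i : MvPowerSeries (Fin n) ℂ) := by
  classical
  refine ⟨1, one_pos, summable_of_ne_finset_zero (s := {Finsupp.single i 1}) fun α hα => ?_⟩
  rw [MvPowerSeries.coeff_X, if_neg (by simpa using hα)]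
  simp

theorem IsConvergent.pderiv {n : ℕ} {f : MvPowerSeries (Fin n) ℂ} (hf : IsConvergent f)
    (i : Fin n) : IsConvergent (MvPowerSeries.pderiv ℂ i f) := by
  obtain ⟨r, hr, hf⟩ := hf
  have hinj : Function.Injective fun α : Fin n →₀ ℕ => α + Finsupp.single i 1 :=
    fun a b h => add_right_cancel h
  refine ⟨r / 2, by positivity, Summable.of_nonneg_of_le (fun α => by positivity) (fun α => ?_)
    ((hf.comp_injective hinj).mul_left r⁻¹)⟩
  have h1 : ‖((α i : ℂ) + 1)‖ ≤ 2 ^ α.degree := by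
    have h2 : α i + 1 ≤ 2 ^ α.degree :=
      (Nat.succ_le_of_lt Nat.lt_two_pow_self).trans
        (Nat.pow_le_pow_right two_pos (Finsupp.le_degree i α))
    have h3 : ((α i : ℂ) + 1) = ((α i + 1 : ℕ) : ℂ) := by push_cast; rfl
    rw [h3, Complex.norm_natCast]
    exact_mod_cast h2
  simp only [Function.comp_apply, MvPowerSeries.coeff_pderiv, norm_mul, map_add,
    Finsupp.degree_single, pow_add, pow_one, div_pow]
  have h4 : r⁻¹ * (‖MvPowerSeries.coeff (α + Finsupp.single i 1) f‖ * (r ^ α.degree * r))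
      = ‖MvPowerSeries.coeff (α + Finsupp.single i 1) f‖ * r ^ α.degree := by
    field_simp
  rw [h4, mul_assoc]
  refine mul_le_mul_of_nonneg_left ?_ (norm_nonneg _)
  rw [mul_div_assoc', div_le_iff₀ (by positivity), mul_comm]
  gcongr

/-- The ring `ℂ{x₁, …, xₙ}` of convergent power series. -/
def convergentSeries (n : ℕ) : Subalgebra ℂ (MvPowerSeries (Fin n) ℂ) where
  carrier := {f | IsConvergent f}
  mul_mem' := IsConvergent.mul
  add_mem' := IsConvergent.add
  algebraMap_mem' c := isConvergent_C c

/-- `ℂ{x₁, …, xₙ}` as a type. -/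
abbrev O (n : ℕ) : Type := convergentSeries n

instance (n : ℕ) : CommRing (O n) := inferInstance

instance (n : ℕ) : AddCommGroup (O n) := inferInstance

instance (n : ℕ) : Ring (Module.End ℂ (O n)) := inferInstance

/-- The coordinate function `xᵢ`. -/
def coord {n : ℕ} (i : Fin n) : O n := ⟨MvPowerSeries.X i, isConvergent_X i⟩

/-- Multiplication by a convergent power series, as an operator on `ℂ{x}`. -/
def mulOp {n : ℕ} (a : O n) : Module.End ℂ (O n) := LinearMap.mulLeft ℂ a

/-- The operator `∂ᵢ = ∂/∂xᵢ` on `ℂ{x}`. -/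
def partialOp {n : ℕ} (i : Fin n) : Module.End ℂ (O n) where
  toFun f := ⟨MvPowerSeries.pderiv ℂ i f.1, f.2.pderiv i⟩
  map_add' _ _ := Subtype.ext (map_add _ _ _)
  map_smul' _ _ := Subtype.ext (Derivation.map_smul _ _ _)

theorem partialOp_commute {n : ℕ} (i j : Fin n) :
    Commute (partialOp i) (partialOp j) := by
  refine LinearMap.ext fun f => Subtype.ext ?_
  change MvPowerSeries.pderiv ℂ i (MvPowerSeries.pderiv ℂ j f.1) =
    MvPowerSeries.pderiv ℂ j (MvPowerSeries.pderiv ℂ i f.1)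
  ext α
  simp only [MvPowerSeries.coeff_pderiv]
  rw [add_right_comm]
  by_cases h : i = j
  · subst h; rfl
  · simp only [Finsupp.add_apply, Finsupp.single_eq_of_ne h, Finsupp.single_eq_of_ne (Ne.symm h),
      add_zero]
    ring

/-- The ring `𝒟` of germs at `0 ∈ ℂⁿ` of linear differential operators with analytic coefficients:
the algebra of operators on `ℂ{x}` generated by `ℂ{x}` and `∂₁, …, ∂ₙ`. -/
def diffOps (n : ℕ) : Subalgebra ℂ (Module.End ℂ (O n)) :=
  Algebra.adjoin ℂ (Set.range mulOp ∪ Set.range partialOp)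

/-- `𝒟` as a type. -/
def D (n : ℕ) : Type := diffOps n

instance (n : ℕ) : Ring (D n) := inferInstanceAs (Ring (diffOps n))

instance (n : ℕ) : Algebra ℂ (D n) := inferInstanceAs (Algebra ℂ (diffOps n))

/-- The inclusion of `𝒟` in the ring of all `ℂ`-linear operators on `ℂ{x}`. -/
def D.toEnd (n : ℕ) : D n →+* Module.End ℂ (O n) := (diffOps n).val.toRingHom

theorem partialPow_comm {n : ℕ} (β : Fin n →₀ ℕ) :
    ((Finset.univ : Finset (Fin n)) : Set (Fin n)).Pairwise
      (Function.onFun Commute fun i => partialOp i ^ β i) :=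
  fun i _ j _ _ => (partialOp_commute i j).pow_pow (β i) (β j)

/-- The operator `∂^β = ∂₁^{β₁} ⋯ ∂ₙ^{βₙ}`. -/
def partialPow {n : ℕ} (β : Fin n →₀ ℕ) : Module.End ℂ (O n) :=
  Finset.univ.noncommProd (fun i => partialOp i ^ β i) (partialPow_comm β)

theorem partialPow_add {n : ℕ} (β γ : Fin n →₀ ℕ) :
    partialPow (β + γ) = partialPow β * partialPow γ := by
  unfold partialPow
  refine Eq.trans (Finset.noncommProd_congr rfl (fun i _ => ?_) _)
    (Finset.noncommProd_mul_distrib _ _ (partialPow_comm β) (partialPow_comm γ)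
      fun i _ j _ _ => (partialOp_commute i j).pow_pow _ _)
  simp [pow_add]

theorem partialPow_single {n : ℕ} (i : Fin n) :
    partialPow (Finsupp.single i 1) = partialOp i := by
  unfold partialPow
  refine (Finset.mul_noncommProd_erase _ (Finset.mem_univ i) _ (partialPow_comm _)).symm.trans ?_
  refine (congrArg₂ (· * ·) ?_ (Finset.noncommProd_eq_pow_card _ _ _ 1 ?_)).trans
    ((congrArg _ (one_pow _)).trans (mul_one (partialOp i)))
  · simp
  · intro j hj
    simp [Finsupp.single_eq_of_ne (Finset.ne_of_mem_erase hj)]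

theorem partialPow_zero {n : ℕ} : partialPow (0 : Fin n →₀ ℕ) = 1 := by
  unfold partialPow
  rw [Finset.noncommProd_eq_pow_card _ _ _ 1] <;> simp

theorem mulOp_mul {n : ℕ} (a b : O n) : mulOp (a * b) = mulOp a * mulOp b := by
  ext1 f; exact mul_assoc a b f

theorem mulOp_one {n : ℕ} : mulOp (1 : O n) = 1 := by
  ext1 f; exact one_mul f

theorem mulOp_add {n : ℕ} (a b : O n) : mulOp (a + b) = mulOp a + mulOp b := by
  ext1 f; exact add_mul a b f

theorem mulOp_zero {n : ℕ} : mulOp (0 : O n) = 0 := by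
  ext1 f; exact zero_mul f

theorem mulOp_neg {n : ℕ} (a : O n) : mulOp (-a) = - mulOp a := by
  ext1 f; exact neg_mul a f

theorem partialOp_mul_mulOp {n : ℕ} (i : Fin n) (a : O n) :
    partialOp i * mulOp a = mulOp a * partialOp i + mulOp (partialOp i a) := by
  refine LinearMap.ext fun f => Subtype.ext ?_
  change MvPowerSeries.pderiv ℂ i (a.1 * f.1) =
    a.1 * MvPowerSeries.pderiv ℂ i f.1 + MvPowerSeries.pderiv ℂ i a.1 * f.1
  rw [Derivation.leibniz, smul_eq_mul, smul_eq_mul, mul_comm f.1]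

/-- The weight `∑ uᵢ αᵢ`. -/
def wt {n : ℕ} (u : Fin n → ℤ) (α : Fin n →₀ ℕ) : ℤ := ∑ i, u i * (α i : ℤ)

theorem wt_add {n : ℕ} (u : Fin n → ℤ) (α β : Fin n →₀ ℕ) :
    wt u (α + β) = wt u α + wt u β := by
  simp [wt, mul_add, Finset.sum_add_distrib]

theorem wt_single {n : ℕ} (u : Fin n → ℤ) (i : Fin n) :
    wt u (Finsupp.single i 1) = u i := by
  simp [wt, Finsupp.single_apply]

theorem wt_zero {n : ℕ} (u : Fin n → ℤ) : wt u 0 = 0 := by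
  simp [wt]

/-- The filtration `F_k^{(u,v)}`: the operators `P = ∑ a_{α,β} x^α ∂^β` (a finite sum over `β`)
such that `∑ uᵢ αᵢ + ∑ vᵢ βᵢ ≤ k` whenever `a_{α,β} ≠ 0`. -/
def opFilt {n : ℕ} (u v : Fin n → ℤ) (k : ℤ) : AddSubgroup (Module.End ℂ (O n)) where
  carrier := {P | ∃ g : (Fin n →₀ ℕ) →₀ O n,
    P = g.sum (fun β a => mulOp a * partialPow β) ∧
    ∀ β α, MvPowerSeries.coeff α (g β).1 ≠ 0 → wt u α + wt v β ≤ k}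
  zero_mem' := ⟨0, by simp, by simp⟩
  add_mem' := by
    rintro _ _ ⟨g, rfl, hg⟩ ⟨g', rfl, hg'⟩
    refine ⟨g + g', ?_, fun β α h => ?_⟩
    · rw [Finsupp.sum_add_index'] <;> simp [mulOp_zero, mulOp_add, add_mul]
    · by_cases h0 : MvPowerSeries.coeff α (g β).1 = 0
      · refine hg' β α fun h1 => h ?_
        simp [h0, h1]
      · exact hg β α h0
  neg_mem' := by
    rintro _ ⟨g, rfl, hg⟩
    refine ⟨-g, ?_, fun β α h => hg β α fun h1 => h (by simp [h1])⟩
    rw [Finsupp.sum_neg_index]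
    · rw [neg_eq_iff_add_eq_zero, Finsupp.sum, Finsupp.sum, ← Finset.sum_add_distrib]
      exact Finset.sum_eq_zero fun β _ => by
        rw [← add_mul, ← mulOp_add, add_neg_cancel, mulOp_zero, zero_mul]
    · simp [mulOp_zero]

theorem monomial_mem {n : ℕ} {u v : Fin n → ℤ} {k : ℤ} (a : O n) (β : Fin n →₀ ℕ)
    (h : ∀ α, MvPowerSeries.coeff α a.1 ≠ 0 → wt u α + wt v β ≤ k) :
    mulOp a * partialPow β ∈ opFilt u v k := by
  classical
  refine ⟨Finsupp.single β a, by simp [mulOp_zero], fun γ α hα => ?_⟩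
  rw [Finsupp.single_apply] at hα
  split_ifs at hα with hγ
  · subst hγ; exact h α hα
  · simp at hα

theorem opFilt_induction {n : ℕ} {u v : Fin n → ℤ} {k : ℤ} (S : AddSubgroup (Module.End ℂ (O n)))
    (h : ∀ (a : O n) (β : Fin n →₀ ℕ),
      (∀ α, MvPowerSeries.coeff α a.1 ≠ 0 → wt u α + wt v β ≤ k) → mulOp a * partialPow β ∈ S)
    {P : Module.End ℂ (O n)} (hP : P ∈ opFilt u v k) : P ∈ S := by
  obtain ⟨g, rfl, hg⟩ := hP
  exact sum_mem fun β _ => h (g β) β (hg β)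

theorem opFilt_mono {n : ℕ} {u v : Fin n → ℤ} {k l : ℤ} (h : k ≤ l) :
    opFilt u v k ≤ opFilt u v l := by
  rintro P ⟨g, hP, hg⟩
  exact ⟨g, hP, fun β α hα => (hg β α hα).trans h⟩

theorem mulOp_mul_mem {n : ℕ} {u v : Fin n → ℤ} {j k : ℤ} {a : O n}
    (ha : ∀ α, MvPowerSeries.coeff α a.1 ≠ 0 → wt u α ≤ j) {P : Module.End ℂ (O n)}
    (hP : P ∈ opFilt u v k) : mulOp a * P ∈ opFilt u v (j + k) := by
  classical
  refine opFilt_induction (u := u) (v := v) (k := k) ((opFilt u v (j + k)).comap (AddMonoidHom.mulLeft (mulOp a)))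
    (fun b β hb => ?_) hP
  change mulOp a * (mulOp b * partialPow β) ∈ opFilt u v (j + k)
  rw [← mul_assoc, ← mulOp_mul]
  refine monomial_mem _ _ fun α hα => ?_
  change MvPowerSeries.coeff α (a.1 * b.1) ≠ 0 at hα
  rw [MvPowerSeries.coeff_mul] at hα
  obtain ⟨⟨x, y⟩, hxy, hne⟩ := Finset.exists_ne_zero_of_sum_ne_zero hα
  have hx := ha x (left_ne_zero_of_mul hne)
  have hy := hb y (right_ne_zero_of_mul hne)
  rw [← Finset.HasAntidiagonal.mem_antidiagonal.1 hxy, wt_add]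
  linarith

theorem partialOp_mul_mem {n : ℕ} {u v : Fin n → ℤ} (huv : ∀ i, 0 ≤ u i + v i) {k : ℤ}
    (i : Fin n) {P : Module.End ℂ (O n)}
    (hP : P ∈ opFilt u v k) : partialOp i * P ∈ opFilt u v (v i + k) := by
  refine opFilt_induction (u := u) (v := v) (k := k) ((opFilt u v (v i + k)).comap (AddMonoidHom.mulLeft (partialOp i)))
    (fun b β hb => ?_) hP
  change partialOp i * (mulOp b * partialPow β) ∈ opFilt u v (v i + k)
  rw [← mul_assoc, partialOp_mul_mulOp, add_mul, mul_assoc, ← partialPow_single i,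
    ← partialPow_add, partialPow_single i]
  refine add_mem (monomial_mem _ _ fun α hα => ?_) (monomial_mem _ _ fun α hα => ?_)
  · rw [wt_add, wt_single]
    linarith [hb α hα]
  · change MvPowerSeries.coeff α (MvPowerSeries.pderiv ℂ i b.1) ≠ 0 at hα
    rw [MvPowerSeries.coeff_pderiv] at hα
    have := hb _ (left_ne_zero_of_mul hα)
    rw [wt_add, wt_single] at this
    linarith [huv i]

theorem partialPow_mul_mem {n : ℕ} {u v : Fin n → ℤ} (huv : ∀ i, 0 ≤ u i + v i) {k : ℤ}
    (β : Fin n →₀ ℕ) {P : Module.End ℂ (O n)}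
    (hP : P ∈ opFilt u v k) : partialPow β * P ∈ opFilt u v (wt v β + k) := by
  induction β using Finsupp.induction_linear generalizing P k with
  | zero => simpa [partialPow_zero, wt_zero] using hP
  | add β γ hβ hγ =>
    rw [partialPow_add, mul_assoc, wt_add, add_assoc]
    exact hβ (hγ hP)
  | single i m =>
    induction m generalizing P k with
    | zero => simpa [partialPow_zero, wt_zero] using hP
    | succ m ih =>
      rw [Finsupp.single_add, partialPow_add, mul_assoc, wt_add, add_assoc, partialPow_single,
        wt_single]
      exact ih (partialOp_mul_mem huv i hP)

theorem opFilt_mul_mem {n : ℕ} {u v : Fin n → ℤ} (huv : ∀ i, 0 ≤ u i + v i) {k l : ℤ}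
    {P Q : Module.End ℂ (O n)} (hP : P ∈ opFilt u v k) (hQ : Q ∈ opFilt u v l) :
    P * Q ∈ opFilt u v (k + l) := by
  refine opFilt_induction (u := u) (v := v) (k := k)
    ((opFilt u v (k + l)).comap (AddMonoidHom.mulRight Q)) (fun b β hb => ?_) hP
  change mulOp b * partialPow β * Q ∈ opFilt u v (k + l)
  have h := mulOp_mul_mem (j := k - wt v β) (a := b) (fun α hα => by linarith [hb α hα])
    (partialPow_mul_mem huv β hQ)
  rw [mul_assoc]
  convert h using 2
  ring

theorem wt_nonpos {n : ℕ} {u : Fin n → ℤ} (hu : ∀ i, u i ≤ 0) (α : Fin n →₀ ℕ) : wt u α ≤ 0 :=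
  Finset.sum_nonpos fun i _ => mul_nonpos_of_nonpos_of_nonneg (hu i) (Int.natCast_nonneg _)

theorem mulOp_mem {n : ℕ} {u v : Fin n → ℤ} (hu : ∀ i, u i ≤ 0) (a : O n) :
    mulOp a ∈ opFilt u v 0 := by
  have := monomial_mem (u := u) (v := v) (k := 0) a 0
    fun α _ => by rw [wt_zero, add_zero]; exact wt_nonpos hu α
  rwa [partialPow_zero, mul_one] at this

theorem partialOp_mem {n : ℕ} {u v : Fin n → ℤ} (hu : ∀ i, u i ≤ 0) (i : Fin n) :
    partialOp i ∈ opFilt u v (v i) := by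
  have := monomial_mem (u := u) (v := v) (k := v i) 1 (Finsupp.single i 1)
    fun α _ => by rw [wt_single]; linarith [wt_nonpos hu α]
  rwa [partialPow_single, mulOp_one, one_mul] at this

theorem coord_mem {n : ℕ} (u v : Fin n → ℤ) (i : Fin n) :
    mulOp (coord i) ∈ opFilt u v (u i) := by
  classical
  have := monomial_mem (u := u) (v := v) (k := u i) (coord i) 0 fun α hα => by
    change MvPowerSeries.coeff α (MvPowerSeries.X i) ≠ 0 at hα
    rw [MvPowerSeries.coeff_X] at hα
    have h : α = Finsupp.single i 1 := by by_contra h; simp [h] at hα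
    rw [h, wt_single, wt_zero, add_zero]
  rwa [partialPow_zero, mul_one] at this

theorem exists_mem_opFilt {n : ℕ} {u v : Fin n → ℤ} (huv : ∀ i, 0 ≤ u i + v i)
    (hu : ∀ i, u i ≤ 0) {P : Module.End ℂ (O n)} (hP : P ∈ diffOps n) :
    ∃ k, P ∈ opFilt u v k := by
  induction hP using Algebra.adjoin_induction with
  | mem P h =>
    rcases h with ⟨a, rfl⟩ | ⟨i, rfl⟩
    · exact ⟨0, mulOp_mem hu a⟩
    · exact ⟨v i, partialOp_mem hu i⟩
  | algebraMap c =>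
    refine ⟨0, ?_⟩
    have : algebraMap ℂ (Module.End ℂ (O n)) c = mulOp (algebraMap ℂ (O n) c) := by
      ext1 f
      exact Algebra.smul_def c f
    rw [this]
    exact mulOp_mem hu _
  | add P Q _ _ hP hQ =>
    obtain ⟨k, hk⟩ := hP
    obtain ⟨l, hl⟩ := hQ
    exact ⟨max k l, add_mem (opFilt_mono (le_max_left _ _) hk) (opFilt_mono (le_max_right _ _) hl)⟩
  | mul P Q _ _ hP hQ =>
    obtain ⟨k, hk⟩ := hP
    obtain ⟨l, hl⟩ := hQ
    exact ⟨k + l, opFilt_mul_mem huv hk hl⟩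

/-- An admissible weight vector `(u, v) ∈ ℤ^{2n}`: `uᵢ + vᵢ ≥ 0` and `uᵢ ≤ 0` for all `i`. -/
structure Weight (n : ℕ) where
  u : Fin n → ℤ
  v : Fin n → ℤ
  add_nonneg : ∀ i, 0 ≤ u i + v i
  u_nonpos : ∀ i, u i ≤ 0

/-- `F_{d,k}(𝒟) = F_d^{(0,1)}(𝒟) ∩ F_k^{(u,v)}(𝒟)`, indexed by the pair `(d, k)`. -/
def bifilt {n : ℕ} (w : Weight n) (p : ℤ × ℤ) : AddSubgroup (D n) :=
  (opFilt (fun _ => 0) (fun _ => 1) p.1 ⊓ opFilt w.u w.v p.2).comap (D.toEnd n).toAddMonoidHom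

theorem bifilt_mul_mem {n : ℕ} (w : Weight n) {p q : ℤ × ℤ} {P Q : D n}
    (hP : P ∈ bifilt w p) (hQ : Q ∈ bifilt w q) : P * Q ∈ bifilt w (p + q) :=
  ⟨opFilt_mul_mem (fun _ => by simp) hP.1 hQ.1, opFilt_mul_mem w.add_nonneg hP.2 hQ.2⟩

theorem bifilt_mono {n : ℕ} (w : Weight n) {p q : ℤ × ℤ} (h : p ≤ q) :
    bifilt w p ≤ bifilt w q :=
  fun _ hP => ⟨opFilt_mono h.1 hP.1, opFilt_mono h.2 hP.2⟩

theorem one_mem_bifilt {n : ℕ} (w : Weight n) : (1 : D n) ∈ bifilt w 0 := by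
  refine ⟨?_, ?_⟩
  · have := mulOp_mem (u := fun _ => 0) (v := fun _ => 1) (fun _ => le_rfl) (1 : O n)
    rwa [mulOp_one] at this
  · have := mulOp_mem (v := w.v) w.u_nonpos (1 : O n)
    rwa [mulOp_one] at this

theorem exists_mem_bifilt {n : ℕ} (w : Weight n) (P : D n) : ∃ p, P ∈ bifilt w p := by
  obtain ⟨d, hd⟩ := exists_mem_opFilt (u := fun _ => 0) (v := fun _ => 1) (fun _ => by simp)
    (fun _ => le_rfl) P.2
  obtain ⟨k, hk⟩ := exists_mem_opFilt w.add_nonneg w.u_nonpos P.2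
  exact ⟨(d, k), hd, hk⟩

/-- A bifiltration `(F_{d,k}(M))` of a left `𝒟`-module `M`, indexed by the pairs `(d, k)`.
(Each `F_{d,k}(M)` is stable under `ℂ{x} ⊆ F_{0,0}(𝒟)` by `smul_mem`.) -/
structure Bifiltration {n : ℕ} (w : Weight n) (M : Type*) [AddCommGroup M] [Module (D n) M] where
  F : ℤ × ℤ → AddSubgroup M
  mono_left : ∀ d k, F (d, k) ≤ F (d + 1, k)
  mono_right : ∀ d k, F (d, k) ≤ F (d, k + 1)
  exhaust : ∀ x, ∃ p, x ∈ F p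
  smul_mem : ∀ {p q : ℤ × ℤ} {P : D n} {x : M}, P ∈ bifilt w p → x ∈ F q → P • x ∈ F (p + q)

/-- The bifiltration is good: `F_{d,k}(M) = ∑ᵢ F_{d-nᵢ,k-mᵢ}(𝒟) fᵢ` for finitely many elements
`fᵢ` of `M` and pairs `sᵢ = (nᵢ, mᵢ)`. -/
def Bifiltration.IsGood {n : ℕ} {w : Weight n} {M : Type*} [AddCommGroup M] [Module (D n) M]
    (B : Bifiltration w M) : Prop :=
  ∃ (l : ℕ) (f : Fin l → M) (s : Fin l → ℤ × ℤ), ∀ p x,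
    x ∈ B.F p ↔ ∃ P : Fin l → D n, (∀ i, P i ∈ bifilt w (p - s i)) ∧ x = ∑ i, P i • f i

/-- `F_d(M) = ⋃_k F_{d,k}(M)`. -/
def Bifiltration.FPart {n : ℕ} {w : Weight n} {M : Type*} [AddCommGroup M] [Module (D n) M]
    (B : Bifiltration w M) (d : ℤ) : Set M := ⋃ k : ℤ, (B.F (d, k) : Set M)

/-- `V_k(M) = ⋃_d F_{d,k}(M)`. -/
def Bifiltration.VPart {n : ℕ} {w : Weight n} {M : Type*} [AddCommGroup M] [Module (D n) M]
    (B : Bifiltration w M) (k : ℤ) : Set M := ⋃ d : ℤ, (B.F (d, k) : Set M)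

/-- `𝒟` with its own bifiltration. -/
def selfBif {n : ℕ} (w : Weight n) : Bifiltration w (D n) where
  F := bifilt w
  mono_left d k := bifilt_mono w ⟨by simp, le_rfl⟩
  mono_right d k := bifilt_mono w ⟨le_rfl, by simp⟩
  exhaust := exists_mem_bifilt w
  smul_mem hP hx := bifilt_mul_mem w hP hx

/-- For a family `(A_p)` of subgroups of `A`, the family of subgroups of `A^r` shifted by
`s = (s₁, …, s_r)`: in degree `p` it is `A_{p-s₁} ⊕ ⋯ ⊕ A_{p-s_r}`. -/
def shifted {A : Type*} [AddCommGroup A] (𝒜 : ℤ × ℤ → AddSubgroup A) {r : ℕ}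
    (s : Fin r → ℤ × ℤ) (p : ℤ × ℤ) : AddSubgroup (Fin r → A) :=
  AddSubgroup.pi Set.univ fun j => 𝒜 (p - s j)

/-- The bifiltered free module `𝒟^r[𝐧][𝐦]`, where `s j = (n_j, m_j)`. -/
def freeBif {n : ℕ} (w : Weight n) {r : ℕ} (s : Fin r → ℤ × ℤ) :
    Bifiltration w (Fin r → D n) where
  F := shifted (bifilt w) s
  mono_left d k x hx j hj := bifilt_mono w
    (sub_le_sub_right (show ((d, k) : ℤ × ℤ) ≤ (d + 1, k) from ⟨by simp, le_rfl⟩) _) (hx j hj)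
  mono_right d k x hx j hj := bifilt_mono w
    (sub_le_sub_right (show ((d, k) : ℤ × ℤ) ≤ (d, k + 1) from ⟨le_rfl, by simp⟩) _) (hx j hj)
  exhaust x := by
    choose q hq using fun j => exists_mem_bifilt w (x j)
    obtain ⟨p, hp⟩ := (Set.finite_range fun j => q j + s j).bddAbove
    exact ⟨p, fun j _ => bifilt_mono w (le_sub_iff_add_le.2 (hp ⟨j, rfl⟩)) (hq j)⟩
  smul_mem {p q P x} hP hx j hj := by
    have := bifilt_mul_mem w hP (hx j hj)
    rwa [← add_sub_assoc] at this

/-! ### Associated bigraded objects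

For a set `S` of steps, `grLow S F p = ∑_{e ∈ S} F_{p-e}`. With `S = {(1,0), (0,1)}` this is
`F_{d-1,k} + F_{d,k-1}`, and with `S = {(0,1)}` it is `F_{d,k-1}`. -/

/-- The sum of the `F_{p-e}` for `e ∈ S`. -/
def grLow {M : Type*} [AddCommGroup M] (S : Set (ℤ × ℤ)) (F : ℤ × ℤ → AddSubgroup M)
    (p : ℤ × ℤ) : AddSubgroup M := ⨆ e ∈ S, F (p - e)

/-- The quotient `F_p / ∑_{e ∈ S} F_{p-e}`. -/
abbrev GrPiece {M : Type*} [AddCommGroup M] (S : Set (ℤ × ℤ)) (F : ℤ × ℤ → AddSubgroup M)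
    (p : ℤ × ℤ) : Type _ := F p ⧸ (grLow S F p).addSubgroupOf (F p)

theorem map_grLow {M N : Type*} [AddCommGroup M] [AddCommGroup N] (S : Set (ℤ × ℤ))
    {F : ℤ × ℤ → AddSubgroup M} {G : ℤ × ℤ → AddSubgroup N} (f : M →+ N) {p q : ℤ × ℤ}
    (h : ∀ e, ∀ x ∈ F (p - e), f x ∈ G (q - e)) {x : M} (hx : x ∈ grLow S F p) :
    f x ∈ grLow S G q := by
  suffices grLow S F p ≤ (grLow S G q).comap f from this hx
  refine iSup₂_le fun e he y hy => ?_
  exact (le_iSup₂ (f := fun e (_ : e ∈ S) => G (q - e)) e he) (h e y hy)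

theorem smul_low_mem {n : ℕ} {w : Weight n} {M : Type*} [AddCommGroup M] [Module (D n) M]
    (B : Bifiltration w M) (S : Set (ℤ × ℤ)) {p q : ℤ × ℤ} {P : D n} {x : M}
    (hP : P ∈ bifilt w p) (hx : x ∈ grLow S B.F q) : P • x ∈ grLow S B.F (p + q) :=
  map_grLow S (DistribSMul.toAddMonoidHom M P) (fun e y hy => by
    rw [add_sub_assoc]; exact B.smul_mem hP hy) hx

theorem low_smul_mem {n : ℕ} {w : Weight n} {M : Type*} [AddCommGroup M] [Module (D n) M]
    (B : Bifiltration w M) (S : Set (ℤ × ℤ)) {p q : ℤ × ℤ} {P : D n} {x : M}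
    (hP : P ∈ grLow S (bifilt w) p) (hx : x ∈ B.F q) : P • x ∈ grLow S B.F (p + q) :=
  map_grLow S ((AddMonoidHom.smul (R := D n) (M := M)).flip x) (fun e y hy => by
    rw [add_sub_right_comm]; exact B.smul_mem hy hx) hP

/-- The action `(P, x) ↦ P x` on classes,
`F_p(𝒟)/∑F_{p-e}(𝒟) × F_q(M)/∑F_{q-e}(M) → F_{p+q}(M)/∑F_{p+q-e}(M)`. -/
def pieceSMul {n : ℕ} {w : Weight n} {M : Type*} [AddCommGroup M] [Module (D n) M]
    (B : Bifiltration w M) (S : Set (ℤ × ℤ)) (p q : ℤ × ℤ) :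
    GrPiece S (bifilt w) p →+ GrPiece S B.F q →+ GrPiece S B.F (p + q) :=
  QuotientAddGroup.lift _
    (AddMonoidHom.mk' (fun P => QuotientAddGroup.lift _
        (AddMonoidHom.mk' (fun x => QuotientAddGroup.mk ⟨P.1 • x.1, B.smul_mem P.2 x.2⟩)
          (fun x y => congrArg QuotientAddGroup.mk (Subtype.ext (smul_add P.1 x.1 y.1))))
        (fun x hx => (QuotientAddGroup.eq_zero_iff _).2 (smul_low_mem B S P.2 hx)))
      (fun P Q => by
        ext x
        exact congrArg QuotientAddGroup.mk (Subtype.ext (add_smul P.1 Q.1 x.1))))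
    (fun P hP => by
      ext x
      exact (QuotientAddGroup.eq_zero_iff _).2 (low_smul_mem B S hP x.2))

theorem grPiece_mk_eq {M : Type*} [AddCommGroup M] {S : Set (ℤ × ℤ)}
    {F : ℤ × ℤ → AddSubgroup M} {p q : ℤ × ℤ} (h : p = q) {x : F p} {y : F q}
    (hxy : (x : M) = y) :
    GradedMonoid.mk (A := GrPiece S F) p (QuotientAddGroup.mk x) =
      GradedMonoid.mk q (QuotientAddGroup.mk y) := by
  subst h
  obtain rfl : x = y := Subtype.ext hxy
  rfl

/-- The class of `1`. -/
def grOne {n : ℕ} (w : Weight n) (S : Set (ℤ × ℤ)) : GrPiece S (bifilt w) 0 :=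
  QuotientAddGroup.mk ⟨1, one_mem_bifilt w⟩

instance grPieceOne {n : ℕ} (w : Weight n) (S : Set (ℤ × ℤ)) :
    GradedMonoid.GOne (GrPiece S (bifilt w)) := ⟨grOne w S⟩

instance grPieceMul {n : ℕ} (w : Weight n) (S : Set (ℤ × ℤ)) :
    GradedMonoid.GMul (GrPiece S (bifilt w)) := ⟨fun {p q} a b => pieceSMul (selfBif w) S p q a b⟩

instance grPieceMonoid {n : ℕ} (w : Weight n) (S : Set (ℤ × ℤ)) :
    GradedMonoid.GMonoid (GrPiece S (bifilt w)) where
  __ := grPieceOne w S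
  __ := grPieceMul w S
  one_mul := by
    rintro ⟨p, ⟨x⟩⟩
    exact grPiece_mk_eq (zero_add p) (one_mul x.1)
  mul_one := by
    rintro ⟨p, ⟨x⟩⟩
    exact grPiece_mk_eq (add_zero p) (mul_one x.1)
  mul_assoc := by
    rintro ⟨p, ⟨x⟩⟩ ⟨q, ⟨y⟩⟩ ⟨r, ⟨z⟩⟩
    exact grPiece_mk_eq (add_assoc p q r) (mul_assoc x.1 y.1 z.1)

instance grPieceRing {n : ℕ} (w : Weight n) (S : Set (ℤ × ℤ)) :
    DirectSum.GRing (GrPiece S (bifilt w)) where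
  __ := grPieceMonoid w S
  mul_zero {p q} a := map_zero (pieceSMul (selfBif w) S p q a)
  zero_mul {p q} b := DFunLike.congr_fun (map_zero (pieceSMul (selfBif w) S p q)) b
  mul_add {p q} a b c := map_add (pieceSMul (selfBif w) S p q a) b c
  add_mul {p q} a b c := DFunLike.congr_fun (map_add (pieceSMul (selfBif w) S p q) a b) c
  natCast m := m • grOne w S
  natCast_zero := zero_nsmul (grOne w S)
  natCast_succ m := succ_nsmul (grOne w S) m
  intCast m := m • grOne w S
  intCast_ofNat m := natCast_zsmul (grOne w S) m
  intCast_negSucc_ofNat m := negSucc_zsmul (grOne w S) m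

instance grPieceModule {n : ℕ} {w : Weight n} {M : Type*} [AddCommGroup M] [Module (D n) M]
    (B : Bifiltration w M) (S : Set (ℤ × ℤ)) :
    DirectSum.Gmodule (GrPiece S (bifilt w)) (GrPiece S B.F) where
  smul {p q} a b := pieceSMul B S p q a b
  one_smul := by
    rintro ⟨p, ⟨x⟩⟩
    exact grPiece_mk_eq (zero_add p) (one_smul (D n) x.1)
  mul_smul := by
    rintro ⟨p, ⟨x⟩⟩ ⟨q, ⟨y⟩⟩ ⟨r, ⟨z⟩⟩
    exact grPiece_mk_eq (add_assoc p q r) (mul_smul x.1 y.1 z.1)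
  smul_add {p q} a b c := map_add (pieceSMul B S p q a) b c
  smul_zero {p q} a := map_zero (pieceSMul B S p q a)
  add_smul {p q} a b c := DFunLike.congr_fun (map_add (pieceSMul B S p q) a b) c
  zero_smul {p q} b := DFunLike.congr_fun (map_zero (pieceSMul B S p q)) b

/-- The bigraded ring `⨁_p F_p(𝒟) / ∑_{e ∈ S} F_{p-e}(𝒟)`. -/
def GrRing {n : ℕ} (w : Weight n) (S : Set (ℤ × ℤ)) : Type := ⨁ p, GrPiece S (bifilt w) p

instance {n : ℕ} (w : Weight n) (S : Set (ℤ × ℤ)) : Ring (GrRing w S) :=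
  inferInstanceAs (Ring (⨁ p, GrPiece S (bifilt w) p))

/-- The bigraded module `⨁_p F_p(M) / ∑_{e ∈ S} F_{p-e}(M)`. -/
def GrMod {n : ℕ} {w : Weight n} {M : Type*} [AddCommGroup M] [Module (D n) M]
    (B : Bifiltration w M) (S : Set (ℤ × ℤ)) : Type _ := ⨁ p, GrPiece S B.F p

instance {n : ℕ} {w : Weight n} {M : Type*} [AddCommGroup M] [Module (D n) M]
    (B : Bifiltration w M) (S : Set (ℤ × ℤ)) : AddCommGroup (GrMod B S) :=
  inferInstanceAs (AddCommGroup (⨁ p, GrPiece S B.F p))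

instance {n : ℕ} {w : Weight n} {M : Type*} [AddCommGroup M] [Module (D n) M]
    (B : Bifiltration w M) (S : Set (ℤ × ℤ)) : Module (GrRing w S) (GrMod B S) :=
  inferInstanceAs (Module (⨁ p, GrPiece S (bifilt w) p) (⨁ p, GrPiece S B.F p))

/-- The homogeneous part of degree `p` of the bigraded ring. -/
def grRingPart {n : ℕ} (w : Weight n) (S : Set (ℤ × ℤ)) (p : ℤ × ℤ) : AddSubgroup (GrRing w S) :=
  (DirectSum.of (GrPiece S (bifilt w)) p).range

/-- The homogeneous part of degree `p` of the bigraded module. -/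
def grModPart {n : ℕ} {w : Weight n} {M : Type*} [AddCommGroup M] [Module (D n) M]
    (B : Bifiltration w M) (S : Set (ℤ × ℤ)) (p : ℤ × ℤ) : AddSubgroup (GrMod B S) :=
  (DirectSum.of (GrPiece S B.F) p).range

/-- The class of `xᵢ` in bidegree `(0, uᵢ)`. -/
def coordClass {n : ℕ} (w : Weight n) (S : Set (ℤ × ℤ)) (i : Fin n) : GrRing w S :=
  DirectSum.of (GrPiece S (bifilt w)) (0, w.u i)
    (QuotientAddGroup.mk ⟨⟨mulOp (coord i), Algebra.subset_adjoin (Or.inl ⟨_, rfl⟩)⟩,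
      mulOp_mem (fun _ => le_rfl) _, coord_mem w.u w.v i⟩)

/-- The two-sided ideal `𝔪` generated by the classes of `x₁, …, xₙ` and by all elements of
bidegree `(1, k)`, `k ∈ ℤ`. -/
def maxIdeal {n : ℕ} (w : Weight n) (S : Set (ℤ × ℤ)) : TwoSidedIdeal (GrRing w S) :=
  TwoSidedIdeal.span
    (Set.range (coordClass w S) ∪ ⋃ k : ℤ, (grRingPart w S (1, k) : Set (GrRing w S)))

section GrMap

variable {n : ℕ} {w : Weight n} {M N : Type*} [AddCommGroup M] [Module (D n) M]
  [AddCommGroup N] [Module (D n) N]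

/-- The map induced on `F_p / ∑_{e ∈ S} F_{p-e}`. -/
def pieceMap (B : Bifiltration w M) (C : Bifiltration w N)
    (S : Set (ℤ × ℤ)) (f : M →ₗ[D n] N) (hf : ∀ p, ∀ x ∈ B.F p, f x ∈ C.F p) (p : ℤ × ℤ) :
    GrPiece S B.F p →+ GrPiece S C.F p :=
  QuotientAddGroup.map _ _
    (AddMonoidHom.mk' (fun x : B.F p => (⟨f x.1, hf p x.1 x.2⟩ : C.F p))
      (fun x y => Subtype.ext (map_add f x.1 y.1)))
    (fun _ hx => map_grLow S (f : M →+ N) (fun e y hy => hf (p - e) y hy) hx)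

theorem map_pieceMap_smul (B : Bifiltration w M) (C : Bifiltration w N)
    (S : Set (ℤ × ℤ)) (f : M →ₗ[D n] N) (hf : ∀ p, ∀ x ∈ B.F p, f x ∈ C.F p)
    (a : ⨁ p, GrPiece S (bifilt w) p) (x : ⨁ p, GrPiece S B.F p) :
    DirectSum.map (pieceMap B C S f hf) (a • x) = a • DirectSum.map (pieceMap B C S f hf) x := by
  induction a using DirectSum.induction_on with
  | zero => rw [zero_smul, map_zero, zero_smul]
  | add a b ha hb => rw [add_smul, map_add, ha, hb, add_smul]
  | of p a =>
    induction x using DirectSum.induction_on with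
    | zero => rw [smul_zero, map_zero, smul_zero]
    | add x y hx hy => rw [smul_add, map_add, hx, hy, map_add, smul_add]
    | of q x =>
      rw [DirectSum.Gmodule.of_smul_of, DirectSum.map_of, DirectSum.map_of,
        DirectSum.Gmodule.of_smul_of]
      obtain ⟨a⟩ := a
      obtain ⟨x⟩ := x
      exact congrArg (DirectSum.of (GrPiece S C.F) (p + q))
        (congrArg QuotientAddGroup.mk (Subtype.ext (map_smul f a.1 x.1)))

/-- The map induced on associated bigraded modules by a `𝒟`-linear map that respects the
bifiltrations. -/
def grMap (B : Bifiltration w M) (C : Bifiltration w N)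
    (S : Set (ℤ × ℤ)) (f : M →ₗ[D n] N) (hf : ∀ p, ∀ x ∈ B.F p, f x ∈ C.F p) :
    GrMod B S →ₗ[GrRing w S] GrMod C S where
  toFun := DirectSum.map (pieceMap B C S f hf)
  map_add' := map_add (DirectSum.map (pieceMap B C S f hf))
  map_smul' := map_pieceMap_smul B C S f hf

end GrMap

/-! ### Resolutions -/

/-- Let `A` be a ring with homogeneous parts `𝒜 p` and `𝔪` a two-sided ideal, and `N` an
`A`-module with homogeneous parts `𝒩 p`. The sequence `⋯ → X 1 → X 0 → N → 0` is a minimal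
bigraded free resolution of `N` with Betti numbers `r i` and shifts `s i j = (n_j, m_j)`: it is an
exact sequence of bigraded maps, `X i ≅ A^{r i}[𝐧][𝐦]` as bigraded modules, and the image of
`X (i + 1)` lies in `𝔪 (X i)`. -/
structure IsMinimalResolution {A : Type*} [Ring A] (𝒜 : ℤ × ℤ → AddSubgroup A)
    (𝔪 : TwoSidedIdeal A) {N : Type*} [AddCommGroup N] [Module A N] (𝒩 : ℤ × ℤ → AddSubgroup N)
    {X : ℕ → Type*} [∀ i, AddCommGroup (X i)] [∀ i, Module A (X i)]
    (𝒳 : ∀ i, ℤ × ℤ → AddSubgroup (X i)) (φ : ∀ i, X (i + 1) →ₗ[A] X i) (ε : X 0 →ₗ[A] N)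
    {r : ℕ → ℕ} (s : ∀ i, Fin (r i) → ℤ × ℤ) : Prop where
  free : ∀ i, ∃ e : X i ≃ₗ[A] (Fin (r i) → A), ∀ p x, x ∈ 𝒳 i p ↔ e x ∈ shifted 𝒜 (s i) p
  map_mem : ∀ i p, ∀ x ∈ 𝒳 (i + 1) p, φ i x ∈ 𝒳 i p
  aug_mem : ∀ p, ∀ x ∈ 𝒳 0 p, ε x ∈ 𝒩 p
  exact : ∀ i, Function.Exact (φ (i + 1)) (φ i)
  exact_aug : Function.Exact (φ 0) ε
  surjective : Function.Surjective ε
  minimal : ∀ i x, φ i x ∈ Submodule.span A {y | ∃ a ∈ 𝔪, ∃ z : X i, y = a • z}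

/-- A bifiltered free resolution `⋯ → ℒ₁ → ℒ₀ → M → 0`, with `ℒ i = 𝒟^{r i}[𝐧][𝐦]` where
`r = rank` and `shift i j = (n_j, m_j)`: it is exact, and
`⋯ → F_{d,k}(ℒ₁) → F_{d,k}(ℒ₀) → F_{d,k}(M) → 0` is an exact sequence for all `d, k`. -/
structure BifilteredFreeResolution {n : ℕ} {w : Weight n} {M : Type*} [AddCommGroup M]
    [Module (D n) M] (B : Bifiltration w M) where
  rank : ℕ → ℕ
  shift : ∀ i, Fin (rank i) → ℤ × ℤ
  φ : ∀ i, (Fin (rank (i + 1)) → D n) →ₗ[D n] (Fin (rank i) → D n)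
  ε : (Fin (rank 0) → D n) →ₗ[D n] M
  exact : ∀ i, Function.Exact (φ (i + 1)) (φ i)
  exact_aug : Function.Exact (φ 0) ε
  surjective : Function.Surjective ε
  map_mem : ∀ i p, ∀ x ∈ (freeBif w (shift (i + 1))).F p, φ i x ∈ (freeBif w (shift i)).F p
  aug_mem : ∀ p, ∀ x ∈ (freeBif w (shift 0)).F p, ε x ∈ B.F p
  filt_exact : ∀ i p, ∀ x ∈ (freeBif w (shift (i + 1))).F p, φ i x = 0 →
    ∃ y ∈ (freeBif w (shift (i + 2))).F p, φ (i + 1) y = x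
  filt_exact_aug : ∀ p, ∀ x ∈ (freeBif w (shift 0)).F p, ε x = 0 →
    ∃ y ∈ (freeBif w (shift 1)).F p, φ 0 y = x
  filt_surjective : ∀ p, ∀ x ∈ B.F p, ∃ y ∈ (freeBif w (shift 0)).F p, ε y = x

namespace BifilteredFreeResolution

variable {n : ℕ} {w : Weight n} {M : Type*} [AddCommGroup M] [Module (D n) M]
  {B : Bifiltration w M}

/-- The sequence of bigraded modules `⨁_p F_p / ∑_{e ∈ S} F_{p-e}` that the bifiltered free
resolution induces is a minimal bigraded free resolution. -/
def InducesMinimal (R : BifilteredFreeResolution B) (S : Set (ℤ × ℤ)) : Prop :=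
  IsMinimalResolution (grRingPart w S) (maxIdeal w S) (grModPart B S)
    (fun i => grModPart (freeBif w (R.shift i)) S)
    (fun i => grMap (freeBif w (R.shift (i + 1))) (freeBif w (R.shift i)) S (R.φ i) (R.map_mem i))
    (grMap (freeBif w (R.shift 0)) B S R.ε R.aug_mem) R.shift

/-- Bifiltered isomorphism of bifiltered free resolutions of `M` (over the identity of `M`). -/
def Iso (R R' : BifilteredFreeResolution B) : Prop :=
  ∃ e : ∀ i, (Fin (R.rank i) → D n) ≃ₗ[D n] (Fin (R'.rank i) → D n),
    (∀ i p x, x ∈ (freeBif w (R.shift i)).F p ↔ e i x ∈ (freeBif w (R'.shift i)).F p) ∧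
    (∀ i x, e i (R.φ i x) = R'.φ i (e (i + 1) x)) ∧
    ∀ x, R'.ε (e 0 x) = R.ε x

end BifilteredFreeResolution

/-- The steps `(1,0), (0,1)`: the associated bigraded object is
`bigr = ⨁_{d,k} F_{d,k} / (F_{d-1,k} + F_{d,k-1})`. -/
abbrev bigrSteps : Set (ℤ × ℤ) := {(1, 0), (0, 1)}

/-- The step `(0,1)`: the associated bigraded object is
`gr^V(𝐑(·)) = ⨁_{d,k} F_{d,k} T^d / F_{d,k-1} T^d`, where `𝐑` is the Rees functor. For `𝒟` itself it
is `gr^V(𝐑(𝒟)) ≅ gr^V(𝒟^{(h)})`, the homogenizing variable `h` being the class of `1` in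
bidegree `(1,0)`. -/
abbrev reesSteps : Set (ℤ × ℤ) := {(0, 1)}

/-- The ring `bigr 𝒟`. -/
abbrev BigrRing {n : ℕ} (w : Weight n) : Type := GrRing w bigrSteps

/-- The module `bigr M`. -/
abbrev BigrMod {n : ℕ} {w : Weight n} {M : Type*} [AddCommGroup M] [Module (D n) M]
    (B : Bifiltration w M) : Type _ := GrMod B bigrSteps

/-- A bifiltered free resolution is minimal if it induces a minimal bigraded free resolution of
`gr^V(𝐑(M))` over `gr^V(𝐑(𝒟))`. -/
def BifilteredFreeResolution.IsMinimal {n : ℕ} {w : Weight n} {M : Type*} [AddCommGroup M]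
    [Module (D n) M] {B : Bifiltration w M} (R : BifilteredFreeResolution B) : Prop :=
  R.InducesMinimal reesSteps

/-- The bifiltered free resolution induces a minimal bigraded free resolution of `bigr M` over
`bigr 𝒟`. -/
def BifilteredFreeResolution.InducesMinimalBigr {n : ℕ} {w : Weight n} {M : Type*}
    [AddCommGroup M] [Module (D n) M] {B : Bifiltration w M}
    (R : BifilteredFreeResolution B) : Prop :=
  R.InducesMinimal bigrSteps

end BifilteredD

end

/-!
The bifiltration of `𝒟` and the bigradings of its associated rings are families `(𝒜_p)` of
subgroups, indexed by `p ∈ ℤ²`, that behave like the bihomogeneous parts of a bigraded local ring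
with residue field `ℂ`: evaluation at `0` defines an additive map `χ` to `ℂ`, and the elements of
`𝒜_0` on which `χ` does not vanish are units (`IsLocalFamily`). For such a family, Nakayama's lemma
(`IsLocalFamily.nakayama`) holds without any finiteness hypothesis on the module, because the
generators can be eliminated one at a time as in Gaussian elimination. Hence minimal covers by free
modules are unique (`IsLocalFamily.exists_equiv`), they exist as soon as there are finitely many
generators (`IsLocalFamily.exists_minimalCover`), minimal resolutions are unique
(`IsMinimalFamilyResolution.exists_iso`), and isomorphic free modules have the same shifts up to
order (`IsLocalFamily.exists_perm`). These facts apply to `𝒟` itself and to `bigr 𝒟` alike.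

Write `gr_S` for the associated bigraded object in which the steps `S` are divided out, so that
`gr^V(𝐑(-))` is the case `S = {(0, 1)}` and `bigr` the case `S = {(1, 0), (0, 1)}`. In both cases the
ideal `𝔪` consists of the elements whose part of degree `0` vanishes at `0` (`mem_maxIdeal_iff`).
Therefore `im φ ⊆ 𝔪 𝓛` says that the matrix entries of `φ` between basis vectors of the same degree
vanish at `0`, a condition on the bifiltered complex that does not involve `S`
(`BifilteredFreeResolution.inducesMinimal_iff`). It remains to see that the induced complexes are
exact. This follows from strictness with respect to the lower order terms (`grMap_exact`), which is
automatic for `gr^V(𝐑(-))`. For `bigr` it is propagated along the resolution from `M`, where it is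
the hypothesis `F_{d,k}(M) = F_d(M) ∩ V_k(M)`.

A minimal bifiltered resolution exists because a submodule of `𝒟^r`, with the induced bifiltration,
has finitely many generators (`exists_generators_of_submodule`). Its symbols with respect to the
step `(1, 0)` alone generate a submodule of a finite free module over
`⨁ F_{d,k}(𝒟) / F_{d-1,k}(𝒟)`. This ring is commutative, and a quotient of a polynomial ring over
`ℂ{x}`, hence Noetherian; lifts of generators are generators by induction on the order. That `ℂ{x}`
is Noetherian (`isNoetherianRing_O`) is proved by division with respect to a monomial order, with
weighted norms that make the leading terms dominate.
-/

noncomputable section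

namespace BifilteredD

/-! ### Local families of subgroups of a ring -/

/-- A family `(𝒜_p)` of subgroups of a ring `A` that behaves like the bihomogeneous parts of a
bigraded local ring with residue field `ℂ`: it is multiplicative, `χ` restricts to a ring
homomorphism on `𝒜_0` that kills the products `𝒜_p 𝒜_{-p}` with `p ≠ 0`, and an element of `𝒜_0`
with `χ a ≠ 0` is invertible in `𝒜_0`. The sum of the `𝒜_p` need not be direct, so that the
bifiltration of `𝒟` and the bigrading of `bigr 𝒟` are both examples. -/
structure IsLocalFamily {A : Type*} [Ring A] (𝒜 : ℤ × ℤ → AddSubgroup A) (χ : A →+ ℂ) : Prop where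
  one_mem : 1 ∈ 𝒜 0
  mul_mem : ∀ {p q : ℤ × ℤ} {a b : A}, a ∈ 𝒜 p → b ∈ 𝒜 q → a * b ∈ 𝒜 (p + q)
  map_one : χ 1 = 1
  map_mul : ∀ {a b : A}, a ∈ 𝒜 0 → b ∈ 𝒜 0 → χ (a * b) = χ a * χ b
  map_mul_of_ne : ∀ {p q : ℤ × ℤ} {a b : A}, a ∈ 𝒜 p → b ∈ 𝒜 q → p + q = 0 → p ≠ 0 →
    χ (a * b) = 0
  exists_inv : ∀ {a : A}, a ∈ 𝒜 0 → χ a ≠ 0 → ∃ b ∈ 𝒜 0, b * a = 1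

/-- A family `(G_p)` of subgroups of an `A`-module is stable if `𝒜_p G_q ⊆ G_{p+q}`. -/
def IsStable {A T : Type*} [Ring A] [AddCommGroup T] [Module A T] (𝒜 : ℤ × ℤ → AddSubgroup A)
    (G : ℤ × ℤ → AddSubgroup T) : Prop :=
  ∀ p q : ℤ × ℤ, ∀ a ∈ 𝒜 p, ∀ x ∈ G q, a • x ∈ G (p + q)

/-- The degree `p` part of the bigraded maximal ideal: all of `𝒜_p` if `p ≠ 0`, and the kernel of
`χ` on `𝒜_0` if `p = 0`. -/
def rad {A : Type*} [Ring A] (𝒜 : ℤ × ℤ → AddSubgroup A) (χ : A →+ ℂ) (p : ℤ × ℤ) :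
    AddSubgroup A where
  carrier := {a | a ∈ 𝒜 p ∧ (p = 0 → χ a = 0)}
  zero_mem' := ⟨zero_mem _, fun _ => map_zero χ⟩
  add_mem' ha hb := ⟨add_mem ha.1 hb.1, fun h => by rw [map_add, ha.2 h, hb.2 h, add_zero]⟩
  neg_mem' ha := ⟨neg_mem ha.1, fun h => by rw [map_neg, ha.2 h, neg_zero]⟩

section

variable {A : Type*} [Ring A] {𝒜 : ℤ × ℤ → AddSubgroup A} {χ : A →+ ℂ}

theorem IsLocalFamily.mul_mem_rad (hA : IsLocalFamily 𝒜 χ) {p q : ℤ × ℤ} {a b : A} (ha : a ∈ 𝒜 p)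
    (hb : b ∈ rad 𝒜 χ q) : a * b ∈ rad 𝒜 χ (p + q) := by
  refine ⟨hA.mul_mem ha hb.1, fun h => ?_⟩
  by_cases hp : p = 0
  · subst hp
    rw [zero_add] at h
    subst h
    rw [hA.map_mul ha hb.1, hb.2 rfl, mul_zero]
  · exact hA.map_mul_of_ne ha hb.1 h hp

theorem IsLocalFamily.rad_mul_mem (hA : IsLocalFamily 𝒜 χ) {p q : ℤ × ℤ} {a b : A}
    (ha : a ∈ rad 𝒜 χ p) (hb : b ∈ 𝒜 q) : a * b ∈ rad 𝒜 χ (p + q) := by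
  refine ⟨hA.mul_mem ha.1 hb, fun h => ?_⟩
  by_cases hp : p = 0
  · subst hp
    rw [zero_add] at h
    subst h
    rw [hA.map_mul ha.1 hb, ha.2 rfl, zero_mul]
  · exact hA.map_mul_of_ne ha.1 hb h hp

/-- Nakayama's lemma for families: if modulo `G` each `e i` is a combination of the `e l` with
coefficients in the maximal ideal, then all `e i` lie in `G`. The `e i` are eliminated one by one,
as in Gaussian elimination; no finiteness or separation property of the family is used. -/
theorem IsLocalFamily.nakayama (hA : IsLocalFamily 𝒜 χ) {T : Type*} [AddCommGroup T] [Module A T]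
    (G : ℤ × ℤ → AddSubgroup T) (hG : IsStable 𝒜 G)
    {ι : Type*} (J : Finset ι) (s : ι → ℤ × ℤ) (e : ι → T) (m : ι → ι → A)
    (hm : ∀ i ∈ J, ∀ l ∈ J, m i l ∈ rad 𝒜 χ (s i - s l))
    (h : ∀ i ∈ J, e i - ∑ l ∈ J, m i l • e l ∈ G (s i)) : ∀ i ∈ J, e i ∈ G (s i) := by
  classical
  induction J using Finset.induction_on generalizing m with
  | empty => simp
  | insert j J hj ih =>
    have hjj := hm j (Finset.mem_insert_self _ _) j (Finset.mem_insert_self _ _)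
    rw [sub_self] at hjj
    obtain ⟨b, hb, hb1⟩ := hA.exists_inv (a := 1 - m j j) (sub_mem hA.one_mem hjj.1) (by
      rw [map_sub, hA.map_one, hjj.2 rfl, sub_zero]; exact one_ne_zero)
    have hgj := h j (Finset.mem_insert_self _ _)
    rw [Finset.sum_insert hj] at hgj
    set g := e j - (m j j • e j + ∑ l ∈ J, m j l • e l) with hg
    have hbg : b • g ∈ G (s j) := by simpa using hG _ _ _ hb _ hgj
    have hej : e j = b • g + ∑ l ∈ J, (b * m j l) • e l := by
      have h1 : g = (1 - m j j) • e j - ∑ l ∈ J, m j l • e l := by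
        rw [hg, sub_smul, one_smul]; abel
      rw [h1, smul_sub, smul_smul, hb1, one_smul, Finset.smul_sum]
      simp [smul_smul]
    have hbm : ∀ l ∈ J, b * m j l ∈ rad 𝒜 χ (s j - s l) := fun l hl => by
      simpa using hA.mul_mem_rad hb
        (hm j (Finset.mem_insert_self _ _) l (Finset.mem_insert_of_mem hl))
    have key : ∀ i ∈ J, e i ∈ G (s i) := by
      refine ih (fun i l => m i l + m i j * (b * m j l)) (fun i hi l hl => ?_) (fun i hi => ?_)
      · refine add_mem (hm i (Finset.mem_insert_of_mem hi) l (Finset.mem_insert_of_mem hl)) ?_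
        have := hA.rad_mul_mem (hm i (Finset.mem_insert_of_mem hi) j (Finset.mem_insert_self _ _))
          (hbm l hl).1
        rwa [sub_add_sub_cancel] at this
      · have h1 := h i (Finset.mem_insert_of_mem hi)
        have h2 := hG _ _ _
          (hm i (Finset.mem_insert_of_mem hi) j (Finset.mem_insert_self _ _)).1 _ hbg
        rw [sub_add_cancel] at h2
        have h3 := add_mem h1 h2
        have h4 : m i j • e j = m i j • b • g + ∑ l ∈ J, (m i j * (b * m j l)) • e l := by
          conv_lhs => rw [hej]
          rw [smul_add, Finset.smul_sum]
          simp [smul_smul]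
        convert h3 using 1
        rw [Finset.sum_insert hj, h4]
        simp only [add_smul, Finset.sum_add_distrib]
        abel
    intro i hi
    rcases Finset.mem_insert.1 hi with rfl | hi
    · rw [hej]
      refine add_mem hbg (sum_mem fun l hl => ?_)
      have := hG _ _ _ (hbm l hl).1 _ (key l hl)
      rwa [sub_add_cancel] at this
    · exact key i hi

/-- The standard basis vectors of `A^r`. -/
def stdVec (A : Type*) [Ring A] {r : ℕ} (j : Fin r) : Fin r → A := Pi.single j 1

theorem stdVec_same {r : ℕ} (j : Fin r) : stdVec A j j = 1 := Pi.single_eq_same j 1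

theorem stdVec_of_ne {r : ℕ} {j l : Fin r} (h : l ≠ j) : stdVec A j l = 0 := Pi.single_eq_of_ne h 1

theorem sum_smul_stdVec {r : ℕ} (x : Fin r → A) : ∑ j, x j • stdVec A j = x :=
  (pi_eq_sum_univ' x).symm

theorem linearCombination_stdVec {T : Type*} [AddCommGroup T] [Module A T] {r : ℕ} (y : Fin r → T)
    (j : Fin r) : Fintype.linearCombination A y (stdVec A j) = y j :=
  (Fintype.linearCombination_apply_single A y j 1).trans (one_smul A _)

theorem map_eq_sum_single {T : Type*} [AddCommGroup T] [Module A T] {r : ℕ}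
    (f : (Fin r → A) →ₗ[A] T) (x : Fin r → A) : f x = ∑ j, x j • f (stdVec A j) := by
  conv_lhs => rw [← sum_smul_stdVec x]
  simp only [map_sum, map_smul]

theorem mem_shifted {r : ℕ} {s : Fin r → ℤ × ℤ} {p : ℤ × ℤ} {x : Fin r → A} :
    x ∈ shifted 𝒜 s p ↔ ∀ j, x j ∈ 𝒜 (p - s j) :=
  ⟨fun h j => h j trivial, fun h j _ => h j⟩

theorem IsLocalFamily.single_mem (hA : IsLocalFamily 𝒜 χ) {r : ℕ} (s : Fin r → ℤ × ℤ) (j : Fin r) :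
    stdVec A j ∈ shifted 𝒜 s (s j) := by
  refine mem_shifted.2 fun l => ?_
  by_cases h : l = j
  · subst h
    rw [stdVec_same, sub_self]
    exact hA.one_mem
  · rw [stdVec_of_ne h]
    exact zero_mem _

theorem IsLocalFamily.isStable_shifted (hA : IsLocalFamily 𝒜 χ) {r : ℕ} (s : Fin r → ℤ × ℤ) :
    IsStable 𝒜 (shifted 𝒜 s) := by
  intro p q a ha x hx
  refine mem_shifted.2 fun j => ?_
  have := hA.mul_mem ha (mem_shifted.1 hx j)
  rwa [← add_sub_assoc] at this

theorem sum_smul_mem {T : Type*} [AddCommGroup T] [Module A T]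
    {G : ℤ × ℤ → AddSubgroup T} (hG : IsStable 𝒜 G)
    {r : ℕ} {s : Fin r → ℤ × ℤ} {y : Fin r → T} (hy : ∀ j, y j ∈ G (s j)) {p : ℤ × ℤ}
    {x : Fin r → A} (hx : x ∈ shifted 𝒜 s p) : ∑ j, x j • y j ∈ G p :=
  sum_mem fun j _ => by
    have := hG _ _ _ (mem_shifted.1 hx j) _ (hy j)
    rwa [sub_add_cancel] at this

/-- A bihomogeneous endomorphism of a free module that is the identity modulo the maximal ideal. -/
def IsUnipotent (𝒜 : ℤ × ℤ → AddSubgroup A) (χ : A →+ ℂ) {r : ℕ} (s : Fin r → ℤ × ℤ)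
    (h : (Fin r → A) →ₗ[A] (Fin r → A)) : Prop :=
  ∀ j l, (h (stdVec A j) - stdVec A j) l ∈ rad 𝒜 χ (s j - s l)

theorem IsUnipotent.exists_preimage (hA : IsLocalFamily 𝒜 χ) {r : ℕ} {s : Fin r → ℤ × ℤ}
    {h : (Fin r → A) →ₗ[A] (Fin r → A)} (hh : IsUnipotent 𝒜 χ s h) {p : ℤ × ℤ} {x : Fin r → A}
    (hx : x ∈ shifted 𝒜 s p) : ∃ y ∈ shifted 𝒜 s p, h y = x := by
  let G : ℤ × ℤ → AddSubgroup (Fin r → A) := fun p => (shifted 𝒜 s p).map h.toAddMonoidHom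
  have hG : IsStable 𝒜 G := by
    rintro p q a ha _ ⟨y, hy, rfl⟩
    exact ⟨a • y, hA.isStable_shifted s _ _ _ ha _ hy, map_smul h a y⟩
  have key := hA.nakayama G hG Finset.univ s (fun j => stdVec A j)
    (fun j l => - (h (stdVec A j) - stdVec A j) l) (fun j _ l _ => neg_mem (hh j l))
    (fun j _ => ⟨_, hA.single_mem s j, by
      have h1 := sum_smul_stdVec (h (stdVec A j) - stdVec A j)
      simp only [neg_smul, Finset.sum_neg_distrib, sub_neg_eq_add]
      rw [h1, add_sub_cancel]
      rfl⟩)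
  obtain ⟨y, hy, hyx⟩ := sum_smul_mem hG (fun j => key j (Finset.mem_univ j)) hx
  refine ⟨y, hy, hyx.trans ?_⟩
  exact sum_smul_stdVec x

/-- A right inverse of a unipotent endomorphism that is chosen on the basis is unipotent again, so
that both are bijective. -/
theorem IsUnipotent.bijective (hA : IsLocalFamily 𝒜 χ) {r : ℕ} {s : Fin r → ℤ × ℤ}
    {h : (Fin r → A) →ₗ[A] (Fin r → A)} (hh : IsUnipotent 𝒜 χ s h) : Function.Bijective h := by
  have surj : ∀ {h : (Fin r → A) →ₗ[A] (Fin r → A)}, IsUnipotent 𝒜 χ s h →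
      Function.Surjective h := fun {h} hh => by
    rw [← LinearMap.range_eq_top, eq_top_iff]
    intro x _
    have : x = ∑ j, x j • stdVec A j := (sum_smul_stdVec x).symm
    rw [this]
    refine sum_mem fun j _ => Submodule.smul_mem _ _ ?_
    obtain ⟨y, -, hy⟩ := hh.exists_preimage hA (hA.single_mem s j)
    exact ⟨y, hy⟩
  choose y hy hhy using fun j => hh.exists_preimage hA (hA.single_mem s j)
  let k : (Fin r → A) →ₗ[A] (Fin r → A) := Fintype.linearCombination A y
  have hk : ∀ j, k (stdVec A j) = y j := linearCombination_stdVec y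
  have hhk : ∀ x, h (k x) = x := fun x => by
    have := map_eq_sum_single (h ∘ₗ k) x
    simp only [LinearMap.comp_apply, hk, hhy] at this
    exact this.trans (sum_smul_stdVec x)
  have hku : IsUnipotent 𝒜 χ s k := fun j l => by
    have h1 : (k (stdVec A j) - stdVec A j) l =
        ∑ i, y j i * (- (h (stdVec A i) - stdVec A i) l) := by
      have h2 : h (y j) = ∑ i, y j i • h (stdVec A i) := map_eq_sum_single h (y j)
      have h3 : y j = ∑ i, y j i • stdVec A i :=
        (sum_smul_stdVec (y j)).symm
      have h4 : y j - stdVec A j =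
          ∑ i, y j i • (- (h (stdVec A i) - stdVec A i)) := by
        rw [← hhy j, h2]
        conv_lhs => lhs; rw [h3]
        rw [← Finset.sum_sub_distrib]
        exact Finset.sum_congr rfl fun i _ => by rw [neg_sub, smul_sub]
      rw [hk, h4, Finset.sum_apply]
      rfl
    rw [h1]
    refine sum_mem fun i _ => ?_
    have := hA.mul_mem_rad (mem_shifted.1 (hy j) i) (neg_mem (hh i l))
    rwa [sub_add_sub_cancel] at this
  have kinj : Function.Injective k := Function.LeftInverse.injective hhk
  refine ⟨fun a b hab => ?_, surj hh⟩
  obtain ⟨a, rfl⟩ := surj hku a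
  obtain ⟨b, rfl⟩ := surj hku b
  rw [hhk, hhk] at hab
  rw [hab]

/-- Minimality of a bihomogeneous map out of a free module: its kernel in degree `p` has no
element with a coordinate in `𝒜_0` that is invertible. -/
def IsMinimalCover (𝒜 : ℤ × ℤ → AddSubgroup A) (χ : A →+ ℂ) {T : Type*} [AddCommGroup T]
    [Module A T] {r : ℕ} (s : Fin r → ℤ × ℤ) (ε : (Fin r → A) →ₗ[A] T) : Prop :=
  ∀ p, ∀ x ∈ shifted 𝒜 s p, ε x = 0 → ∀ j, s j = p → χ (x j) = 0

/-- Two minimal covers with the same image in every degree are isomorphic. -/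
theorem IsLocalFamily.exists_equiv (hA : IsLocalFamily 𝒜 χ) {T : Type*} [AddCommGroup T]
    [Module A T] {r r' : ℕ} {s : Fin r → ℤ × ℤ} {s' : Fin r' → ℤ × ℤ} {ε : (Fin r → A) →ₗ[A] T}
    {ε' : (Fin r' → A) →ₗ[A] T} (hε : IsMinimalCover 𝒜 χ s ε) (hε' : IsMinimalCover 𝒜 χ s' ε')
    (h : ∀ p, ∀ x ∈ shifted 𝒜 s p, ∃ y ∈ shifted 𝒜 s' p, ε' y = ε x)
    (h' : ∀ p, ∀ y ∈ shifted 𝒜 s' p, ∃ x ∈ shifted 𝒜 s p, ε x = ε' y) :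
    ∃ e : (Fin r → A) ≃ₗ[A] (Fin r' → A),
      (∀ p x, x ∈ shifted 𝒜 s p ↔ e x ∈ shifted 𝒜 s' p) ∧ ∀ x, ε' (e x) = ε x := by
  choose y hy hyε using fun j => h _ _ (hA.single_mem s j)
  choose x hx hxε using fun j => h' _ _ (hA.single_mem s' j)
  let f : (Fin r → A) →ₗ[A] (Fin r' → A) := Fintype.linearCombination A y
  let g : (Fin r' → A) →ₗ[A] (Fin r → A) := Fintype.linearCombination A x
  have hf1 : ∀ j, f (stdVec A j) = y j := linearCombination_stdVec y
  have hg1 : ∀ j, g (stdVec A j) = x j := linearCombination_stdVec x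
  have hfm : ∀ p, ∀ z ∈ shifted 𝒜 s p, f z ∈ shifted 𝒜 s' p := fun p z hz => by
    rw [map_eq_sum_single f z]
    simp only [hf1]
    exact sum_smul_mem (hA.isStable_shifted s') hy hz
  have hgm : ∀ p, ∀ z ∈ shifted 𝒜 s' p, g z ∈ shifted 𝒜 s p := fun p z hz => by
    rw [map_eq_sum_single g z]
    simp only [hg1]
    exact sum_smul_mem (hA.isStable_shifted s) hx hz
  have hfε : ∀ z, ε' (f z) = ε z := fun z => by
    rw [map_eq_sum_single ε z, ← LinearMap.comp_apply, map_eq_sum_single (ε' ∘ₗ f) z]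
    exact Finset.sum_congr rfl fun j _ => by rw [LinearMap.comp_apply, hf1, hyε]
  have hgε : ∀ z, ε (g z) = ε' z := fun z => by
    rw [map_eq_sum_single ε' z, ← LinearMap.comp_apply, map_eq_sum_single (ε ∘ₗ g) z]
    exact Finset.sum_congr rfl fun j _ => by rw [LinearMap.comp_apply, hg1, hxε]
  have hgf : IsUnipotent 𝒜 χ s (g ∘ₗ f) := fun j l => by
    have hm : g (f (stdVec A j)) - stdVec A j ∈ shifted 𝒜 s (s j) :=
      sub_mem (hgm _ _ (hfm _ _ (hA.single_mem s j))) (hA.single_mem s j)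
    refine ⟨mem_shifted.1 hm l, fun hjl => hε _ _ hm ?_ l (sub_eq_zero.1 hjl).symm⟩
    rw [map_sub, hgε, hfε, sub_self]
  have hfg : IsUnipotent 𝒜 χ s' (f ∘ₗ g) := fun j l => by
    have hm : f (g (stdVec A j)) - stdVec A j ∈ shifted 𝒜 s' (s' j) :=
      sub_mem (hfm _ _ (hgm _ _ (hA.single_mem s' j))) (hA.single_mem s' j)
    refine ⟨mem_shifted.1 hm l, fun hjl => hε' _ _ hm ?_ l (sub_eq_zero.1 hjl).symm⟩
    rw [map_sub, hfε, hgε, sub_self]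
  have hbij : Function.Bijective f :=
    ⟨Function.Injective.of_comp (f := g) (hgf.bijective hA).1,
      Function.Surjective.of_comp (g := g) (hfg.bijective hA).2⟩
  refine ⟨LinearEquiv.ofBijective f hbij, fun p z => ⟨hfm p z, fun hz => ?_⟩, hfε⟩
  obtain ⟨t, ht, hte⟩ := hfg.exists_preimage hA hz
  have : g t = z := hbij.1 hte
  exact this ▸ hgm _ _ ht

/-- A bihomogeneous isomorphism of free modules is invertible modulo the maximal ideal, degree by
degree, so that the shifts agree up to permutation. -/
theorem IsLocalFamily.exists_perm (hA : IsLocalFamily 𝒜 χ) {r r' : ℕ} {s : Fin r → ℤ × ℤ}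
    {s' : Fin r' → ℤ × ℤ} (e : (Fin r → A) ≃ₗ[A] (Fin r' → A))
    (he : ∀ p x, x ∈ shifted 𝒜 s p ↔ e x ∈ shifted 𝒜 s' p) :
    ∃ σ : Fin r ≃ Fin r', ∀ j, s' (σ j) = s j := by
  classical
  have he' : ∀ p x, x ∈ shifted 𝒜 s' p ↔ e.symm x ∈ shifted 𝒜 s p := fun p x => by
    rw [he, LinearEquiv.apply_symm_apply]
  have aux : ∀ {r r' : ℕ} {s : Fin r → ℤ × ℤ} {s' : Fin r' → ℤ × ℤ}
      (e : (Fin r → A) ≃ₗ[A] (Fin r' → A))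
      (_ : ∀ p x, x ∈ shifted 𝒜 s p ↔ e x ∈ shifted 𝒜 s' p)
      (_ : ∀ p x, x ∈ shifted 𝒜 s' p ↔ e.symm x ∈ shifted 𝒜 s p) (q : ℤ × ℤ),
      (Matrix.of fun (j : {j // s j = q}) (l : {l // s' l = q}) => χ (e (stdVec A j.1) l.1)) *
      (Matrix.of fun (l : {l // s' l = q}) (j : {j // s j = q}) =>
        χ (e.symm (stdVec A l.1) j.1)) = 1 := by
    intro r r' s s' e he he' q
    refine Matrix.ext fun j m => ?_
    have h1 : stdVec A j.1 m.1 =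
        ∑ l, e (stdVec A j.1) l * e.symm (stdVec A l) m.1 := by
      have := map_eq_sum_single (e.symm : (Fin r' → A) →ₗ[A] (Fin r → A)) (e (stdVec A j.1))
      simp only [LinearEquiv.coe_coe, LinearEquiv.symm_apply_apply] at this
      conv_lhs => rw [this]
      rw [Finset.sum_apply]
      rfl
    have h2 := congrArg χ h1
    rw [map_sum] at h2
    have hfl : ∀ l, e (stdVec A j.1) l ∈ 𝒜 (q - s' l) := fun l => by
      have := mem_shifted.1 ((he _ _).1 (hA.single_mem s j.1)) l
      rwa [j.2] at this
    have hgl : ∀ l, e.symm (stdVec A l) m.1 ∈ 𝒜 (s' l - q) := fun l => by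
      have := mem_shifted.1 ((he' _ _).1 (hA.single_mem s' l)) m.1
      rwa [m.2] at this
    rw [Matrix.mul_apply]
    have h3 : ∀ l : {l // s' l = q}, χ (e (stdVec A j.1) l.1 * e.symm (stdVec A l.1) m.1) =
        χ (e (stdVec A j.1) l.1) * χ (e.symm (stdVec A l.1) m.1) := fun l => by
      have h4 := hfl l.1
      have h5 := hgl l.1
      rw [l.2, sub_self] at h4 h5
      exact hA.map_mul h4 h5
    simp only [Matrix.of_apply, ← h3]
    have h6 : ∑ l, χ (e (stdVec A j.1) l * e.symm (stdVec A l) m.1) =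
        ∑ l : {l // s' l = q}, χ (e (stdVec A j.1) l.1 * e.symm (stdVec A l.1) m.1) := by
      rw [← Finset.sum_filter_of_ne (p := fun l => s' l = q)]
      · exact Finset.sum_subtype _ (by simp) _
      · intro l _ hl
        by_contra hlq
        exact hl (hA.map_mul_of_ne (hfl l) (hgl l) (by simp) fun h => hlq (sub_eq_zero.1 h).symm)
    rw [← h6, ← h2, Matrix.one_apply]
    by_cases hjm : j = m
    · rw [if_pos hjm, hjm, stdVec_same, hA.map_one]
    · rw [if_neg hjm, stdVec_of_ne (fun h => hjm (Subtype.ext h.symm)), map_zero]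
  have hcard : ∀ q, Fintype.card {j // s j = q} = Fintype.card {l // s' l = q} := fun q =>
    Matrix.square_of_invertible _ _ (aux e he he' q) (aux e.symm he' he q)
  have σ : ∀ q, {j // s j = q} ≃ {l // s' l = q} := fun q => Fintype.equivOfCardEq (hcard q)
  refine ⟨(Equiv.sigmaFiberEquiv s).symm.trans
    ((Equiv.sigmaCongrRight σ).trans (Equiv.sigmaFiberEquiv s')), fun j => ?_⟩
  exact (σ (s j) ⟨j, rfl⟩).2

end

/-! ### Minimal resolutions of families -/

section

variable {A : Type*} [Ring A] {𝒜 : ℤ × ℤ → AddSubgroup A} {χ : A →+ ℂ}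

/-- If a family of subgroups has a finite system of generators, it has one without relations that
involve a unit: a generator with an invertible coefficient in a relation is redundant, hence a
system with the least number of generators will do. -/
theorem IsLocalFamily.exists_minimalCover (hA : IsLocalFamily 𝒜 χ) {T : Type*} [AddCommGroup T]
    [Module A T] {G : ℤ × ℤ → AddSubgroup T}
    (hG : ∃ (l : ℕ) (f : Fin l → T) (s : Fin l → ℤ × ℤ), ∀ p x,
      x ∈ G p ↔ ∃ P : Fin l → A, (∀ i, P i ∈ 𝒜 (p - s i)) ∧ x = ∑ i, P i • f i) :
    ∃ (l : ℕ) (s : Fin l → ℤ × ℤ) (ε : (Fin l → A) →ₗ[A] T),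
      (∀ p x, x ∈ G p ↔ ∃ y ∈ shifted 𝒜 s p, ε y = x) ∧ IsMinimalCover 𝒜 χ s ε := by
  classical
  obtain ⟨f, s, hfs⟩ := Nat.find_spec hG
  refine ⟨Nat.find hG, s, Fintype.linearCombination A f, fun p x => ?_, fun p x hx hx0 j hj => ?_⟩
  · rw [hfs]
    exact ⟨fun ⟨P, hP, h⟩ => ⟨P, mem_shifted.2 hP, h.symm⟩,
      fun ⟨P, hP, h⟩ => ⟨P, mem_shifted.1 hP, h.symm⟩⟩
  · by_contra hne
    have hmin := @Nat.find_min _ _ hG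
    revert f s hfs x j hmin
    generalize Nat.find hG = l
    intro f s hfs x hx hx0 j hj hne hmin
    obtain ⟨l, rfl⟩ : ∃ l', l = l' + 1 := ⟨l - 1, by have := j.2; omega⟩
    refine hmin (Nat.lt_succ_self l) ⟨fun i => f (j.succAbove i), fun i => s (j.succAbove i), ?_⟩
    subst hj
    have hxm := mem_shifted.1 hx
    obtain ⟨b, hb, hb1⟩ := hA.exists_inv (a := x j) (by simpa using hxm j) hne
    have hfj : f j = - ∑ i, (b * x (j.succAbove i)) • f (j.succAbove i) := by
      have h1 : ∑ i, x i • f i = 0 := hx0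
      rw [Fin.sum_univ_succAbove _ j] at h1
      have h2 := congrArg (b • ·) h1
      simp only [smul_add, smul_smul, hb1, one_smul, smul_zero, Finset.smul_sum] at h2
      exact eq_neg_of_add_eq_zero_left h2
    have hbx : ∀ i, b * x (j.succAbove i) ∈ 𝒜 (s j - s (j.succAbove i)) := fun i => by
      simpa using hA.mul_mem hb (hxm (j.succAbove i))
    intro p y
    rw [hfs]
    constructor
    · rintro ⟨P, hP, rfl⟩
      refine ⟨fun i => P (j.succAbove i) - P j * (b * x (j.succAbove i)), fun i => ?_, ?_⟩
      · refine sub_mem (hP _) ?_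
        have := hA.mul_mem (hP j) (hbx i)
        rwa [sub_add_sub_cancel] at this
      · rw [Fin.sum_univ_succAbove _ j, hfj]
        simp only [sub_smul, Finset.sum_sub_distrib, smul_neg, Finset.smul_sum, smul_smul]
        abel
    · rintro ⟨P, hP, rfl⟩
      refine ⟨j.insertNth 0 P, fun i => ?_, ?_⟩
      · refine Fin.succAboveCases j ?_ (fun i => ?_) i
        · rw [Fin.insertNth_apply_same]; exact zero_mem _
        · rw [Fin.insertNth_apply_succAbove]; exact hP i
      · rw [Fin.sum_univ_succAbove _ j]
        simp

/-- A minimal free resolution of a family `(𝒩_p)` of subgroups of `N`, that is, an `A`-linear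
complex of free modules whose degree `p` part is an exact sequence that ends in `𝒩_p`, and whose
maps vanish modulo the maximal ideal. For the bifiltration of `𝒟` it is a minimal bifiltered
resolution, for the bigrading of `bigr 𝒟` a minimal bigraded resolution. -/
structure IsMinimalFamilyResolution (𝒜 : ℤ × ℤ → AddSubgroup A) (χ : A →+ ℂ) {N : Type*}
    [AddCommGroup N] [Module A N] (𝒩 : ℤ × ℤ → AddSubgroup N) {r : ℕ → ℕ}
    (s : ∀ i, Fin (r i) → ℤ × ℤ) (φ : ∀ i, (Fin (r (i + 1)) → A) →ₗ[A] (Fin (r i) → A))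
    (ε : (Fin (r 0) → A) →ₗ[A] N) : Prop where
  map_mem : ∀ i p, ∀ x ∈ shifted 𝒜 (s (i + 1)) p, φ i x ∈ shifted 𝒜 (s i) p
  aug_mem : ∀ p, ∀ x ∈ shifted 𝒜 (s 0) p, ε x ∈ 𝒩 p
  comp_eq_zero : ∀ i x, φ i (φ (i + 1) x) = 0
  aug_comp_eq_zero : ∀ x, ε (φ 0 x) = 0
  exact : ∀ i p, ∀ x ∈ shifted 𝒜 (s (i + 1)) p, φ i x = 0 →
    ∃ y ∈ shifted 𝒜 (s (i + 2)) p, φ (i + 1) y = x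
  exact_aug : ∀ p, ∀ x ∈ shifted 𝒜 (s 0) p, ε x = 0 → ∃ y ∈ shifted 𝒜 (s 1) p, φ 0 y = x
  surjective : ∀ p, ∀ x ∈ 𝒩 p, ∃ y ∈ shifted 𝒜 (s 0) p, ε y = x
  minimal : ∀ i p, ∀ x ∈ shifted 𝒜 (s (i + 1)) p, ∀ j, s i j = p → χ (φ i x j) = 0

end

theorem exists_seq {α : ℕ → Type*} (P : ∀ i, α i → Prop) (R : ∀ i, α i → α (i + 1) → Prop)
    (a : α 0) (h0 : P 0 a) (hs : ∀ i a, P i a → ∃ b, P (i + 1) b ∧ R i a b) :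
    ∃ f : ∀ i, α i, f 0 = a ∧ (∀ i, P i (f i)) ∧ ∀ i, R i (f i) (f (i + 1)) := by
  choose g hg using hs
  let f : ∀ i, {b : α i // P i b} := fun i =>
    Nat.rec ⟨a, h0⟩ (fun i b => ⟨g i b.1 b.2, (hg i b.1 b.2).1⟩) i
  exact ⟨fun i => (f i).1, rfl, fun i => (f i).2, fun i => (hg i _ (f i).2).2⟩

section

variable {A : Type*} [Ring A] {𝒜 : ℤ × ℤ → AddSubgroup A} {χ : A →+ ℂ}

/-- Minimal resolutions are unique up to isomorphism. -/
theorem IsMinimalFamilyResolution.exists_iso (hA : IsLocalFamily 𝒜 χ) {N : Type*} [AddCommGroup N]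
    [Module A N] {𝒩 : ℤ × ℤ → AddSubgroup N} {r r' : ℕ → ℕ} {s : ∀ i, Fin (r i) → ℤ × ℤ}
    {s' : ∀ i, Fin (r' i) → ℤ × ℤ} {φ : ∀ i, (Fin (r (i + 1)) → A) →ₗ[A] (Fin (r i) → A)}
    {φ' : ∀ i, (Fin (r' (i + 1)) → A) →ₗ[A] (Fin (r' i) → A)} {ε : (Fin (r 0) → A) →ₗ[A] N}
    {ε' : (Fin (r' 0) → A) →ₗ[A] N} (h : IsMinimalFamilyResolution 𝒜 χ 𝒩 s φ ε)
    (h' : IsMinimalFamilyResolution 𝒜 χ 𝒩 s' φ' ε') :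
    ∃ e : ∀ i, (Fin (r i) → A) ≃ₗ[A] (Fin (r' i) → A),
      (∀ i p x, x ∈ shifted 𝒜 (s i) p ↔ e i x ∈ shifted 𝒜 (s' i) p) ∧
      (∀ i x, e i (φ i x) = φ' i (e (i + 1) x)) ∧ ∀ x, ε' (e 0 x) = ε x := by
  let P : ∀ i, ((Fin (r i) → A) ≃ₗ[A] (Fin (r' i) → A)) → Prop := fun i e =>
    (∀ p x, x ∈ shifted 𝒜 (s i) p ↔ e x ∈ shifted 𝒜 (s' i) p) ∧
    (∀ p, ∀ x ∈ shifted 𝒜 (s (i + 1)) p, ∃ y ∈ shifted 𝒜 (s' (i + 1)) p, φ' i y = e (φ i x)) ∧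
    (∀ p, ∀ y ∈ shifted 𝒜 (s' (i + 1)) p, ∃ x ∈ shifted 𝒜 (s (i + 1)) p, e (φ i x) = φ' i y)
  obtain ⟨e₀, he₀, hε₀⟩ := hA.exists_equiv (ε := ε) (ε' := ε')
    (fun p x hx hx0 j hj => by
      obtain ⟨y, hy, rfl⟩ := h.exact_aug p x hx hx0
      exact h.minimal 0 p y hy j hj)
    (fun p x hx hx0 j hj => by
      obtain ⟨y, hy, rfl⟩ := h'.exact_aug p x hx hx0
      exact h'.minimal 0 p y hy j hj)
    (fun p x hx => h'.surjective p _ (h.aug_mem p x hx))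
    (fun p x hx => h.surjective p _ (h'.aug_mem p x hx))
  have hP₀ : P 0 e₀ := by
    refine ⟨he₀, fun p x hx => ?_, fun p y hy => ?_⟩
    · exact h'.exact_aug p _ ((he₀ _ _).1 (h.map_mem 0 p x hx))
        (by rw [hε₀, h.aug_comp_eq_zero])
    · have h1 : φ' 0 y = e₀ (e₀.symm (φ' 0 y)) := (e₀.apply_symm_apply _).symm
      obtain ⟨x, hx, hxy⟩ := h.exact_aug p (e₀.symm (φ' 0 y))
        ((he₀ _ _).2 (h1 ▸ h'.map_mem 0 p y hy)) (by rw [← hε₀, ← h1, h'.aug_comp_eq_zero])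
      exact ⟨x, hx, by rw [hxy, ← h1]⟩
  obtain ⟨e, he0, hP, hR⟩ := exists_seq P
    (fun i e e' => ∀ x, e (φ i x) = φ' i (e' x)) e₀ hP₀ (fun i e ⟨he, h1, h2⟩ => by
      obtain ⟨e', he', hφ⟩ := hA.exists_equiv (ε := e.toLinearMap ∘ₗ φ i) (ε' := φ' i)
        (fun p x hx hx0 j hj => by
          obtain ⟨y, hy, rfl⟩ := h.exact i p x hx (e.map_eq_zero_iff.1 hx0)
          exact h.minimal (i + 1) p y hy j hj)
        (fun p x hx hx0 j hj => by
          obtain ⟨y, hy, rfl⟩ := h'.exact i p x hx hx0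
          exact h'.minimal (i + 1) p y hy j hj) h1 h2
      have hφ : ∀ x, φ' i (e' x) = e (φ i x) := hφ
      refine ⟨e', ⟨he', fun p x hx => ?_, fun p y hy => ?_⟩, fun x => (hφ x).symm⟩
      · exact h'.exact i p _ ((he' _ _).1 (h.map_mem (i + 1) p x hx))
          (by rw [hφ, h.comp_eq_zero, map_zero])
      · have h3 : φ' (i + 1) y = e' (e'.symm (φ' (i + 1) y)) := (e'.apply_symm_apply _).symm
        obtain ⟨x, hx, hxy⟩ := h.exact i p (e'.symm (φ' (i + 1) y))
          ((he' _ _).2 (h3 ▸ h'.map_mem (i + 1) p y hy))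
          (e.map_eq_zero_iff.1 (by rw [← hφ, ← h3, h'.comp_eq_zero]))
        exact ⟨x, hx, by rw [hxy, ← h3]⟩)
  exact ⟨e, fun i => (hP i).1, hR, fun x => he0 ▸ hε₀ x⟩

end

/-! ### Convergent power series -/

section PowerSeries

open scoped ENNReal
open Filter

variable {n : ℕ}

/-- The integer `∏ pᵢ ^ αᵢ` with `pᵢ` the `i`-th prime. It is multiplicative and, by unique
factorization, injective in `α`, so that comparing these integers is a monomial order. -/
def primeCode (α : Fin n →₀ ℕ) : ℕ := ∏ i : Fin n, Nat.nth Nat.Prime i ^ α i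

theorem primeCode_add (α β : Fin n →₀ ℕ) : primeCode (α + β) = primeCode α * primeCode β := by
  simp [primeCode, pow_add, Finset.prod_mul_distrib]

theorem primeCode_pos (α : Fin n →₀ ℕ) : 0 < primeCode α :=
  Finset.prod_pos fun i _ => pow_pos (Nat.prime_nth_prime i).pos _

theorem primeCode_injective : Function.Injective (primeCode (n := n)) := by
  intro α β h
  have key : ∀ (α : Fin n →₀ ℕ) (i : Fin n),
      (primeCode α).factorization (Nat.nth Nat.Prime i) = α i := fun α i => by
    rw [primeCode, Nat.factorization_prod
      (fun (j : Fin n) _ => (pow_pos (Nat.prime_nth_prime j).pos _).ne'), Finset.sum_apply']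
    rw [Finset.sum_eq_single i]
    · rw [(Nat.prime_nth_prime i).factorization_pow, Finsupp.single_eq_same]
    · intro j _ hj
      rw [(Nat.prime_nth_prime j).factorization_pow, Finsupp.single_eq_of_ne]
      exact fun h => hj (Fin.ext (Nat.nth_injective Nat.infinite_setOfPred_prime h)).symm
    · simp
  ext i
  rw [← key α, h, key]

theorem two_pow_degree_le_primeCode (α : Fin n →₀ ℕ) : 2 ^ α.degree ≤ primeCode α := by
  rw [Finsupp.degree_eq_sum, ← Finset.prod_pow_eq_pow_sum]
  exact Finset.prod_le_prod' fun i _ => Nat.pow_le_pow_left (Nat.prime_nth_prime i).two_le _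

theorem exists_primeCode_le_pow_degree (n : ℕ) :
    ∃ b : ℕ, 0 < b ∧ ∀ α : Fin n →₀ ℕ, primeCode α ≤ b ^ α.degree := by
  have hpos : ∀ i : Fin n, 1 ≤ Nat.nth Nat.Prime i := fun i => (Nat.prime_nth_prime i).pos
  refine ⟨∏ i : Fin n, Nat.nth Nat.Prime i, Finset.prod_pos fun i _ => hpos i, fun α => ?_⟩
  rw [Finsupp.degree_eq_sum, ← Finset.prod_pow_eq_pow_sum]
  exact Finset.prod_le_prod' fun i _ => Nat.pow_le_pow_left
    (Finset.single_le_prod' (fun j _ => hpos j) (Finset.mem_univ i)) _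

/-- The weight `(∏ pᵢ ^ αᵢ)⁻ˢ` of the exponent `α`, which turns the absolute values of a power
series on polydiscs into a Dirichlet series. -/
def codeWeight (s : ℕ) (α : Fin n →₀ ℕ) : ℝ≥0∞ := ((primeCode α : ℝ≥0∞)⁻¹) ^ s

theorem codeWeight_add (s : ℕ) (α β : Fin n →₀ ℕ) :
    codeWeight s (α + β) = codeWeight s α * codeWeight s β := by
  have h : ∀ γ : Fin n →₀ ℕ, (primeCode γ : ℝ≥0∞) ≠ 0 := fun γ => by
    exact_mod_cast (primeCode_pos γ).ne'
  rw [codeWeight, codeWeight, codeWeight, ← mul_pow, primeCode_add, Nat.cast_mul,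
    ENNReal.mul_inv (Or.inl (h α)) (Or.inr (h β))]

theorem codeWeight_ne_zero (s : ℕ) (α : Fin n →₀ ℕ) : codeWeight s α ≠ 0 :=
  pow_ne_zero _ (ENNReal.inv_ne_zero.2 (ENNReal.natCast_ne_top _))

/-- The weighted `ℓ¹`-norm of a power series, with values in `[0, ∞]`. -/
def codeNorm (s : ℕ) (f : MvPowerSeries (Fin n) ℂ) : ℝ≥0∞ :=
  ∑' α, ‖MvPowerSeries.coeff α f‖ₑ * codeWeight s α

theorem codeNorm_anti {s t : ℕ} (h : s ≤ t) (f : MvPowerSeries (Fin n) ℂ) :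
    codeNorm t f ≤ codeNorm s f := by
  refine ENNReal.tsum_le_tsum fun α => mul_le_mul_right (pow_le_pow_of_le_one zero_le ?_ h) _
  exact ENNReal.inv_le_one.2 (by exact_mod_cast primeCode_pos α)

theorem codeNorm_add_le (s : ℕ) (f g : MvPowerSeries (Fin n) ℂ) :
    codeNorm s (f + g) ≤ codeNorm s f + codeNorm s g := by
  rw [codeNorm, codeNorm, codeNorm, ← ENNReal.tsum_add]
  refine ENNReal.tsum_le_tsum fun α => ?_
  rw [map_add, ← add_mul]
  exact mul_le_mul_left (enorm_add_le _ _) _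

theorem codeNorm_mul_le (s : ℕ) (f g : MvPowerSeries (Fin n) ℂ) :
    codeNorm s (f * g) ≤ codeNorm s f * codeNorm s g := by
  have h1 : codeNorm s f * codeNorm s g = ∑' p : (Fin n →₀ ℕ) × (Fin n →₀ ℕ),
      (‖MvPowerSeries.coeff p.1 f‖ₑ * codeWeight s p.1) *
        (‖MvPowerSeries.coeff p.2 g‖ₑ * codeWeight s p.2) := by
    rw [codeNorm, codeNorm, ENNReal.tsum_prod', ← ENNReal.tsum_mul_right]
    exact tsum_congr fun α => ENNReal.tsum_mul_left.symm
  rw [h1, ← Finset.HasAntidiagonal.sigmaAntidiagonalEquivProd.tsum_eq, ENNReal.tsum_sigma', codeNorm]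
  refine ENNReal.tsum_le_tsum fun α => ?_
  rw [tsum_fintype, MvPowerSeries.coeff_mul, ← Finset.sum_coe_sort]
  refine (mul_le_mul_left (enorm_sum_le _ _) _).trans_eq ?_
  rw [Finset.sum_mul]
  refine Finset.sum_congr rfl fun p _ => ?_
  have h : p.1.1 + p.1.2 = α := Finset.HasAntidiagonal.mem_antidiagonal.1 p.2
  rw [enorm_mul]
  simp only [Finset.HasAntidiagonal.sigmaAntidiagonalEquivProd_apply]
  have h' : codeWeight s α = codeWeight s p.1.1 * codeWeight s p.1.2 := by
    rw [← codeWeight_add, h]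
  rw [h']
  ring

theorem codeNorm_sum_le {ι : Type*} (J : Finset ι) (s : ℕ) (f : ι → MvPowerSeries (Fin n) ℂ) :
    codeNorm s (∑ i ∈ J, f i) ≤ ∑ i ∈ J, codeNorm s (f i) := by
  classical
  induction J using Finset.induction_on with
  | empty => simp [codeNorm]
  | insert i J hi ih =>
    rw [Finset.sum_insert hi, Finset.sum_insert hi]
    exact (codeNorm_add_le s _ _).trans (add_le_add le_rfl ih)

theorem isConvergent_iff_codeNorm {f : MvPowerSeries (Fin n) ℂ} :
    IsConvergent f ↔ ∃ s, codeNorm s f ≠ ∞ := by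
  have key : ∀ r : NNReal, (Summable fun α : Fin n →₀ ℕ =>
      ‖MvPowerSeries.coeff α f‖ * (r : ℝ) ^ α.degree) ↔
      ∑' α : Fin n →₀ ℕ, ‖MvPowerSeries.coeff α f‖ₑ * (r : ℝ≥0∞) ^ α.degree ≠ ∞ := fun r => by
    have h1 : ∀ α : Fin n →₀ ℕ, ‖MvPowerSeries.coeff α f‖ₑ * (r : ℝ≥0∞) ^ α.degree =
        ((‖MvPowerSeries.coeff α f‖₊ * r ^ α.degree : NNReal) : ℝ≥0∞) := fun α => by
      push_cast; rfl
    simp only [h1]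
    rw [ENNReal.tsum_coe_ne_top_iff_summable, ← NNReal.summable_coe]
    simp
  constructor
  · rintro ⟨r, hr, h⟩
    lift r to NNReal using hr.le
    have hr : 0 < r := by exact_mod_cast hr
    obtain ⟨s, hs⟩ := exists_pow_lt_of_lt_one hr (y := (2⁻¹ : NNReal)) (by norm_num)
    refine ⟨s, ne_top_of_le_ne_top ((key r).1 h) (ENNReal.tsum_le_tsum fun α => ?_)⟩
    refine mul_le_mul_right ?_ _
    have h2 : (primeCode α : ℝ≥0∞)⁻¹ ≤ (2⁻¹ : ℝ≥0∞) ^ α.degree := by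
      rw [← ENNReal.inv_pow]
      exact ENNReal.inv_le_inv.2 (by exact_mod_cast two_pow_degree_le_primeCode α)
    calc codeWeight s α ≤ ((2⁻¹ : ℝ≥0∞) ^ α.degree) ^ s := pow_le_pow_left' h2 s
      _ = ((2⁻¹ : ℝ≥0∞) ^ s) ^ α.degree := by rw [← pow_mul, mul_comm, pow_mul]
      _ ≤ (r : ℝ≥0∞) ^ α.degree := by
        refine pow_le_pow_left' ?_ _
        have h3 : ((2⁻¹ : NNReal) ^ s : NNReal) ≤ (r : ℝ≥0∞) := by exact_mod_cast hs.le
        refine le_trans (le_of_eq ?_) h3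
        rw [ENNReal.coe_pow, ENNReal.coe_inv two_ne_zero]
        rfl
  · rintro ⟨s, hs⟩
    obtain ⟨b, hb, hbα⟩ := exists_primeCode_le_pow_degree n
    refine ⟨((b : NNReal)⁻¹ ^ s : NNReal), by positivity, (key _).2 ?_⟩
    refine ne_top_of_le_ne_top hs (ENNReal.tsum_le_tsum fun α => mul_le_mul_right ?_ _)
    rw [ENNReal.coe_pow, ENNReal.coe_inv (by positivity), ← pow_mul, mul_comm, pow_mul,
      ← ENNReal.inv_pow]
    refine pow_le_pow_left' (ENNReal.inv_le_inv.2 ?_) _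
    exact_mod_cast hbα α

/-- Inversion of `1 - T` by the geometric series, for an operator `T` on power series that is
coefficientwise continuous and halves the norm. -/
theorem exists_sub_eq_of_contraction (s : ℕ)
    (T : MvPowerSeries (Fin n) ℂ → MvPowerSeries (Fin n) ℂ)
    (hT : ∀ g, codeNorm s (T g) ≤ 2⁻¹ * codeNorm s g)
    (hcont : ∀ (g : ℕ → MvPowerSeries (Fin n) ℂ) (h : MvPowerSeries (Fin n) ℂ),
      (∀ α, HasSum (fun k => MvPowerSeries.coeff α (g k)) (MvPowerSeries.coeff α h)) →
      ∀ α, HasSum (fun k => MvPowerSeries.coeff α (T (g k))) (MvPowerSeries.coeff α (T h)))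
    {g : MvPowerSeries (Fin n) ℂ} (hg : codeNorm s g ≠ ∞) :
    ∃ h, codeNorm s h ≠ ∞ ∧ h - T h = g := by
  have hk : ∀ k, codeNorm s (T^[k] g) ≤ 2⁻¹ ^ k * codeNorm s g := fun k => by
    induction k with
    | zero => simp
    | succ k ih =>
      rw [Function.iterate_succ_apply', pow_succ', mul_assoc]
      exact (hT _).trans (mul_le_mul_right ih _)
  have hsum : ∑' k, codeNorm s (T^[k] g) ≠ ∞ := by
    refine ne_top_of_le_ne_top ?_ (ENNReal.tsum_le_tsum hk)
    rw [ENNReal.tsum_mul_right, ENNReal.tsum_geometric]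
    refine ENNReal.mul_ne_top (ENNReal.inv_ne_top.2 ?_) hg
    rw [ENNReal.one_sub_inv_two]
    exact ENNReal.inv_ne_zero.2 ENNReal.ofNat_ne_top
  have hsum' : ∑' α, ∑' k, ‖MvPowerSeries.coeff α (T^[k] g)‖ₑ * codeWeight s α ≠ ∞ := by
    rwa [ENNReal.tsum_comm]
  have hα : ∀ α, Summable fun k => MvPowerSeries.coeff α (T^[k] g) := fun α => by
    have h1 : ∑' k, ‖MvPowerSeries.coeff α (T^[k] g)‖ₑ ≠ ∞ := by
      have := ne_top_of_le_ne_top hsum' (ENNReal.le_tsum α)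
      rw [ENNReal.tsum_mul_right] at this
      intro h
      rw [h, ENNReal.top_mul (codeWeight_ne_zero s α)] at this
      exact this rfl
    exact Summable.of_nnnorm (ENNReal.tsum_coe_ne_top_iff_summable.1 h1)
  let h : MvPowerSeries (Fin n) ℂ := fun α => ∑' k, MvPowerSeries.coeff α (T^[k] g)
  have hh : ∀ α, HasSum (fun k => MvPowerSeries.coeff α (T^[k] g)) (MvPowerSeries.coeff α h) :=
    fun α => (hα α).hasSum
  refine ⟨h, ne_top_of_le_ne_top hsum' (ENNReal.tsum_le_tsum fun α => ?_), ?_⟩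
  · rw [ENNReal.tsum_mul_right]
    exact mul_le_mul_left enorm_tsum_le_tsum_enorm _
  · ext α
    have h1 := hcont _ _ hh α
    simp only [← Function.iterate_succ_apply' T] at h1
    have h2 := (hasSum_nat_add_iff' (f := fun k => MvPowerSeries.coeff α (T^[k] g)) 1).2 (hh α)
    have h3 := h1.unique h2
    rw [map_sub, h3]
    simp

/-- `γ` is the leading exponent of `f`, that is, the one in its support whose prime code is least,
and the leading coefficient is `1`. -/
def IsLeading (f : MvPowerSeries (Fin n) ℂ) (γ : Fin n →₀ ℕ) : Prop :=
  MvPowerSeries.coeff γ f = 1 ∧ ∀ α, MvPowerSeries.coeff α f ≠ 0 → primeCode γ ≤ primeCode α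

theorem tendsto_codeNorm_tail {f : MvPowerSeries (Fin n) ℂ} {γ : Fin n →₀ ℕ} (h : IsLeading f γ)
    (hf : IsConvergent f) :
    Tendsto (fun s => (primeCode γ : ℝ≥0∞) ^ s * codeNorm s (MvPowerSeries.monomial γ 1 - f)) atTop
      (nhds 0) := by
  classical
  obtain ⟨s₀, hs₀⟩ := isConvergent_iff_codeNorm.1 hf
  set c : ℝ≥0∞ := (primeCode γ : ℝ≥0∞) with hc
  have hc0 : c ≠ 0 := by rw [hc]; exact_mod_cast (primeCode_pos γ).ne'
  have hctop : c ≠ ∞ := ENNReal.natCast_ne_top _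
  set ρ : ℝ≥0∞ := c * (c + 1)⁻¹ with hρ
  have hρ1 : ρ < 1 := by
    rw [hρ, ← div_eq_mul_inv, ENNReal.div_lt_iff (Or.inl (by simp)) (Or.inl (by simp [hctop])),
      one_mul]
    exact ENNReal.lt_add_right hctop one_ne_zero
  have hbound : ∀ t, c ^ (t + s₀) * codeNorm (t + s₀) (MvPowerSeries.monomial γ 1 - f) ≤
      ρ ^ t * (c ^ s₀ * codeNorm s₀ f) := fun t => by
    rw [codeNorm, codeNorm, ← ENNReal.tsum_mul_left, ← ENNReal.tsum_mul_left,
      ← ENNReal.tsum_mul_left]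
    refine ENNReal.tsum_le_tsum fun α => ?_
    rw [map_sub, MvPowerSeries.coeff_monomial]
    by_cases hα : α = γ
    · rw [if_pos hα, hα, h.1, sub_self, enorm_zero]
      simp
    · rw [if_neg hα, zero_sub, enorm_neg]
      by_cases h0 : MvPowerSeries.coeff α f = 0
      · simp [h0]
      have hlt : primeCode γ + 1 ≤ primeCode α :=
        lt_of_le_of_ne (h.2 α h0) fun hh => hα (primeCode_injective hh).symm
      have hw : codeWeight (t + s₀) α ≤ ((c + 1)⁻¹) ^ t * codeWeight s₀ α := by
        rw [codeWeight, codeWeight, pow_add]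
        refine mul_le_mul_left (pow_le_pow_left' (ENNReal.inv_le_inv.2 ?_) t) _
        rw [hc]
        exact_mod_cast hlt
      calc c ^ (t + s₀) * (‖MvPowerSeries.coeff α f‖ₑ * codeWeight (t + s₀) α)
          ≤ c ^ (t + s₀) * (‖MvPowerSeries.coeff α f‖ₑ * (((c + 1)⁻¹) ^ t * codeWeight s₀ α)) := by
            gcongr
        _ = ρ ^ t * (c ^ s₀ * (‖MvPowerSeries.coeff α f‖ₑ * codeWeight s₀ α)) := by
            rw [hρ, mul_pow]; ring
  rw [← tendsto_add_atTop_iff_nat s₀]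
  refine tendsto_of_tendsto_of_tendsto_of_le_of_le tendsto_const_nhds ?_ (fun _ => zero_le) hbound
  have := ENNReal.Tendsto.mul_const (b := c ^ s₀ * codeNorm s₀ f)
    (ENNReal.tendsto_pow_atTop_nhds_zero_of_lt_one hρ1)
    (Or.inr (ENNReal.mul_ne_top (ENNReal.pow_ne_top hctop) hs₀))
  rwa [zero_mul] at this

theorem codeNorm_shift_le (s : ℕ) (γ : Fin n →₀ ℕ) {f g : MvPowerSeries (Fin n) ℂ}
    (h : ∀ β, ‖MvPowerSeries.coeff β f‖ₑ ≤ ‖MvPowerSeries.coeff (β + γ) g‖ₑ) :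
    codeNorm s f ≤ (primeCode γ : ℝ≥0∞) ^ s * codeNorm s g := by
  have h0 : (primeCode γ : ℝ≥0∞) ≠ 0 := by exact_mod_cast (primeCode_pos _).ne'
  have h1 : (primeCode γ : ℝ≥0∞) ^ s * codeWeight s γ = 1 := by
    rw [codeWeight, ← mul_pow, ENNReal.mul_inv_cancel h0 (ENNReal.natCast_ne_top _), one_pow]
  rw [codeNorm, codeNorm, ← ENNReal.tsum_mul_left]
  refine le_trans (ENNReal.tsum_le_tsum fun β => ?_) (ENNReal.tsum_comp_le_tsum_of_injective
    (add_left_injective γ) fun α => (primeCode γ : ℝ≥0∞) ^ s *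
      (‖MvPowerSeries.coeff α g‖ₑ * codeWeight s α))
  calc ‖MvPowerSeries.coeff β f‖ₑ * codeWeight s β
      ≤ ‖MvPowerSeries.coeff (β + γ) g‖ₑ * codeWeight s β := mul_le_mul_left (h β) _
    _ = ‖MvPowerSeries.coeff (β + γ) g‖ₑ * codeWeight s β *
        ((primeCode γ : ℝ≥0∞) ^ s * codeWeight s γ) := by rw [h1, mul_one]
    _ = _ := by rw [codeWeight_add]; ring

theorem IsConvergent.shift {f g : MvPowerSeries (Fin n) ℂ} (hg : IsConvergent g) (γ : Fin n →₀ ℕ)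
    (h : ∀ β, ‖MvPowerSeries.coeff β f‖ₑ ≤ ‖MvPowerSeries.coeff (β + γ) g‖ₑ) :
    IsConvergent f := by
  obtain ⟨s, hs⟩ := isConvergent_iff_codeNorm.1 hg
  exact isConvergent_iff_codeNorm.2 ⟨s, ne_top_of_le_ne_top
    (ENNReal.mul_ne_top (ENNReal.pow_ne_top (ENNReal.natCast_ne_top _)) hs) (codeNorm_shift_le s γ h)⟩

/-- Division of convergent power series with remainder by finitely many series: no exponent of the
remainder is divisible by one of the leading exponents. The naive division, which sees only the
leading monomials, is a perturbation of the true one that is small in the norm `codeNorm s` for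
large `s`. -/
theorem exists_division {m : ℕ} {f : Fin m → MvPowerSeries (Fin n) ℂ} {γ : Fin m → Fin n →₀ ℕ}
    (hf : ∀ i, IsConvergent (f i)) (hγ : ∀ i, IsLeading (f i) (γ i))
    {g : MvPowerSeries (Fin n) ℂ} (hg : IsConvergent g) :
    ∃ (q : Fin m → MvPowerSeries (Fin n) ℂ) (r : MvPowerSeries (Fin n) ℂ),
      (∀ i, IsConvergent (q i)) ∧ IsConvergent r ∧ g = ∑ i, q i * f i + r ∧
      ∀ i α, γ i ≤ α → MvPowerSeries.coeff α r = 0 := by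
  classical
  -- `c α` is an index `i` such that `γ i` divides `α`, if there is one
  have hc : ∀ α, ∃ c : Option (Fin m), (∀ i, c = some i → γ i ≤ α) ∧
      (c = none → ∀ i, ¬ γ i ≤ α) := fun α => by
    by_cases h : ∃ i, γ i ≤ α
    · obtain ⟨i, hi⟩ := h
      exact ⟨some i, fun j hj => by rw [← Option.some.inj hj]; exact hi, by simp⟩
    · exact ⟨none, by simp, fun _ i hi => h ⟨i, hi⟩⟩
  choose c hc1 hc2 using hc
  let q : Fin m → MvPowerSeries (Fin n) ℂ → MvPowerSeries (Fin n) ℂ := fun i g β =>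
    if c (β + γ i) = some i then MvPowerSeries.coeff (β + γ i) g else 0
  let r : MvPowerSeries (Fin n) ℂ → MvPowerSeries (Fin n) ℂ := fun g α =>
    if c α = none then MvPowerSeries.coeff α g else 0
  have hq : ∀ i g β, MvPowerSeries.coeff β (q i g) =
    if c (β + γ i) = some i then MvPowerSeries.coeff (β + γ i) g else 0 := fun _ _ _ => rfl
  have hr : ∀ g α, MvPowerSeries.coeff α (r g) =
    if c α = none then MvPowerSeries.coeff α g else 0 := fun _ _ => rfl
  have hqr : ∀ g, ∑ i, MvPowerSeries.monomial (γ i) (1 : ℂ) * q i g + r g = g := fun g => by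
    ext α
    rw [map_add, map_sum, hr]
    have h1 : ∀ i, MvPowerSeries.coeff α (MvPowerSeries.monomial (γ i) (1 : ℂ) * q i g) =
        if c α = some i then MvPowerSeries.coeff α g else 0 := fun i => by
      rw [MvPowerSeries.coeff_monomial_mul]
      by_cases hi : γ i ≤ α
      · rw [if_pos hi, one_mul, hq, tsub_add_cancel_of_le hi]
      · rw [if_neg hi, if_neg fun h => hi (hc1 α i h)]
    simp only [h1]
    cases hcα : c α with
    | none => simp
    | some i => simp
  have hqn : ∀ s i g, codeNorm s (q i g) ≤ (primeCode (γ i) : ℝ≥0∞) ^ s * codeNorm s g :=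
      fun s i g => codeNorm_shift_le s (γ i) fun β => by
    rw [hq]; split_ifs <;> simp
  have hrn : ∀ s g, codeNorm s (r g) ≤ codeNorm s g := fun s g => by
    refine ENNReal.tsum_le_tsum fun α => mul_le_mul_left ?_ _
    rw [hr]; split_ifs <;> simp
  -- `q i g` and `r g` divide `g` by the leading monomials; replacing these by the `f i` makes an
  -- error `T g`, so that division of `h` with `h - T h = g` yields the quotients of `g`
  let t : Fin m → MvPowerSeries (Fin n) ℂ := fun i => MvPowerSeries.monomial (γ i) 1 - f i
  let T : MvPowerSeries (Fin n) ℂ → MvPowerSeries (Fin n) ℂ := fun g => ∑ i, q i g * t i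
  obtain ⟨s₁, hs₁⟩ := isConvergent_iff_codeNorm.1 hg
  have hlim : Tendsto (fun s => ∑ i, (primeCode (γ i) : ℝ≥0∞) ^ s * codeNorm s (t i)) atTop
      (nhds 0) := by
    have := tendsto_finsetSum (Finset.univ : Finset (Fin m))
      fun i _ => tendsto_codeNorm_tail (hγ i) (hf i)
    simpa using this
  obtain ⟨s, hs, hss₁⟩ := ((hlim.eventually (gt_mem_nhds (ENNReal.inv_pos.2 ENNReal.ofNat_ne_top :
    (0 : ℝ≥0∞) < 2⁻¹))).and (eventually_ge_atTop s₁)).exists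
  have hT : ∀ g, codeNorm s (T g) ≤ 2⁻¹ * codeNorm s g := fun g => by
    calc codeNorm s (T g) ≤ ∑ i, codeNorm s (q i g * t i) := codeNorm_sum_le _ _ _
      _ ≤ ∑ i, (primeCode (γ i) : ℝ≥0∞) ^ s * codeNorm s (t i) * codeNorm s g :=
          Finset.sum_le_sum fun i _ => by
            refine (codeNorm_mul_le _ _ _).trans ((mul_le_mul_left (hqn s i g) _).trans_eq ?_)
            ring
      _ ≤ _ := by
          rw [← Finset.sum_mul]
          exact mul_le_mul_left hs.le _
  have hcont : ∀ (g : ℕ → MvPowerSeries (Fin n) ℂ) (h : MvPowerSeries (Fin n) ℂ),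
      (∀ α, HasSum (fun k => MvPowerSeries.coeff α (g k)) (MvPowerSeries.coeff α h)) →
      ∀ α, HasSum (fun k => MvPowerSeries.coeff α (T (g k))) (MvPowerSeries.coeff α (T h)) := by
    intro g h hgh α
    simp only [T, map_sum, MvPowerSeries.coeff_mul]
    refine hasSum_sum fun i _ => hasSum_sum fun p _ => HasSum.mul_right _ ?_
    simp only [hq]
    split_ifs
    · exact hgh _
    · exact hasSum_zero
  obtain ⟨h, hh, hTh⟩ := exists_sub_eq_of_contraction s T hT hcont
    (ne_top_of_le_ne_top hs₁ (codeNorm_anti hss₁ g))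
  refine ⟨fun i => q i h, r h, fun i => isConvergent_iff_codeNorm.2 ⟨s, ?_⟩,
    isConvergent_iff_codeNorm.2 ⟨s, ne_top_of_le_ne_top hh (hrn s h)⟩, ?_, fun i α hi => ?_⟩
  · exact ne_top_of_le_ne_top
      (ENNReal.mul_ne_top (ENNReal.pow_ne_top (ENNReal.natCast_ne_top _)) hh) (hqn s i h)
  · rw [← hTh]
    conv_lhs => lhs; rw [← hqr h]
    simp only [T, t, mul_sub, Finset.sum_sub_distrib]
    have : ∀ i, MvPowerSeries.monomial (γ i) (1 : ℂ) * q i h =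
      q i h * MvPowerSeries.monomial (γ i) 1 := fun i => mul_comm _ _
    simp only [this]
    abel
  · rw [hr, if_neg fun hn => hc2 α hn i hi]

theorem exists_isLeading {f : O n} (hf : f ≠ 0) :
    ∃ γ, ∃ c : ℂ, c ≠ 0 ∧ IsLeading (c • f).1 γ := by
  have hne : ∃ k, ∃ α, MvPowerSeries.coeff α f.1 ≠ 0 ∧ primeCode α = k := by
    by_contra h
    push Not at h
    refine hf (Subtype.ext (MvPowerSeries.ext fun α => ?_))
    by_contra h0
    exact h _ α h0 rfl
  classical
  obtain ⟨γ, hγ, hk⟩ := Nat.find_spec hne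
  refine ⟨γ, (MvPowerSeries.coeff γ f.1)⁻¹, inv_ne_zero hγ, inv_mul_cancel₀ hγ, fun α hα => ?_⟩
  rw [hk]
  refine Nat.find_min' hne ⟨α, fun h0 => hα ?_, rfl⟩
  change (MvPowerSeries.coeff γ f.1)⁻¹ * MvPowerSeries.coeff α f.1 = 0
  rw [h0, mul_zero]

/-- Rückert's basis theorem: `ℂ{x₁, …, xₙ}` is Noetherian. By Dickson's lemma the leading exponents
of an ideal are the multiples of finitely many of them, and division with remainder shows that the
corresponding series generate the ideal. -/
instance isNoetherianRing_O (n : ℕ) : IsNoetherianRing (O n) := by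
  classical
  rw [isNoetherianRing_iff_ideal_fg]
  intro I
  let E : Set (Fin n →₀ ℕ) := {γ | ∃ f ∈ I, IsLeading f.1 γ}
  have hfin : {γ | Minimal (· ∈ E) γ}.Finite :=
    WellQuasiOrderedLE.finite_of_isAntichain (setOfPred_minimal_antichain _)
  obtain ⟨m, γ, hγ⟩ : ∃ (m : ℕ) (γ : Fin m → Fin n →₀ ℕ),
      Set.range γ = {γ | Minimal (· ∈ E) γ} := by
    obtain ⟨m, e, -, he⟩ := hfin.fin_param
    exact ⟨m, e, he⟩
  have hγE : ∀ i, ∃ f ∈ I, IsLeading f.1 (γ i) := fun i =>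
    Minimal.prop (P := (· ∈ E)) (hγ ▸ Set.mem_range_self i : γ i ∈ {γ | Minimal (· ∈ E) γ})
  choose f hfI hf using hγE
  refine ⟨Finset.univ.image f, le_antisymm (Ideal.span_le.2 ?_) fun g hg => ?_⟩
  · intro x hx
    obtain ⟨i, -, rfl⟩ := Finset.mem_image.1 (Finset.mem_coe.1 hx)
    exact hfI i
  · obtain ⟨q, r, hq, hr, hgqr, hr0⟩ := exists_division (fun i => (f i).2) hf g.2
    let q' : Fin m → O n := fun i => ⟨q i, hq i⟩
    let r' : O n := ⟨r, hr⟩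
    have hg' : g = ∑ i, q' i * f i + r' := Subtype.ext (by
      rw [hgqr]
      simp [q', r'])
    have hsum : ∑ i, q' i * f i ∈ Ideal.span (Finset.univ.image f : Set (O n)) :=
      sum_mem fun i _ => Ideal.mul_mem_left _ _ (Ideal.subset_span (by simp))
    suffices hr' : r' = 0 by rw [hg', hr', add_zero]; exact hsum
    by_contra hne
    have hrI : r' ∈ I := by
      have : r' = g - ∑ i, q' i * f i := by rw [hg', add_sub_cancel_left]
      rw [this]
      exact sub_mem hg (sum_mem fun i _ => Ideal.mul_mem_left _ _ (hfI i))
    obtain ⟨δ, c, hc, hδ⟩ := exists_isLeading hne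
    have hδE : δ ∈ E := ⟨c • r', by
      rw [Algebra.smul_def]; exact Ideal.mul_mem_left _ _ hrI, hδ⟩
    obtain ⟨ε, hεδ, hε⟩ := exists_minimal_le_of_wellFoundedLT (· ∈ E) δ hδE
    obtain ⟨i, rfl⟩ : ε ∈ Set.range γ := hγ ▸ hε
    have h1 : c * MvPowerSeries.coeff δ r = 1 := hδ.1
    rw [hr0 i δ hεδ, mul_zero] at h1
    exact zero_ne_one h1

/-- A convergent power series with non-zero constant term is invertible. -/
theorem exists_mul_eq_one {a : O n} (ha : MvPowerSeries.constantCoeff a.1 ≠ 0) :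
    ∃ b : O n, b * a = 1 := by
  set c := (MvPowerSeries.constantCoeff a.1)⁻¹
  have hlead : ∀ _ : Fin 1, IsLeading (c • a).1 0 := fun _ => by
    refine ⟨inv_mul_cancel₀ ha, fun α _ => ?_⟩
    have : primeCode (0 : Fin n →₀ ℕ) = 1 := by simp [primeCode]
    rw [this]
    exact primeCode_pos α
  obtain ⟨q, r, hq, hr, hqr, hr0⟩ := exists_division (fun _ => (c • a).2) hlead (1 : O n).2
  have hr0 : r = 0 := MvPowerSeries.ext fun α => hr0 0 α zero_le
  refine ⟨c • ⟨q 0, hq 0⟩, Subtype.ext ?_⟩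
  rw [hr0, add_zero, Fin.sum_univ_one] at hqr
  rw [hqr]
  change c • q 0 * a.1 = q 0 * (c • a.1)
  rw [smul_mul_assoc, mul_smul_comm]

/-- If each monomial of `a` is divisible by a coordinate `xᵢ` with `i ∈ J`, then `a = ∑_{i ∈ J} xᵢ bᵢ`
where the monomials of `xᵢ bᵢ` are among those of `a`. -/
theorem exists_eq_sum_coord_mul (J : Set (Fin n)) (a : O n)
    (h : ∀ α, MvPowerSeries.coeff α a.1 ≠ 0 → ∃ i ∈ J, α i ≠ 0) :
    ∃ b : Fin n → O n, a = ∑ i, coord i * b i ∧ (∀ i, i ∉ J → b i = 0) ∧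
      ∀ i α, MvPowerSeries.coeff α (b i).1 ≠ 0 →
        MvPowerSeries.coeff (α + Finsupp.single i 1) a.1 ≠ 0 := by
  classical
  have h' : ∀ α, ∃ c : Option (Fin n), MvPowerSeries.coeff α a.1 ≠ 0 →
      ∃ i ∈ J, α i ≠ 0 ∧ c = some i := fun α => by
    by_cases h0 : MvPowerSeries.coeff α a.1 = 0
    · exact ⟨none, fun h1 => absurd h0 h1⟩
    · obtain ⟨i, hi, hαi⟩ := h α h0
      exact ⟨some i, fun _ => ⟨i, hi, hαi, rfl⟩⟩
  choose c hc using h'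
  let b : Fin n → MvPowerSeries (Fin n) ℂ := fun i α =>
    if c (α + Finsupp.single i 1) = some i then MvPowerSeries.coeff (α + Finsupp.single i 1) a.1 else 0
  have hb : ∀ i α, MvPowerSeries.coeff α (b i) = if c (α + Finsupp.single i 1) = some i then
      MvPowerSeries.coeff (α + Finsupp.single i 1) a.1 else 0 := fun _ _ => rfl
  refine ⟨fun i => ⟨b i, a.2.shift (Finsupp.single i 1) fun β => ?_⟩, Subtype.ext ?_,
    fun i hi => Subtype.ext (MvPowerSeries.ext fun α => ?_), fun i α hα => ?_⟩
  · rw [hb]; split_ifs <;> simp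
  · ext α
    have h1 : (∑ i, coord i * (⟨b i, a.2.shift (Finsupp.single i 1) fun β => by
        rw [hb]; split_ifs <;> simp⟩ : O n)).1 =
        ∑ i, MvPowerSeries.monomial (Finsupp.single i 1) (1 : ℂ) * b i := by
      rw [AddSubmonoidClass.coe_finsetSum]
      rfl
    rw [h1, map_sum]
    have h2 : ∀ i, MvPowerSeries.coeff α (MvPowerSeries.monomial (Finsupp.single i 1) (1 : ℂ) * b i)
        = if c α = some i then MvPowerSeries.coeff α a.1 else 0 := fun i => by
      rw [MvPowerSeries.coeff_monomial_mul]
      by_cases hi : Finsupp.single i 1 ≤ α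
      · rw [if_pos hi, one_mul, hb, tsub_add_cancel_of_le hi]
      · rw [if_neg hi]
        split_ifs with hic
        · by_contra h0
          obtain ⟨j, -, hj, hcj⟩ := hc α (Ne.symm h0)
          obtain rfl : i = j := Option.some.inj (hic.symm.trans hcj)
          exact hi (Finsupp.single_le_iff.2 (Nat.one_le_iff_ne_zero.2 hj))
        · rfl
    simp only [h2]
    by_cases h0 : MvPowerSeries.coeff α a.1 = 0
    · simp [h0]
    · obtain ⟨j, -, -, hcj⟩ := hc α h0
      simp [hcj]
  · rw [hb]
    split_ifs with hic
    · by_contra h0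
      obtain ⟨j, hj, -, hcj⟩ := hc _ h0
      exact hi (Option.some.inj (hic.symm.trans hcj) ▸ hj)
    · rfl
  · change MvPowerSeries.coeff α (b i) ≠ 0 at hα
    rw [hb] at hα
    split_ifs at hα with hic
    · exact hα
    · exact absurd rfl hα

end PowerSeries

/-! ### Normal forms of differential operators -/

section NormalForm

variable {n : ℕ}

/-- `∂^γ` multiplies the coefficient of `x^(α+γ)` by a non-zero integer and moves it to `x^α`. -/
theorem exists_coeff_partialPow (γ α : Fin n →₀ ℕ) : ∃ c : ℕ, c ≠ 0 ∧ ∀ f : O n,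
    MvPowerSeries.coeff α (partialPow γ f).1 = c * MvPowerSeries.coeff (α + γ) f.1 := by
  induction γ using Finsupp.induction_linear generalizing α with
  | zero => exact ⟨1, one_ne_zero, fun f => by rw [partialPow_zero, add_zero]; simp⟩
  | add β γ hβ hγ =>
    obtain ⟨c, hc, h⟩ := hβ α
    obtain ⟨c', hc', h'⟩ := hγ (α + β)
    refine ⟨c * c', mul_ne_zero hc hc', fun f => ?_⟩
    rw [partialPow_add]
    refine (h (partialPow γ f)).trans ?_
    rw [h', Nat.cast_mul, mul_assoc, add_assoc]
  | single i m =>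
    induction m generalizing α with
    | zero => exact ⟨1, one_ne_zero, fun f => by
        rw [Finsupp.single_zero, partialPow_zero, add_zero]; simp⟩
    | succ m ih =>
      obtain ⟨c, hc, h⟩ := ih α
      refine ⟨c * ((α + Finsupp.single i m) i + 1), mul_ne_zero hc (Nat.succ_ne_zero _), fun f => ?_⟩
      rw [Finsupp.single_add, partialPow_add, partialPow_single]
      refine (h (partialOp i f)).trans ?_
      change _ * MvPowerSeries.coeff _ (MvPowerSeries.pderiv ℂ i f.1) = _
      rw [MvPowerSeries.coeff_pderiv, add_assoc]
      push_cast
      ring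

/-- The operator `∑ g_β ∂^β`. -/
def ofNormalForm (g : (Fin n →₀ ℕ) →₀ O n) : Module.End ℂ (O n) :=
  g.sum fun β a => mulOp a * partialPow β

theorem ofNormalForm_sub (g h : (Fin n →₀ ℕ) →₀ O n) :
    ofNormalForm (g - h) = ofNormalForm g - ofNormalForm h := by
  refine Finsupp.sum_sub_index fun β a b => ?_
  rw [sub_eq_add_neg, mulOp_add, mulOp_neg, ← sub_eq_add_neg, sub_mul]

/-- The normal form of a differential operator is unique: an exponent `β` of least degree in a
putative relation is detected on `x^β`. -/
theorem ofNormalForm_injective : Function.Injective (ofNormalForm (n := n)) := by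
  classical
  suffices ∀ g : (Fin n →₀ ℕ) →₀ O n, ofNormalForm g = 0 → g = 0 by
    intro g h hgh
    exact sub_eq_zero.1 (this (g - h) (by rw [ofNormalForm_sub, hgh, sub_self]))
  intro g hg
  by_contra hne
  obtain ⟨β, hβ, hmin⟩ := g.support.exists_min_image Finsupp.degree (Finsupp.support_nonempty_iff.2 hne)
  let x : O n := ⟨MvPowerSeries.monomial β 1,
    1, one_pos, summable_of_ne_finset_zero (s := {β}) fun α hα => by
      rw [MvPowerSeries.coeff_monomial, if_neg (by simpa using hα)]
      simp⟩
  have h1 := LinearMap.congr_fun hg x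
  rw [ofNormalForm, Finsupp.sum, LinearMap.sum_apply, Finset.sum_eq_single β] at h1
  · have h2 : (g β).1 * (partialPow β x).1 = 0 := congrArg Subtype.val h1
    have h3 : ∀ α, α ≠ 0 → MvPowerSeries.coeff α (partialPow β x).1 = 0 := fun α hα => by
      obtain ⟨c, -, h⟩ := exists_coeff_partialPow β α
      rw [h, MvPowerSeries.coeff_monomial, if_neg (by simpa using hα), mul_zero]
    obtain ⟨c, hc, h⟩ := exists_coeff_partialPow β 0
    refine Finsupp.mem_support_iff.1 hβ (Subtype.ext ?_)
    rcases mul_eq_zero.1 h2 with h4 | h4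
    · exact h4
    · have h5 := h x
      rw [h4, zero_add, MvPowerSeries.coeff_monomial_same, mul_one, map_zero] at h5
      exact absurd h5.symm (Nat.cast_ne_zero.2 hc)
  · intro γ hγ hγβ
    have h2 : partialPow γ x = 0 := by
      refine Subtype.ext (MvPowerSeries.ext fun α => ?_)
      obtain ⟨c, -, h⟩ := exists_coeff_partialPow γ α
      rw [h, MvPowerSeries.coeff_monomial, if_neg, mul_zero]
      · rfl
      · intro hαγ
        have h3 := hmin γ hγ
        rw [← hαγ, map_add] at h3
        have h4 : α = 0 := (Finsupp.degree_eq_zero_iff α).1 (by omega)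
        rw [h4, zero_add] at hαγ
        exact hγβ hαγ
    change g γ * partialPow γ x = 0
    rw [h2, mul_zero]
  · intro h
    exact absurd hβ h

theorem exists_normalForm {w : Weight n} {p : ℤ × ℤ} {P : D n} (hP : P ∈ bifilt w p) :
    ∃ g : (Fin n →₀ ℕ) →₀ O n, D.toEnd n P = ofNormalForm g ∧
      ∀ β α, MvPowerSeries.coeff α (g β).1 ≠ 0 →
        (β.degree : ℤ) ≤ p.1 ∧ wt w.u α + wt w.v β ≤ p.2 := by
  obtain ⟨⟨g, hg, hg1⟩, ⟨h, hh, hh1⟩⟩ := hP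
  have : g = h := ofNormalForm_injective (hg.symm.trans hh)
  subst this
  refine ⟨g, hg, fun β α hα => ⟨?_, hh1 β α hα⟩⟩
  have := hg1 β α hα
  simp only [wt, zero_mul, one_mul, Finset.sum_const_zero, zero_add] at this
  rwa [Finsupp.degree_eq_sum, Nat.cast_sum]

theorem toEnd_injective : Function.Injective (D.toEnd n) := Subtype.val_injective

/-- Multiplication by a convergent power series, as an element of `𝒟`. -/
def mulD (a : O n) : D n := ⟨mulOp a, Algebra.subset_adjoin (Or.inl ⟨a, rfl⟩)⟩

theorem partialPow_mem (β : Fin n →₀ ℕ) : partialPow β ∈ diffOps n := by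
  induction β using Finsupp.induction_linear with
  | zero => rw [partialPow_zero]; exact one_mem _
  | add β γ hβ hγ => rw [partialPow_add]; exact mul_mem hβ hγ
  | single i m =>
    induction m with
    | zero => rw [Finsupp.single_zero, partialPow_zero]; exact one_mem _
    | succ m ih =>
      rw [Finsupp.single_add, partialPow_add, partialPow_single]
      exact mul_mem ih (Algebra.subset_adjoin (Or.inr ⟨i, rfl⟩))

/-- `∂^β` as an element of `𝒟`. -/
def partialD (β : Fin n →₀ ℕ) : D n := ⟨partialPow β, partialPow_mem β⟩

theorem mulD_mul (a b : O n) : mulD (a * b) = mulD a * mulD b := Subtype.ext (mulOp_mul a b)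

theorem mulD_one : mulD (1 : O n) = 1 := Subtype.ext mulOp_one

theorem mulD_zero : mulD (0 : O n) = 0 := Subtype.ext mulOp_zero

theorem mulD_add (a b : O n) : mulD (a + b) = mulD a + mulD b := Subtype.ext (mulOp_add a b)

theorem mulD_sum {ι : Type*} (J : Finset ι) (a : ι → O n) :
    mulD (∑ i ∈ J, a i) = ∑ i ∈ J, mulD (a i) :=
  map_sum (AddMonoidHom.mk' (mulD (n := n)) mulD_add) a J

theorem partialD_add (β γ : Fin n →₀ ℕ) : partialD (β + γ) = partialD β * partialD γ :=
  Subtype.ext (partialPow_add β γ)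

theorem partialD_zero : partialD (0 : Fin n →₀ ℕ) = 1 :=
  toEnd_injective (partialPow_zero.trans (map_one (D.toEnd n)).symm)

theorem wt_one_left (β : Fin n →₀ ℕ) : wt (fun _ => 1) β = β.degree := by
  rw [Finsupp.degree_eq_sum]; simp [wt]

theorem mulD_mem {w : Weight n} {a : O n} {d k : ℤ} (hd : 0 ≤ d)
    (h : ∀ α, MvPowerSeries.coeff α a.1 ≠ 0 → wt w.u α ≤ k) : mulD a ∈ bifilt w (d, k) := by
  refine ⟨opFilt_mono hd (mulOp_mem (fun _ => le_rfl) a), ?_⟩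
  have := monomial_mem (u := w.u) (v := w.v) (k := k) a 0 fun α hα => by
    rw [wt_zero, add_zero]; exact h α hα
  rwa [partialPow_zero, mul_one] at this

theorem partialD_mem (w : Weight n) (β : Fin n →₀ ℕ) :
    partialD β ∈ bifilt w ((β.degree : ℤ), wt w.v β) := by
  have key : ∀ (u v : Fin n → ℤ), (∀ i, u i ≤ 0) → partialPow β ∈ opFilt u v (wt v β) :=
    fun u v hu => by
      have := monomial_mem (u := u) (v := v) (k := wt v β) 1 β fun α _ => by
        linarith [wt_nonpos hu α]
      rwa [mulOp_one, one_mul] at this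
  refine ⟨?_, key _ _ w.u_nonpos⟩
  have := key (fun _ => 0) (fun _ => 1) fun _ => le_rfl
  rwa [wt_one_left] at this

/-- An additive subgroup contains `F_{d,k}(𝒟)` as soon as it contains the operators `a ∂^β` in it. -/
theorem bifilt_induction {w : Weight n} {p : ℤ × ℤ} (S : AddSubgroup (D n))
    (h : ∀ (a : O n) (β : Fin n →₀ ℕ), (β.degree : ℤ) ≤ p.1 →
      (∀ α, MvPowerSeries.coeff α a.1 ≠ 0 → wt w.u α ≤ p.2 - wt w.v β) →
      mulD a * partialD β ∈ S) {P : D n} (hP : P ∈ bifilt w p) : P ∈ S := by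
  obtain ⟨g, hg, hg1⟩ := exists_normalForm hP
  have h1 : P = ∑ β ∈ g.support, mulD (g β) * partialD β := by
    apply toEnd_injective
    rw [hg, map_sum]
    rfl
  rw [h1]
  refine sum_mem fun β hβ => ?_
  have hne : ∃ α, MvPowerSeries.coeff α (g β).1 ≠ 0 := by
    by_contra hcon
    push Not at hcon
    exact Finsupp.mem_support_iff.1 hβ (Subtype.ext (MvPowerSeries.ext hcon))
  obtain ⟨α, hα⟩ := hne
  exact h _ _ (hg1 β α hα).1 fun α hα => by linarith [(hg1 β α hα).2]

theorem eq_zero_of_mem_bifilt {w : Weight n} {p : ℤ × ℤ} (hp : p.1 < 0) {P : D n}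
    (hP : P ∈ bifilt w p) : P = 0 :=
  bifilt_induction (w := w) (p := p) ⊥ (fun a β hβ _ => by
    have : (0 : ℤ) ≤ β.degree := Int.natCast_nonneg _
    omega) hP

theorem exists_eq_mulD {w : Weight n} {k : ℤ} {P : D n} (hP : P ∈ bifilt w (0, k)) :
    ∃ a : O n, P = mulD a ∧ ∀ α, MvPowerSeries.coeff α a.1 ≠ 0 → wt w.u α ≤ k := by
  let S : AddSubgroup (D n) :=
    { carrier := {P | ∃ a : O n, P = mulD a ∧ ∀ α, MvPowerSeries.coeff α a.1 ≠ 0 → wt w.u α ≤ k}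
      zero_mem' := ⟨0, mulD_zero.symm, fun α hα => absurd (map_zero _) hα⟩
      add_mem' := by
        rintro _ _ ⟨a, rfl, ha⟩ ⟨b, rfl, hb⟩
        refine ⟨a + b, (mulD_add a b).symm, fun α hα => ?_⟩
        by_cases h0 : MvPowerSeries.coeff α a.1 = 0
        · refine hb α fun h1 => hα ?_
          change MvPowerSeries.coeff α (a.1 + b.1) = 0
          rw [map_add, h0, h1, add_zero]
        · exact ha α h0
      neg_mem' := by
        rintro _ ⟨a, rfl, ha⟩
        refine ⟨-a, Subtype.ext (mulOp_neg a).symm, fun α hα => ha α fun h0 => hα ?_⟩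
        change MvPowerSeries.coeff α (-a.1) = 0
        rw [map_neg, h0, neg_zero] }
  refine bifilt_induction (w := w) (p := (0, k)) S (fun a β hβ ha => ⟨a, ?_, fun α hα => ?_⟩) hP
  · have : β = 0 := (Finsupp.degree_eq_zero_iff β).1 (by simpa using hβ)
    rw [this, partialD_zero, mul_one]
  · have : β = 0 := (Finsupp.degree_eq_zero_iff β).1 (by simpa using hβ)
    have h1 := ha α hα
    rwa [this, wt_zero, sub_zero] at h1

/-! ### The residue field -/

/-- The value at `0` of `P(1)`. On `F_{0,0}(𝒟) = ℂ{x}` it is the evaluation at `0`. -/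
def residue (n : ℕ) : D n →+ ℂ where
  toFun P := MvPowerSeries.constantCoeff (D.toEnd n P 1).1
  map_zero' := by simp
  map_add' P Q := by
    rw [map_add]
    exact map_add MvPowerSeries.constantCoeff _ _

theorem residue_mulD (a : O n) : residue n (mulD a) = MvPowerSeries.constantCoeff a.1 := by
  change MvPowerSeries.constantCoeff (a * 1 : O n).1 = _
  rw [mul_one]

theorem constantCoeff_eq_zero {w : Weight n} {a : O n} {k : ℤ} (hk : k < 0)
    (h : ∀ α, MvPowerSeries.coeff α a.1 ≠ 0 → wt w.u α ≤ k) :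
    MvPowerSeries.constantCoeff a.1 = 0 := by
  by_contra h0
  have := h 0 h0
  rw [wt_zero] at this
  omega

theorem isLocalFamily_bifilt (w : Weight n) : IsLocalFamily (bifilt w) (residue n) where
  one_mem := one_mem_bifilt w
  mul_mem := bifilt_mul_mem w
  map_one := by
    rw [← mulD_one, residue_mulD]
    exact map_one _
  map_mul {P Q} hP hQ := by
    obtain ⟨a, rfl, -⟩ := exists_eq_mulD hP
    obtain ⟨b, rfl, -⟩ := exists_eq_mulD hQ
    rw [← mulD_mul, residue_mulD, residue_mulD, residue_mulD]
    exact map_mul _ _ _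
  map_mul_of_ne {p q P Q} hP hQ hpq hp := by
    obtain ⟨d, k⟩ := p
    obtain ⟨d', k'⟩ := q
    obtain ⟨h1, h2⟩ : d + d' = 0 ∧ k + k' = 0 := ⟨congrArg Prod.fst hpq, congrArg Prod.snd hpq⟩
    rcases lt_trichotomy d 0 with hd | rfl | hd
    · rw [eq_zero_of_mem_bifilt hd hP, zero_mul, map_zero]
    · obtain rfl : d' = 0 := by omega
      obtain ⟨a, rfl, ha⟩ := exists_eq_mulD hP
      obtain ⟨b, rfl, hb⟩ := exists_eq_mulD hQ
      rw [← mulD_mul, residue_mulD]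
      change MvPowerSeries.constantCoeff (a.1 * b.1) = 0
      have hk : k ≠ 0 := fun h => hp (by rw [h]; rfl)
      rcases lt_or_gt_of_ne hk with hk | hk
      · rw [map_mul, constantCoeff_eq_zero hk ha, zero_mul]
      · rw [map_mul, constantCoeff_eq_zero (by omega) hb, mul_zero]
    · rw [eq_zero_of_mem_bifilt (show ((d', k') : ℤ × ℤ).1 < 0 by simp; omega) hQ, mul_zero,
        map_zero]
  exists_inv {P} hP hχ := by
    obtain ⟨a, rfl, -⟩ := exists_eq_mulD hP
    rw [residue_mulD] at hχ
    obtain ⟨b, hb⟩ := exists_mul_eq_one hχ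
    exact ⟨mulD b, mulD_mem le_rfl fun α _ => wt_nonpos w.u_nonpos α,
      by rw [← mulD_mul, hb, mulD_one]⟩

/-! ### Commutators -/

/-- `[P, Q] ∈ F_{p+q-(1,0)}(𝒟)`, for `P ∈ F_p(𝒟)` and `Q ∈ F_q(𝒟)`. -/
structure CommutesTo (w : Weight n) (p q : ℤ × ℤ) (P Q : D n) : Prop where
  left_mem : P ∈ bifilt w p
  right_mem : Q ∈ bifilt w q
  bracket_mem : P * Q - Q * P ∈ bifilt w (p + q - (1, 0))

theorem CommutesTo.symm {w : Weight n} {p q : ℤ × ℤ} {P Q : D n} (h : CommutesTo w p q P Q) :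
    CommutesTo w q p Q P :=
  ⟨h.right_mem, h.left_mem, by
    rw [← neg_sub (P * Q), add_comm q p]; exact neg_mem h.bracket_mem⟩

theorem CommutesTo.mul_left {w : Weight n} {p p' q : ℤ × ℤ} {P P' Q : D n}
    (h : CommutesTo w p q P Q) (h' : CommutesTo w p' q P' Q) :
    CommutesTo w (p + p') q (P * P') Q :=
  ⟨bifilt_mul_mem w h.left_mem h'.left_mem, h.right_mem, by
    have h1 := bifilt_mul_mem w h.left_mem h'.bracket_mem
    have h2 := bifilt_mul_mem w h.bracket_mem h'.left_mem
    rw [show p + (p' + q - (1, 0)) = p + p' + q - (1, 0) by abel] at h1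
    rw [show p + q - (1, 0) + p' = p + p' + q - (1, 0) by abel] at h2
    have h3 : P * P' * Q - Q * (P * P') = P * (P' * Q - Q * P') + (P * Q - Q * P) * P' := by
      noncomm_ring
    rw [h3]
    exact add_mem h1 h2⟩

theorem CommutesTo.of_commute {w : Weight n} {p q : ℤ × ℤ} {P Q : D n} (hP : P ∈ bifilt w p)
    (hQ : Q ∈ bifilt w q) (h : P * Q = Q * P) : CommutesTo w p q P Q :=
  ⟨hP, hQ, by rw [h, sub_self]; exact zero_mem _⟩

theorem partialD_single_commutesTo {w : Weight n} {a : O n} {k : ℤ}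
    (ha : ∀ α, MvPowerSeries.coeff α a.1 ≠ 0 → wt w.u α ≤ k) (i : Fin n) :
    CommutesTo w (1, w.v i) (0, k) (partialD (Finsupp.single i 1)) (mulD a) where
  left_mem := by simpa [wt_single] using partialD_mem w (Finsupp.single i 1)
  right_mem := mulD_mem le_rfl ha
  bracket_mem := by
    have h1 : partialD (Finsupp.single i 1) * mulD a - mulD a * partialD (Finsupp.single i 1) =
        mulD (partialOp i a) := by
      rw [sub_eq_iff_eq_add']
      refine Subtype.ext ?_
      change partialPow (Finsupp.single i 1) * mulOp a = _
      rw [partialPow_single, partialOp_mul_mulOp, ← partialPow_single]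
      rfl
    rw [h1]
    refine mulD_mem (by simp) fun α hα => ?_
    change MvPowerSeries.coeff α (MvPowerSeries.pderiv ℂ i a.1) ≠ 0 at hα
    rw [MvPowerSeries.coeff_pderiv] at hα
    have h2 := ha _ (left_ne_zero_of_mul hα)
    rw [wt_add, wt_single] at h2
    have := w.add_nonneg i
    simp only [Prod.snd_add]
    linarith

theorem partialD_commutesTo {w : Weight n} {a : O n} {k : ℤ}
    (ha : ∀ α, MvPowerSeries.coeff α a.1 ≠ 0 → wt w.u α ≤ k) (β : Fin n →₀ ℕ) :
    CommutesTo w ((β.degree : ℤ), wt w.v β) (0, k) (partialD β) (mulD a) := by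
  have h0 : CommutesTo w (((0 : Fin n →₀ ℕ).degree : ℤ), wt w.v 0) (0, k) (partialD 0) (mulD a) :=
    CommutesTo.of_commute (partialD_mem w 0) (mulD_mem le_rfl ha) (by simp [partialD_zero])
  have hadd : ∀ β γ : Fin n →₀ ℕ, (((β + γ).degree : ℤ), wt w.v (β + γ)) =
      ((β.degree : ℤ), wt w.v β) + ((γ.degree : ℤ), wt w.v γ) := fun β γ => by
    rw [map_add, wt_add]; simp
  induction β using Finsupp.induction_linear with
  | zero => exact h0
  | add β γ hβ hγ =>
    rw [partialD_add, hadd]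
    exact hβ.mul_left hγ
  | single i m =>
    induction m with
    | zero => rw [Finsupp.single_zero]; exact h0
    | succ m ih =>
      rw [Finsupp.single_add, partialD_add, hadd]
      refine ih.mul_left ?_
      rw [Finsupp.degree_single, wt_single]
      exact partialD_single_commutesTo ha i

/-- The commutator lowers the order of a differential operator and does not increase its weight. -/
theorem bracket_mem_bifilt {w : Weight n} {p q : ℤ × ℤ} {P Q : D n} (hP : P ∈ bifilt w p)
    (hQ : Q ∈ bifilt w q) : P * Q - Q * P ∈ bifilt w (p + q - (1, 0)) := by
  have hmono : ∀ (a : O n) (β : Fin n →₀ ℕ) (p : ℤ × ℤ), (β.degree : ℤ) ≤ p.1 →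
      (0, p.2 - wt w.v β) + ((β.degree : ℤ), wt w.v β) ≤ p := fun a β p h =>
    ⟨by simpa using h, by simp⟩
  refine bifilt_induction (w := w) (p := p)
    ((bifilt w (p + q - (1, 0))).comap (AddMonoidHom.mulRight Q - AddMonoidHom.mulLeft Q))
    (fun a β hβ ha => ?_) hP
  change mulD a * partialD β * Q - Q * (mulD a * partialD β) ∈ bifilt w (p + q - (1, 0))
  refine bifilt_induction (w := w) (p := q) ((bifilt w (p + q - (1, 0))).comap
    (AddMonoidHom.mulLeft (mulD a * partialD β) - AddMonoidHom.mulRight (mulD a * partialD β)))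
    (fun b γ hγ hb => ?_) hQ
  change mulD a * partialD β * (mulD b * partialD γ) - mulD b * partialD γ * (mulD a * partialD β) ∈
    bifilt w (p + q - (1, 0))
  have h1 : CommutesTo w (0, p.2 - wt w.v β) (0, q.2 - wt w.v γ) (mulD a) (mulD b) :=
    CommutesTo.of_commute (mulD_mem le_rfl ha) (mulD_mem le_rfl hb)
      (by rw [← mulD_mul, ← mulD_mul, mul_comm])
  have h2 : CommutesTo w ((β.degree : ℤ), wt w.v β) ((γ.degree : ℤ), wt w.v γ)
      (partialD β) (partialD γ) :=
    CommutesTo.of_commute (partialD_mem w β) (partialD_mem w γ)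
      (by rw [← partialD_add, ← partialD_add, add_comm])
  have h3 := (h1.mul_left (partialD_commutesTo hb β)).symm
  have h4 := ((partialD_commutesTo ha γ).symm.mul_left h2).symm
  refine bifilt_mono w ?_ (h3.mul_left h4).symm.bracket_mem
  exact sub_le_sub_right (add_le_add (hmono a β p hβ) (hmono b γ q hγ)) _

end NormalForm

/-! ### Symbols -/

section Symbol

variable {M : Type*} [AddCommGroup M] (S : Set (ℤ × ℤ)) (F : ℤ × ℤ → AddSubgroup M)

/-- The projection of an associated bigraded object onto its part of degree `p`. -/
def homPart (p : ℤ × ℤ) : (⨁ p, GrPiece S F p) →+ ⨁ p, GrPiece S F p :=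
  (DirectSum.of (GrPiece S F) p).comp (DFinsupp.evalAddMonoidHom p)

variable {F}

/-- The class of `x ∈ F_p` in the associated bigraded object. -/
def symbol {p : ℤ × ℤ} {x : M} (hx : x ∈ F p) : ⨁ p, GrPiece S F p :=
  DirectSum.of (GrPiece S F) p (QuotientAddGroup.mk ⟨x, hx⟩)

variable {S}

theorem symbol_congr {p q : ℤ × ℤ} {x y : M} {hx : x ∈ F p} {hy : y ∈ F q} (h : p = q)
    (hxy : x = y) : symbol S hx = symbol S hy := by
  subst h hxy
  rfl

theorem symbol_add {p : ℤ × ℤ} {x y : M} (hx : x ∈ F p) (hy : y ∈ F p) :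
    symbol S (add_mem hx hy) = symbol S hx + symbol S hy :=
  map_add (DirectSum.of (GrPiece S F) p) (QuotientAddGroup.mk ⟨x, hx⟩ : GrPiece S F p)
    (QuotientAddGroup.mk ⟨y, hy⟩ : GrPiece S F p)

theorem symbol_eq_zero_iff {p : ℤ × ℤ} {x : M} (hx : x ∈ F p) :
    symbol S hx = 0 ↔ x ∈ grLow S F p := by
  rw [symbol, ← map_zero (DirectSum.of (GrPiece S F) p), (DirectSum.of_injective p).eq_iff,
    QuotientAddGroup.eq_zero_iff]
  rfl

theorem homPart_symbol_self {p : ℤ × ℤ} {x : M} (hx : x ∈ F p) :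
    homPart S F p (symbol S hx) = symbol S hx :=
  congrArg (DirectSum.of (GrPiece S F) p) (DirectSum.of_eq_same p _)

theorem homPart_symbol_of_ne {p q : ℤ × ℤ} {x : M} (hx : x ∈ F q) (h : q ≠ p) :
    homPart S F p (symbol S hx) = 0 :=
  (congrArg (DirectSum.of (GrPiece S F) p) (DirectSum.of_eq_of_ne q p _ h.symm)).trans (map_zero _)

theorem exists_homPart_eq_symbol (p : ℤ × ℤ) (a : ⨁ p, GrPiece S F p) :
    ∃ (x : M) (hx : x ∈ F p), homPart S F p a = symbol S hx := by
  obtain ⟨⟨x, hx⟩, h⟩ := QuotientAddGroup.mk_surjective (a p)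
  exact ⟨x, hx, congrArg (DirectSum.of (GrPiece S F) p) h.symm⟩

theorem eq_zero_of_homPart {a : ⨁ p, GrPiece S F p} (h : ∀ p, homPart S F p a = 0) : a = 0 := by
  refine DFinsupp.ext fun p => DirectSum.of_injective p ((h p).trans (map_zero _).symm)

theorem exists_sum_homPart (a : ⨁ p, GrPiece S F p) :
    ∃ J : Finset (ℤ × ℤ), a = ∑ p ∈ J, homPart S F p a := by
  classical
  exact ⟨DFinsupp.support a, (DirectSum.sum_support_of a).symm⟩

theorem symbol_induction {motive : (⨁ p, GrPiece S F p) → Prop} (zero : motive 0)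
    (add : ∀ a b, motive a → motive b → motive (a + b))
    (symb : ∀ (p : ℤ × ℤ) (x : M) (hx : x ∈ F p), motive (symbol S hx))
    (a : ⨁ p, GrPiece S F p) : motive a := by
  induction a using DirectSum.induction_on with
  | zero => exact zero
  | add a b ha hb => exact add a b ha hb
  | of p a =>
    obtain ⟨⟨x, hx⟩, rfl⟩ := QuotientAddGroup.mk_surjective a
    exact symb p x hx

theorem mem_range_of_iff {p : ℤ × ℤ} {a : ⨁ p, GrPiece S F p} :
    a ∈ (DirectSum.of (GrPiece S F) p).range ↔ ∃ (x : M) (hx : x ∈ F p), a = symbol S hx := by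
  constructor
  · rintro ⟨a, rfl⟩
    obtain ⟨⟨x, hx⟩, rfl⟩ := QuotientAddGroup.mk_surjective a
    exact ⟨x, hx, rfl⟩
  · rintro ⟨x, hx, rfl⟩
    exact ⟨_, rfl⟩

end Symbol

section GrRing

variable {n : ℕ} {w : Weight n} {S : Set (ℤ × ℤ)}

/-- The class of `P ∈ F_p(𝒟)` in the associated bigraded ring. -/
def ringSymbol (S : Set (ℤ × ℤ)) {p : ℤ × ℤ} {P : D n} (hP : P ∈ bifilt w p) : GrRing w S :=
  symbol S hP

/-- The class of `x ∈ F_p(M)` in the associated bigraded module. -/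
def modSymbol {M : Type*} [AddCommGroup M] [Module (D n) M] (B : Bifiltration w M)
    (S : Set (ℤ × ℤ)) {p : ℤ × ℤ} {x : M} (hx : x ∈ B.F p) : GrMod B S :=
  symbol S hx

theorem ringSymbol_congr {p q : ℤ × ℤ} {P Q : D n} {hP : P ∈ bifilt w p} {hQ : Q ∈ bifilt w q}
    (h : p = q) (hPQ : P = Q) : ringSymbol S hP = ringSymbol S hQ :=
  symbol_congr h hPQ

theorem ringSymbol_add {p : ℤ × ℤ} {P Q : D n} (hP : P ∈ bifilt w p) (hQ : Q ∈ bifilt w p) :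
    ringSymbol S (add_mem hP hQ) = ringSymbol S hP + ringSymbol S hQ :=
  symbol_add hP hQ

theorem ringSymbol_eq_zero_iff {p : ℤ × ℤ} {P : D n} (hP : P ∈ bifilt w p) :
    ringSymbol S hP = 0 ↔ P ∈ grLow S (bifilt w) p :=
  symbol_eq_zero_iff hP

theorem ringSymbol_mul {p q : ℤ × ℤ} {P Q : D n} (hP : P ∈ bifilt w p) (hQ : Q ∈ bifilt w q) :
    ringSymbol S hP * ringSymbol S hQ = ringSymbol S (bifilt_mul_mem w hP hQ) :=
  DirectSum.of_mul_of (A := GrPiece S (bifilt w)) _ _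

theorem one_eq_ringSymbol : (1 : GrRing w S) = ringSymbol S (one_mem_bifilt w) := rfl

theorem ringSymbol_induction {motive : GrRing w S → Prop} (zero : motive 0)
    (add : ∀ a b, motive a → motive b → motive (a + b))
    (symb : ∀ (p : ℤ × ℤ) (P : D n) (hP : P ∈ bifilt w p), motive (ringSymbol S hP))
    (a : GrRing w S) : motive a :=
  symbol_induction (S := S) (F := bifilt w) zero add symb a

theorem mem_grRingPart_iff {p : ℤ × ℤ} {a : GrRing w S} :
    a ∈ grRingPart w S p ↔ ∃ (P : D n) (hP : P ∈ bifilt w p), a = ringSymbol S hP :=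
  mem_range_of_iff (S := S) (F := bifilt w)

/-- The projection of the bigraded ring onto its part of degree `p`. -/
def ringPart (w : Weight n) (S : Set (ℤ × ℤ)) (p : ℤ × ℤ) : GrRing w S →+ GrRing w S :=
  homPart S (bifilt w) p

theorem ringPart_symbol_self {p : ℤ × ℤ} {P : D n} (hP : P ∈ bifilt w p) :
    ringPart w S p (ringSymbol S hP) = ringSymbol S hP :=
  homPart_symbol_self hP

theorem ringPart_symbol_of_ne {p q : ℤ × ℤ} {P : D n} (hP : P ∈ bifilt w q) (h : q ≠ p) :
    ringPart w S p (ringSymbol S hP) = 0 :=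
  homPart_symbol_of_ne hP h

theorem exists_ringPart_eq_symbol (p : ℤ × ℤ) (a : GrRing w S) :
    ∃ (P : D n) (hP : P ∈ bifilt w p), ringPart w S p a = ringSymbol S hP :=
  exists_homPart_eq_symbol (S := S) (F := bifilt w) p a

theorem eq_zero_of_ringPart {a : GrRing w S} (h : ∀ p, ringPart w S p a = 0) : a = 0 :=
  eq_zero_of_homPart (S := S) (F := bifilt w) h

theorem exists_sum_ringPart (a : GrRing w S) :
    ∃ J : Finset (ℤ × ℤ), a = ∑ p ∈ J, ringPart w S p a :=
  exists_sum_homPart (S := S) (F := bifilt w) a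

section Module

variable {M : Type*} [AddCommGroup M] [Module (D n) M] {B : Bifiltration w M}

theorem modSymbol_congr {p q : ℤ × ℤ} {x y : M} {hx : x ∈ B.F p} {hy : y ∈ B.F q}
    (h : p = q) (hxy : x = y) : modSymbol B S hx = modSymbol B S hy :=
  symbol_congr h hxy

theorem modSymbol_add {p : ℤ × ℤ} {x y : M} (hx : x ∈ B.F p) (hy : y ∈ B.F p) :
    modSymbol B S (add_mem hx hy) = modSymbol B S hx + modSymbol B S hy :=
  symbol_add hx hy

theorem modSymbol_eq_zero_iff {p : ℤ × ℤ} {x : M} (hx : x ∈ B.F p) :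
    modSymbol B S hx = 0 ↔ x ∈ grLow S B.F p :=
  symbol_eq_zero_iff hx

theorem modSymbol_zero {p : ℤ × ℤ} (h : (0 : M) ∈ B.F p) : modSymbol B S h = 0 :=
  (modSymbol_eq_zero_iff h).2 (zero_mem _)

theorem modSymbol_sum {p : ℤ × ℤ} {ι : Type*} (J : Finset ι) {x : ι → M} (hx : ∀ j, x j ∈ B.F p) :
    modSymbol B S (sum_mem fun j (_ : j ∈ J) => hx j) = ∑ j ∈ J, modSymbol B S (hx j) := by
  classical
  induction J using Finset.induction_on with
  | empty => exact modSymbol_zero _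
  | insert j J hj ih =>
    refine (modSymbol_congr rfl (Finset.sum_insert hj)).trans ((modSymbol_add (hx j)
      (sum_mem fun j _ => hx j)).trans ?_)
    rw [ih, Finset.sum_insert hj]

theorem modSymbol_induction {motive : GrMod B S → Prop} (zero : motive 0)
    (add : ∀ a b, motive a → motive b → motive (a + b))
    (symb : ∀ (p : ℤ × ℤ) (x : M) (hx : x ∈ B.F p), motive (modSymbol B S hx))
    (a : GrMod B S) : motive a :=
  symbol_induction (S := S) (F := B.F) zero add symb a

theorem mem_grModPart_iff {p : ℤ × ℤ} {a : GrMod B S} :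
    a ∈ grModPart B S p ↔ ∃ (x : M) (hx : x ∈ B.F p), a = modSymbol B S hx :=
  mem_range_of_iff (S := S) (F := B.F)

theorem ringSymbol_smul {p q : ℤ × ℤ} {P : D n} {x : M} (hP : P ∈ bifilt w p) (hx : x ∈ B.F q) :
    ringSymbol S hP • modSymbol B S hx = modSymbol B S (B.smul_mem hP hx) :=
  DirectSum.Gmodule.of_smul_of (A := GrPiece S (bifilt w)) (M := GrPiece S B.F) _ _

/-- The projection of the bigraded module onto its part of degree `p`. -/
def modPart (B : Bifiltration w M) (S : Set (ℤ × ℤ)) (p : ℤ × ℤ) : GrMod B S →+ GrMod B S :=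
  homPart S B.F p

theorem modPart_symbol_self {p : ℤ × ℤ} {x : M} (hx : x ∈ B.F p) :
    modPart B S p (modSymbol B S hx) = modSymbol B S hx :=
  homPart_symbol_self hx

theorem modPart_symbol_of_ne {p q : ℤ × ℤ} {x : M} (hx : x ∈ B.F q) (h : q ≠ p) :
    modPart B S p (modSymbol B S hx) = 0 :=
  homPart_symbol_of_ne hx h

theorem modPart_smul (a : GrRing w S) {p q : ℤ × ℤ} {x : M} (hx : x ∈ B.F q) :
    modPart B S p (a • modSymbol B S hx) = ringPart w S (p - q) a • modSymbol B S hx := by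
  induction a using ringSymbol_induction with
  | zero => rw [zero_smul, map_zero, map_zero, zero_smul]
  | add a b ha hb => rw [add_smul, map_add, ha, hb, map_add, add_smul]
  | symb t P hP =>
    by_cases h : t = p - q
    · subst h
      rw [ringPart_symbol_self, ringSymbol_smul]
      have : modSymbol B S (B.smul_mem hP hx) =
          modSymbol B S (show P • x ∈ B.F p from sub_add_cancel p q ▸ B.smul_mem hP hx) :=
        modSymbol_congr (sub_add_cancel p q) rfl
      rw [this, modPart_symbol_self]
    · rw [ringPart_symbol_of_ne hP h, zero_smul, ringSymbol_smul]
      exact modPart_symbol_of_ne _ fun h' => h (eq_sub_of_add_eq h')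

/-- The part of degree `p` of a relation between symbols: `[x] = ∑ aᵢ [yᵢ]` with `x` in degree `p`
and `yᵢ` in degree `qᵢ` means that `x - ∑ Pᵢ yᵢ` is of lower degree for some
`Pᵢ ∈ F_{p-qᵢ}(𝒟)` that represent the parts of degree `p - qᵢ` of the `aᵢ`. -/
theorem exists_sub_mem_grLow {ι : Type*} [Fintype ι] {p : ℤ × ℤ} {x : M} (hx : x ∈ B.F p)
    {q : ι → ℤ × ℤ} {y : ι → M} (hy : ∀ i, y i ∈ B.F (q i)) {a : ι → GrRing w S}
    (h : modSymbol B S hx = ∑ i, a i • modSymbol B S (hy i)) :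
    ∃ P : ι → D n, (∀ i, ∃ hP : P i ∈ bifilt w (p - q i),
      ringPart w S (p - q i) (a i) = ringSymbol S hP) ∧ x - ∑ i, P i • y i ∈ grLow S B.F p := by
  choose P hP hPa using fun i => exists_ringPart_eq_symbol (p - q i) (a i)
  refine ⟨P, fun i => ⟨hP i, hPa i⟩, ?_⟩
  have hPy : ∀ i, P i • y i ∈ B.F p := fun i => sub_add_cancel p (q i) ▸ B.smul_mem (hP i) (hy i)
  have h1 := congrArg (modPart B S p) h
  rw [modPart_symbol_self, map_sum] at h1
  have h2 : ∀ i, modPart B S p (a i • modSymbol B S (hy i)) = modSymbol B S (hPy i) := fun i => by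
    rw [modPart_smul, hPa, ringSymbol_smul]
    exact modSymbol_congr (sub_add_cancel p (q i)) rfl
  simp only [h2] at h1
  rw [← modSymbol_sum] at h1
  have h3 : x - ∑ i, P i • y i ∈ B.F p := sub_mem hx (sum_mem fun i _ => hPy i)
  rw [← modSymbol_eq_zero_iff h3]
  have h4 := modSymbol_add (S := S) h3 (sum_mem fun i (_ : i ∈ Finset.univ) => hPy i)
  rw [← h1] at h4
  have h5 : modSymbol B S (add_mem h3 (sum_mem fun i (_ : i ∈ Finset.univ) => hPy i)) =
      modSymbol B S hx := modSymbol_congr rfl (sub_add_cancel _ _)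
  rw [h5] at h4
  exact right_eq_add.1 h4

end Module

theorem le_grLow {M : Type*} [AddCommGroup M] {F : ℤ × ℤ → AddSubgroup M} {e : ℤ × ℤ} (he : e ∈ S)
    (p : ℤ × ℤ) : F (p - e) ≤ grLow S F p :=
  le_iSup₂ (f := fun e (_ : e ∈ S) => F (p - e)) e he

/-- If the step `(1,0)` is divided out then the associated bigraded ring is commutative, because
commutators lower the order. -/
theorem grRing_mul_comm (hS : (1, 0) ∈ S) (a b : GrRing w S) : a * b = b * a := by
  induction a using ringSymbol_induction with
  | zero => rw [zero_mul, mul_zero]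
  | add a a' ha ha' => rw [add_mul, mul_add, ha, ha']
  | symb p P hP =>
    induction b using ringSymbol_induction with
    | zero => rw [zero_mul, mul_zero]
    | add b b' hb hb' => rw [add_mul, mul_add, hb, hb']
    | symb q Q hQ =>
      rw [ringSymbol_mul, ringSymbol_mul]
      have h1 : P * Q - Q * P ∈ bifilt w (p + q) :=
        sub_mem (bifilt_mul_mem w hP hQ) (add_comm p q ▸ bifilt_mul_mem w hQ hP)
      have h2 : ringSymbol S h1 = 0 :=
        (ringSymbol_eq_zero_iff h1).2 (le_grLow hS _ (bracket_mem_bifilt hP hQ))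
      have h3 : Q * P ∈ bifilt w (p + q) := add_comm p q ▸ bifilt_mul_mem w hQ hP
      have h4 := ringSymbol_add (S := S) h1 h3
      rw [h2, zero_add] at h4
      exact ((ringSymbol_congr rfl (sub_add_cancel _ _)).symm.trans h4).trans
        (ringSymbol_congr (add_comm p q) rfl)

/-! ### The bigraded maximal ideal -/

theorem residue_eq_zero_of_mem_grLow (hS : S ⊆ bigrSteps) {P : D n}
    (hP : P ∈ grLow S (bifilt w) 0) : residue n P = 0 := by
  suffices grLow S (bifilt w) 0 ≤ (residue n).ker from this hP
  refine iSup₂_le fun e he Q hQ => ?_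
  rw [AddMonoidHom.mem_ker]
  rcases hS he with rfl | rfl
  · rw [eq_zero_of_mem_bifilt (by simp) hQ, map_zero]
  · obtain ⟨a, rfl, ha⟩ := exists_eq_mulD (k := -1) (by simpa using hQ)
    rw [residue_mulD]
    exact constantCoeff_eq_zero (by norm_num) ha

/-- The residue homomorphism on the part of degree `(0,0)`: the value at `0` of `P(1)`. -/
def pieceResidue (w : Weight n) (hS : S ⊆ bigrSteps) : GrPiece S (bifilt w) 0 →+ ℂ :=
  QuotientAddGroup.lift _ ((residue n).comp (bifilt w 0).subtype)
    fun _ hP => residue_eq_zero_of_mem_grLow hS hP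

/-- The residue homomorphism of the associated bigraded ring: the value at `0` of the part of
degree `(0,0)`. -/
def grResidue (w : Weight n) (hS : S ⊆ bigrSteps) : GrRing w S →+ ℂ :=
  (pieceResidue w hS).comp (DFinsupp.evalAddMonoidHom (β := GrPiece S (bifilt w)) 0)

theorem grResidue_symbol_zero (hS : S ⊆ bigrSteps) {P : D n} (hP : P ∈ bifilt w 0) :
    grResidue w hS (ringSymbol S hP) = residue n P :=
  congrArg (pieceResidue w hS) (DirectSum.of_eq_same (β := GrPiece S (bifilt w)) 0
    (QuotientAddGroup.mk ⟨P, hP⟩ : GrPiece S (bifilt w) 0))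

theorem grResidue_symbol_of_ne (hS : S ⊆ bigrSteps) {p : ℤ × ℤ} {P : D n} (hP : P ∈ bifilt w p)
    (hp : p ≠ 0) : grResidue w hS (ringSymbol S hP) = 0 :=
  (congrArg (pieceResidue w hS) (DirectSum.of_eq_of_ne (β := GrPiece S (bifilt w)) p 0 _
    hp.symm)).trans (map_zero _)

theorem grResidue_ringPart_zero (hS : S ⊆ bigrSteps) (a : GrRing w S) :
    grResidue w hS (ringPart w S 0 a) = grResidue w hS a :=
  congrArg (pieceResidue w hS) (DirectSum.of_eq_same (β := GrPiece S (bifilt w)) 0 _)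

theorem grResidue_one (hS : S ⊆ bigrSteps) : grResidue w hS 1 = 1 := by
  rw [one_eq_ringSymbol, grResidue_symbol_zero, (isLocalFamily_bifilt w).map_one]

theorem grResidue_mul (hS : S ⊆ bigrSteps) (a b : GrRing w S) :
    grResidue w hS (a * b) = grResidue w hS a * grResidue w hS b := by
  induction a using ringSymbol_induction with
  | zero => rw [zero_mul, map_zero, zero_mul]
  | add a a' ha ha' => rw [add_mul, map_add, ha, ha', map_add, add_mul]
  | symb p P hP =>
    induction b using ringSymbol_induction with
    | zero => rw [mul_zero, map_zero, mul_zero]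
    | add b b' hb hb' => rw [mul_add, map_add, hb, hb', map_add, mul_add]
    | symb q Q hQ =>
      rw [ringSymbol_mul]
      by_cases hp : p = 0
      · subst hp
        by_cases hq : q = 0
        · subst hq
          have h1 : P * Q ∈ bifilt w 0 := zero_add (0 : ℤ × ℤ) ▸ bifilt_mul_mem w hP hQ
          rw [ringSymbol_congr (hQ := h1) (zero_add 0) rfl, grResidue_symbol_zero,
            grResidue_symbol_zero, grResidue_symbol_zero, (isLocalFamily_bifilt w).map_mul hP hQ]
        · rw [grResidue_symbol_of_ne hS hQ hq, mul_zero,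
            grResidue_symbol_of_ne hS _ (by rwa [zero_add])]
      · rw [grResidue_symbol_of_ne hS hP hp, zero_mul]
        by_cases hpq : p + q = 0
        · have h1 : P * Q ∈ bifilt w 0 := hpq ▸ bifilt_mul_mem w hP hQ
          rw [ringSymbol_congr (hQ := h1) hpq rfl, grResidue_symbol_zero]
          exact (isLocalFamily_bifilt w).map_mul_of_ne hP hQ hpq hp
        · exact grResidue_symbol_of_ne hS _ hpq

theorem isLocalFamily_grRingPart (w : Weight n) (hS : S ⊆ bigrSteps) :
    IsLocalFamily (grRingPart w S) (grResidue w hS) where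
  one_mem := mem_grRingPart_iff.2 ⟨1, one_mem_bifilt w, one_eq_ringSymbol⟩
  mul_mem {p q a b} ha hb := by
    obtain ⟨P, hP, rfl⟩ := mem_grRingPart_iff.1 ha
    obtain ⟨Q, hQ, rfl⟩ := mem_grRingPart_iff.1 hb
    exact mem_grRingPart_iff.2 ⟨_, _, ringSymbol_mul hP hQ⟩
  map_one := grResidue_one hS
  map_mul _ _ := grResidue_mul hS _ _
  map_mul_of_ne {p q a b} ha hb hpq hp := by
    obtain ⟨P, hP, rfl⟩ := mem_grRingPart_iff.1 ha
    rw [grResidue_mul, grResidue_symbol_of_ne hS hP hp, zero_mul]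
  exists_inv {a} ha hχ := by
    obtain ⟨P, hP, rfl⟩ := mem_grRingPart_iff.1 ha
    rw [grResidue_symbol_zero] at hχ
    obtain ⟨Q, hQ, hQP⟩ := (isLocalFamily_bifilt w).exists_inv hP hχ
    refine ⟨ringSymbol S hQ, mem_grRingPart_iff.2 ⟨Q, hQ, rfl⟩, ?_⟩
    rw [ringSymbol_mul, one_eq_ringSymbol]
    exact ringSymbol_congr (zero_add 0) hQP

/-- The operators in `F_p(𝒟)` whose class lies in a given subgroup of the bigraded ring. -/
def symbolPreimage (I : AddSubgroup (GrRing w S)) (p : ℤ × ℤ) : AddSubgroup (D n) where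
  carrier := {P | ∃ hP : P ∈ bifilt w p, ringSymbol S hP ∈ I}
  zero_mem' := ⟨zero_mem _, by
    rw [(ringSymbol_eq_zero_iff _).2 (zero_mem _)]; exact zero_mem _⟩
  add_mem' := by
    rintro P Q ⟨hP, h⟩ ⟨hQ, h'⟩
    exact ⟨add_mem hP hQ, by rw [ringSymbol_add hP hQ]; exact add_mem h h'⟩
  neg_mem' := by
    rintro P ⟨hP, h⟩
    refine ⟨neg_mem hP, ?_⟩
    have h1 := ringSymbol_add (S := S) hP (neg_mem hP)
    have h2 : ringSymbol S (add_mem hP (neg_mem hP)) = 0 :=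
      (ringSymbol_eq_zero_iff _).2 (by rw [add_neg_cancel]; exact zero_mem _)
    rw [h2] at h1
    rw [eq_neg_of_add_eq_zero_right h1.symm]
    exact neg_mem h

/-- A two-sided ideal as an additive subgroup. -/
def idealSubgroup (I : TwoSidedIdeal (GrRing w S)) : AddSubgroup (GrRing w S) where
  carrier := {a | a ∈ I}
  zero_mem' := I.zero_mem
  add_mem' := I.add_mem
  neg_mem' := I.neg_mem

theorem mul_mem_symbolPreimage {p q t : ℤ × ℤ} {I : TwoSidedIdeal (GrRing w S)} {P Q : D n}
    (hP : P ∈ bifilt w p) (hQ : Q ∈ bifilt w q) (h : p + q = t)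
    (hI : ringSymbol S hP ∈ I ∨ ringSymbol S hQ ∈ I) : P * Q ∈ symbolPreimage (idealSubgroup I) t := by
  subst h
  refine ⟨bifilt_mul_mem w hP hQ, ?_⟩
  rw [← ringSymbol_mul hP hQ]
  rcases hI with hI | hI
  · exact I.mul_mem_right _ _ hI
  · exact I.mul_mem_left _ _ hI

theorem ringSymbol_mem_maxIdeal_of_order {k : ℤ} {P : D n} (hP : P ∈ bifilt w (1, k)) :
    ringSymbol S hP ∈ maxIdeal w S :=
  TwoSidedIdeal.subset_span (Or.inr (Set.mem_iUnion.2 ⟨k, mem_grRingPart_iff.2 ⟨P, hP, rfl⟩⟩))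

/-- A class in degree `p` lies in `𝔪` unless `p = (0,0)` and its value at `0` is non-zero: an
operator of positive order is a sum of products with one factor in some `F_{1,k}(𝒟)`, and a power
series without constant term is a combination of the coordinates. -/
theorem ringSymbol_mem_maxIdeal (hS : (0, 1) ∈ S) {p : ℤ × ℤ} {P : D n} (hP : P ∈ bifilt w p)
    (h0 : p = 0 → residue n P = 0) : ringSymbol S hP ∈ maxIdeal w S := by
  suffices P ∈ symbolPreimage (idealSubgroup (maxIdeal w S)) p by
    obtain ⟨_, h⟩ := this
    exact h
  obtain ⟨d, k⟩ := p
  rcases lt_trichotomy d 0 with hd | rfl | hd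
  · rw [eq_zero_of_mem_bifilt hd hP]
    exact zero_mem _
  · by_cases hk : 0 < k
    · refine ⟨hP, ?_⟩
      have : ringSymbol S hP = 0 := by
        refine (ringSymbol_eq_zero_iff hP).2 (le_grLow hS _ ?_)
        obtain ⟨a, rfl, -⟩ := exists_eq_mulD hP
        refine mulD_mem (by simp) fun α _ => (wt_nonpos w.u_nonpos α).trans ?_
        show (0 : ℤ) ≤ k - 1
        omega
      rw [this]
      exact zero_mem _
    · obtain ⟨a, rfl, ha⟩ := exists_eq_mulD hP
      have ha0 : MvPowerSeries.constantCoeff a.1 = 0 := by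
        rcases (not_lt.1 hk).lt_or_eq with hk | rfl
        · exact constantCoeff_eq_zero hk ha
        · rw [← residue_mulD]; exact h0 rfl
      obtain ⟨b, rfl, -, hb⟩ := exists_eq_sum_coord_mul Set.univ a fun α hα => by
        by_contra hcon
        push Not at hcon
        refine hα ?_
        have : α = 0 := Finsupp.ext fun i => hcon i trivial
        rw [this]
        exact ha0
      rw [mulD_sum]
      refine sum_mem fun i _ => ?_
      rw [mulD_mul]
      refine mul_mem_symbolPreimage (p := (0, w.u i)) (q := (0, k - w.u i))
        ⟨mulOp_mem (fun _ => le_rfl) _, coord_mem w.u w.v i⟩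
        (mulD_mem le_rfl fun α hα => ?_) (by simp)
        (Or.inl (TwoSidedIdeal.subset_span (Or.inl ⟨i, rfl⟩)))
      have := ha _ (hb i α hα)
      rw [wt_add, wt_single] at this
      linarith
  · refine bifilt_induction (w := w) (p := (d, k)) _ (fun a β hβ ha => ?_) hP
    by_cases hβ0 : β = 0
    · subst hβ0
      rw [partialD_zero]
      refine mul_mem_symbolPreimage (p := (d - 1, k)) (q := (1, 0))
        (mulD_mem (by omega) fun α hα => ?_)
        (bifilt_mono w (show ((0, 0) : ℤ × ℤ) ≤ (1, 0) from ⟨by simp, le_rfl⟩) (one_mem_bifilt w))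
        (by simp) (Or.inr (ringSymbol_mem_maxIdeal_of_order _))
      have := ha α hα
      rwa [wt_zero, sub_zero] at this
    · obtain ⟨i, hi⟩ := Finsupp.ne_iff.1 hβ0
      obtain ⟨γ, rfl⟩ : ∃ γ, β = γ + Finsupp.single i 1 :=
        ⟨β - Finsupp.single i 1, (tsub_add_cancel_of_le
          (Finsupp.single_le_iff.2 (Nat.one_le_iff_ne_zero.2 hi))).symm⟩
      rw [partialD_add, ← mul_assoc]
      have h1 : mulD a * partialD γ ∈ bifilt w (d - 1, k - w.v i) := by
        have h2 := bifilt_mul_mem w (mulD_mem (w := w) (d := 0) le_rfl ha) (partialD_mem w γ)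
        refine bifilt_mono w ⟨?_, ?_⟩ h2
        · simp only [map_add, Finsupp.degree_single] at hβ
          push_cast at hβ
          simp only [Prod.fst_add, zero_add]
          linarith
        · simp only [Prod.snd_add, wt_add, wt_single]
          linarith
      have h2 : partialD (Finsupp.single i 1) ∈ bifilt w (1, w.v i) := by
        simpa [wt_single] using partialD_mem w (Finsupp.single i 1)
      exact mul_mem_symbolPreimage h1 h2 (by simp) (Or.inr (ringSymbol_mem_maxIdeal_of_order _))

theorem mem_maxIdeal_iff (hS : S ⊆ bigrSteps) (hS' : (0, 1) ∈ S) {a : GrRing w S} :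
    a ∈ maxIdeal w S ↔ grResidue w hS a = 0 := by
  constructor
  · let χ : GrRing w S →+* ℂ :=
      { grResidue w hS with
        map_one' := grResidue_one hS
        map_mul' := grResidue_mul hS }
    suffices maxIdeal w S ≤ TwoSidedIdeal.ker χ from fun ha => (TwoSidedIdeal.mem_ker χ).1 (this ha)
    refine TwoSidedIdeal.span_le.2 ?_
    rintro x (⟨i, rfl⟩ | hx)
    · refine (TwoSidedIdeal.mem_ker χ).2 ?_
      by_cases hi : w.u i = 0
      · have hmem : mulD (coord i) ∈ bifilt w 0 := by
          have : mulD (coord i) ∈ bifilt w (0, w.u i) :=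
            ⟨mulOp_mem (fun _ => le_rfl) _, coord_mem w.u w.v i⟩
          rwa [hi] at this
        have h1 : coordClass w S i = ringSymbol S hmem :=
          symbol_congr (by rw [hi]; rfl) rfl
        change grResidue w hS (coordClass w S i) = 0
        rw [h1, grResidue_symbol_zero, residue_mulD]
        exact MvPowerSeries.constantCoeff_X i
      · exact grResidue_symbol_of_ne hS _ fun h => hi (congrArg Prod.snd h)
    · obtain ⟨k, hk⟩ := Set.mem_iUnion.1 hx
      obtain ⟨P, hP, rfl⟩ := mem_grRingPart_iff.1 hk
      exact (TwoSidedIdeal.mem_ker χ).2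
        (grResidue_symbol_of_ne hS hP fun h => one_ne_zero (congrArg Prod.fst h))
  · intro ha
    obtain ⟨J, hJ⟩ := exists_sum_ringPart a
    have h0 : grResidue w hS (ringPart w S 0 a) = 0 := by
      rw [grResidue_ringPart_zero, ha]
    rw [hJ]
    refine sum_mem (S := idealSubgroup (maxIdeal w S)) fun p _ => ?_
    obtain ⟨P, hP, h⟩ := exists_ringPart_eq_symbol p a
    rw [h]
    refine ringSymbol_mem_maxIdeal hS' hP fun hp => ?_
    subst hp
    rwa [h, grResidue_symbol_zero] at h0

end GrRing

/-! ### Associated bigraded modules of free modules -/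

section Free

variable {n : ℕ} {w : Weight n}

theorem stdVec_mem_freeBif (w : Weight n) {r : ℕ} (s : Fin r → ℤ × ℤ) (j : Fin r) :
    stdVec (D n) j ∈ (freeBif w s).F (s j) :=
  (isLocalFamily_bifilt w).single_mem s j

theorem mem_freeBif {r : ℕ} {s : Fin r → ℤ × ℤ} {p : ℤ × ℤ} {x : Fin r → D n} :
    x ∈ (freeBif w s).F p ↔ ∀ j, x j ∈ bifilt w (p - s j) :=
  mem_shifted

theorem apply_mem_grLow {S : Set (ℤ × ℤ)} {r : ℕ} {s : Fin r → ℤ × ℤ} {p : ℤ × ℤ}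
    {x : Fin r → D n} (hx : x ∈ grLow S (freeBif w s).F p) (j : Fin r) :
    x j ∈ grLow S (bifilt w) (p - s j) :=
  map_grLow S (Pi.evalAddMonoidHom (fun _ : Fin r => D n) j) (fun e y hy => by
    have := mem_freeBif.1 hy j
    rwa [sub_right_comm] at this) hx

/-- The classes of the standard basis vectors define a map `A^r → gr(𝒟^r)`. -/
def freeMap (w : Weight n) (S : Set (ℤ × ℤ)) {r : ℕ} (s : Fin r → ℤ × ℤ) :
    (Fin r → GrRing w S) →ₗ[GrRing w S] GrMod (freeBif w s) S :=
  Fintype.linearCombination (GrRing w S) fun j =>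
    modSymbol (freeBif w s) S (stdVec_mem_freeBif w s j)

variable {S : Set (ℤ × ℤ)} {r : ℕ} {s : Fin r → ℤ × ℤ}

theorem freeMap_apply (a : Fin r → GrRing w S) : freeMap w S s a =
    ∑ j, a j • modSymbol (freeBif w s) S (stdVec_mem_freeBif w s j) :=
  Fintype.linearCombination_apply _ _ _

theorem freeMap_symbol {p : ℤ × ℤ} {x : Fin r → D n} (hx : x ∈ (freeBif w s).F p) :
    freeMap w S s (fun j => ringSymbol S (mem_freeBif.1 hx j)) = modSymbol (freeBif w s) S hx := by
  have h1 : ∀ j, x j • stdVec (D n) j ∈ (freeBif w s).F p := fun j =>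
    sub_add_cancel p (s j) ▸ (freeBif w s).smul_mem (mem_freeBif.1 hx j) (stdVec_mem_freeBif w s j)
  have h2 : ∀ j, ringSymbol S (mem_freeBif.1 hx j) •
      modSymbol (freeBif w s) S (stdVec_mem_freeBif w s j) = modSymbol (freeBif w s) S (h1 j) :=
    fun j => by
      rw [ringSymbol_smul]
      exact modSymbol_congr (sub_add_cancel p (s j)) rfl
  rw [freeMap_apply]
  simp only [h2]
  rw [← modSymbol_sum Finset.univ h1]
  exact modSymbol_congr rfl (sum_smul_stdVec x)

theorem freeMap_bijective : Function.Bijective (freeMap w S s) := by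
  refine ⟨?_, fun a => ?_⟩
  · rw [injective_iff_map_eq_zero]
    intro a ha
    refine funext fun j => eq_zero_of_ringPart fun q => ?_
    have h0 : (0 : Fin r → D n) ∈ (freeBif w s).F (q + s j) := zero_mem _
    obtain ⟨P, hP, hlow⟩ := exists_sub_mem_grLow (S := S) h0 (stdVec_mem_freeBif w s) (a := a)
      ((modSymbol_zero h0).trans (ha.symm.trans (freeMap_apply a)))
    rw [sum_smul_stdVec, zero_sub] at hlow
    have h1 := apply_mem_grLow (neg_mem hlow) j
    rw [neg_neg] at h1
    obtain ⟨hPj, hj⟩ := hP j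
    rw [(ringSymbol_eq_zero_iff hPj).2 h1, add_sub_cancel_right] at hj
    exact hj
  · induction a using modSymbol_induction with
    | zero => exact ⟨0, map_zero _⟩
    | add a b ha hb =>
      obtain ⟨x, rfl⟩ := ha
      obtain ⟨y, rfl⟩ := hb
      exact ⟨x + y, map_add _ _ _⟩
    | symb p x hx => exact ⟨_, freeMap_symbol hx⟩

/-- `gr(𝒟^r[𝐧][𝐦]) ≅ A^r[𝐧][𝐦]` for `A = gr 𝒟`. -/
def freeEquiv (w : Weight n) (S : Set (ℤ × ℤ)) {r : ℕ} (s : Fin r → ℤ × ℤ) :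
    GrMod (freeBif w s) S ≃ₗ[GrRing w S] (Fin r → GrRing w S) :=
  (LinearEquiv.ofBijective (freeMap w S s) freeMap_bijective).symm

theorem freeEquiv_symm_apply (a : Fin r → GrRing w S) :
    (freeEquiv w S s).symm a = freeMap w S s a := rfl

theorem freeEquiv_symbol {p : ℤ × ℤ} {x : Fin r → D n} (hx : x ∈ (freeBif w s).F p) :
    freeEquiv w S s (modSymbol (freeBif w s) S hx) =
      fun j => ringSymbol S (mem_freeBif.1 hx j) := by
  rw [← LinearEquiv.eq_symm_apply, freeEquiv_symm_apply, freeMap_symbol]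

theorem mem_grModPart_freeBif_iff (p : ℤ × ℤ) (a : GrMod (freeBif w s) S) :
    a ∈ grModPart (freeBif w s) S p ↔ freeEquiv w S s a ∈ shifted (grRingPart w S) s p := by
  rw [mem_grModPart_iff, mem_shifted]
  constructor
  · rintro ⟨x, hx, rfl⟩ j
    rw [freeEquiv_symbol]
    exact mem_grRingPart_iff.2 ⟨x j, mem_freeBif.1 hx j, rfl⟩
  · intro h
    choose x hx h using fun j => mem_grRingPart_iff.1 (h j)
    refine ⟨x, mem_freeBif.2 hx, ?_⟩
    rw [← freeMap_symbol, ← freeEquiv_symm_apply, LinearEquiv.eq_symm_apply]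
    exact funext h

end Free

/-! ### Noetherianity -/

section Noetherian

variable {n : ℕ} {w : Weight n}

/-- The classes of the convergent power series. -/
def coeffHom (w : Weight n) (S : Set (ℤ × ℤ)) : O n →+* GrRing w S where
  toFun a := ringSymbol S (p := 0) (P := mulD a) (mulD_mem le_rfl fun α _ => wt_nonpos w.u_nonpos α)
  map_one' := ringSymbol_congr rfl mulD_one
  map_mul' a b := by
    rw [ringSymbol_mul]
    exact ringSymbol_congr (zero_add 0).symm (mulD_mul a b)
  map_zero' := (ringSymbol_congr (hQ := zero_mem _) rfl mulD_zero).trans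
    ((ringSymbol_eq_zero_iff _).2 (zero_mem _))
  map_add' a b := by
    rw [← ringSymbol_add]
    exact ringSymbol_congr rfl (mulD_add a b)

theorem mul_mem_symbolPreimage_subring {S : Set (ℤ × ℤ)} {p q t : ℤ × ℤ}
    {R : Subring (GrRing w S)} {P Q : D n} (hP : P ∈ symbolPreimage R.toAddSubgroup p)
    (hQ : Q ∈ symbolPreimage R.toAddSubgroup q) (h : p + q = t) :
    P * Q ∈ symbolPreimage R.toAddSubgroup t := by
  subst h
  obtain ⟨hP, h⟩ := hP
  obtain ⟨hQ, h'⟩ := hQ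
  refine ⟨bifilt_mul_mem w hP hQ, ?_⟩
  rw [← ringSymbol_mul hP hQ]
  exact R.mul_mem h h'

/-- The ring `⨁ F_{d,k}(𝒟) / F_{d-1,k}(𝒟)` is generated over `ℂ{x}` by the classes of the `xᵢ`, the
`∂ᵢ` and of `1` in degree `(0,1)`. -/
theorem subring_eq_top {S : Set (ℤ × ℤ)} (hS : (1, 0) ∈ S) (R : Subring (GrRing w S))
    (hO : ∀ a, coeffHom w S a ∈ R)
    (hX : ∀ i, mulD (coord i) ∈ symbolPreimage R.toAddSubgroup (0, w.u i))
    (hΔ : ∀ i, partialD (Finsupp.single i 1) ∈ symbolPreimage R.toAddSubgroup (1, w.v i))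
    (hT : 1 ∈ symbolPreimage R.toAddSubgroup ((0, 1) : ℤ × ℤ)) : R = ⊤ := by
  have hcoeff : ∀ (m : ℕ) (k : ℤ) (a : O n), -k ≤ m →
      (∀ α, MvPowerSeries.coeff α a.1 ≠ 0 → wt w.u α ≤ k) →
      mulD a ∈ symbolPreimage R.toAddSubgroup (0, k) := by
    have hpos : ∀ (k : ℕ) (a : O n), mulD a ∈ symbolPreimage R.toAddSubgroup (0, (k : ℤ)) := by
      intro k a
      induction k with
      | zero => exact ⟨_, hO a⟩
      | succ k ih =>
        have := mul_mem_symbolPreimage_subring ih hT (t := (0, ((k + 1 : ℕ) : ℤ))) (by simp)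
        rwa [mul_one] at this
    intro m
    induction m with
    | zero =>
      intro k a hk _
      obtain ⟨k, rfl⟩ := Int.eq_ofNat_of_zero_le (a := k) (by simpa using hk)
      exact hpos k a
    | succ m ih =>
      intro k a hk ha
      rcases le_or_gt 0 k with h0 | h0
      · obtain ⟨k, rfl⟩ := Int.eq_ofNat_of_zero_le h0
        exact hpos k a
      · obtain ⟨b, rfl, hb0, hb⟩ := exists_eq_sum_coord_mul {i | w.u i < 0} a fun α hα => by
          by_contra hcon
          push Not at hcon
          have h1 : wt w.u α = 0 := Finset.sum_eq_zero fun i _ => by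
            rcases (w.u_nonpos i).lt_or_eq with h | h
            · rw [hcon i h]; simp
            · rw [h, zero_mul]
          have := ha α hα
          omega
        rw [mulD_sum]
        refine sum_mem fun i _ => ?_
        by_cases hi : w.u i < 0
        · rw [mulD_mul]
          refine mul_mem_symbolPreimage_subring (hX i) (ih (k - w.u i) (b i) ?_ fun α hα => ?_)
            (by simp)
          · push_cast at hk
            omega
          · have := ha _ (hb i α hα)
            rw [wt_add, wt_single] at this
            linarith
        · rw [hb0 i hi, mul_zero, mulD_zero]
          exact zero_mem _
  have hone : (1 : D n) ∈ symbolPreimage R.toAddSubgroup 0 := ⟨one_mem_bifilt w, R.one_mem⟩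
  have hpartial : ∀ β : Fin n →₀ ℕ,
      partialD β ∈ symbolPreimage R.toAddSubgroup ((β.degree : ℤ), wt w.v β) := by
    intro β
    induction β using Finsupp.induction_linear with
    | zero =>
      rw [partialD_zero, wt_zero, map_zero, Nat.cast_zero]
      exact hone
    | add β γ hβ hγ =>
      rw [partialD_add]
      exact mul_mem_symbolPreimage_subring hβ hγ (by rw [wt_add]; simp)
    | single i m =>
      induction m with
      | zero =>
        rw [Finsupp.single_zero, partialD_zero, wt_zero, map_zero, Nat.cast_zero]
        exact hone
      | succ m ih =>
        rw [Finsupp.single_add, partialD_add]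
        refine mul_mem_symbolPreimage_subring ih (hΔ i) ?_
        rw [wt_add, wt_single]
        simp
  refine eq_top_iff.2 fun a _ => ?_
  induction a using ringSymbol_induction with
  | zero => exact R.zero_mem
  | add a b ha hb => exact R.add_mem (ha trivial) (hb trivial)
  | symb p P hP =>
    suffices P ∈ symbolPreimage R.toAddSubgroup p by
      obtain ⟨_, h⟩ := this
      exact h
    refine bifilt_induction (w := w) (p := p) _ (fun a β hβ ha => ?_) hP
    rcases hβ.lt_or_eq with hlt | heq
    · have hmem : mulD a * partialD β ∈ bifilt w (p - (1, 0)) := by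
        refine bifilt_mono w ⟨?_, ?_⟩
          (bifilt_mul_mem w (mulD_mem (w := w) (d := 0) le_rfl ha) (partialD_mem w β))
        · change 0 + (β.degree : ℤ) ≤ p.1 - 1
          omega
        · change p.2 - wt w.v β + wt w.v β ≤ p.2 - 0
          omega
      refine ⟨bifilt_mono w (show p - (1, 0) ≤ p from ⟨by simp, by simp⟩) hmem, ?_⟩
      rw [(ringSymbol_eq_zero_iff _).2 (le_grLow hS _ hmem)]
      exact R.zero_mem
    · refine mul_mem_symbolPreimage_subring (hcoeff (-(p.2 - wt w.v β)).toNat _ a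
        (Int.self_le_toNat _) ha) (hpartial β) (Prod.ext ?_ ?_)
      · simp [heq]
      · simp

/-- `⨁ F_{d,k}(𝒟) / F_{d-1,k}(𝒟)` is a quotient of a polynomial ring over the Noetherian ring `ℂ{x}`. -/
theorem isNoetherianRing_grRing (w : Weight n) {S : Set (ℤ × ℤ)} (hS : (1, 0) ∈ S) :
    IsNoetherianRing (GrRing w S) := by
  let _ : CommRing (GrRing w S) :=
    { (inferInstance : Ring (GrRing w S)) with mul_comm := grRing_mul_comm hS }
  have hX : ∀ i, mulD (coord i) ∈ bifilt w (0, w.u i) := fun i =>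
    ⟨mulOp_mem (fun _ => le_rfl) _, coord_mem w.u w.v i⟩
  have hΔ : ∀ i, partialD (Finsupp.single i 1) ∈ bifilt w (1, w.v i) := fun i => by
    simpa [wt_single] using partialD_mem w (Finsupp.single i 1)
  have hT : (1 : D n) ∈ bifilt w (0, 1) :=
    bifilt_mono w (show (0 : ℤ × ℤ) ≤ (0, 1) from ⟨le_rfl, by simp⟩) (one_mem_bifilt w)
  let g : Option (Fin n ⊕ Fin n) → GrRing w S := fun
    | none => ringSymbol S hT
    | some (Sum.inl i) => ringSymbol S (hX i)
    | some (Sum.inr i) => ringSymbol S (hΔ i)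
  let f : MvPolynomial (Option (Fin n ⊕ Fin n)) (O n) →+* GrRing w S :=
    MvPolynomial.eval₂Hom (coeffHom w S) g
  have hg : ∀ i, g i ∈ f.range := fun i => ⟨MvPolynomial.X i, MvPolynomial.eval₂Hom_X' _ _ i⟩
  refine isNoetherianRing_of_surjective _ _ f (RingHom.range_eq_top.1
    (subring_eq_top hS f.range (fun a => ⟨MvPolynomial.C a, MvPolynomial.eval₂Hom_C _ _ a⟩)
      (fun i => ⟨hX i, hg (some (Sum.inl i))⟩) (fun i => ⟨hΔ i, hg (some (Sum.inr i))⟩)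
      ⟨hT, hg none⟩))

/-- Every submodule of `𝒟^r` with the induced bifiltration is finitely generated as a family: its
classes modulo lower order span a submodule of a Noetherian module, and lifts of finitely many
generators generate by induction on the order. -/
theorem exists_generators_of_submodule {r : ℕ} (s : Fin r → ℤ × ℤ) (K : Submodule (D n) (Fin r → D n)) :
    ∃ (l : ℕ) (f : Fin l → (Fin r → D n)) (t : Fin l → ℤ × ℤ), ∀ p x,
      x ∈ K.toAddSubgroup ⊓ (freeBif w s).F p ↔
        ∃ P : Fin l → D n, (∀ i, P i ∈ bifilt w (p - t i)) ∧ x = ∑ i, P i • f i := by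
  let S : Set (ℤ × ℤ) := {(1, 0)}
  have := isNoetherianRing_grRing w (S := S) rfl
  have : IsNoetherian (GrRing w S) (GrMod (freeBif w s) S) :=
    isNoetherian_of_linearEquiv (freeEquiv w S s).symm
  let X : Set (GrMod (freeBif w s) S) :=
    {a | ∃ (p : ℤ × ℤ) (x : Fin r → D n) (hx : x ∈ (freeBif w s).F p), x ∈ K ∧
      a = modSymbol (freeBif w s) S hx}
  obtain ⟨Y, hYX, hY⟩ := Submodule.fg_span_iff_fg_span_finset_subset X |>.1
    (IsNoetherian.noetherian (Submodule.span (GrRing w S) X))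
  let e := Y.equivFin
  choose t f hf hfK hfY using fun i => hYX (e.symm i).2
  refine ⟨Y.card, f, t, fun p x => ⟨fun hxp => ?_, ?_⟩⟩
  · obtain ⟨b, hb⟩ : ∃ b : ℤ, ∀ j, b ≤ (s j).1 := by
      obtain ⟨b, hb⟩ := (Set.finite_range fun j => (s j).1).bddBelow
      exact ⟨b, fun j => hb ⟨j, rfl⟩⟩
    obtain ⟨m, hm⟩ : ∃ m : ℕ, p.1 - b < m := ⟨(p.1 - b + 1).toNat, by omega⟩
    induction m generalizing p x with
    | zero =>
      have hx : x ∈ (freeBif w s).F p := hxp.2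
      refine ⟨0, fun i => zero_mem _, ?_⟩
      simp only [Pi.zero_apply, zero_smul, Finset.sum_const_zero]
      refine funext fun j => eq_zero_of_mem_bifilt (w := w) (p := p - s j) ?_ (mem_freeBif.1 hx j)
      have := hb j
      simp only [Prod.fst_sub]
      push_cast at hm
      omega
    | succ m ih =>
      obtain ⟨hxK, hx⟩ : x ∈ K ∧ x ∈ (freeBif w s).F p := hxp
      have h1 : modSymbol (freeBif w s) S hx ∈ Submodule.span (GrRing w S) (Y : Set _) :=
        hY ▸ Submodule.subset_span ⟨p, x, hx, hxK, rfl⟩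
      have h2 : (Y : Set (GrMod (freeBif w s) S)) =
          Set.range fun i => modSymbol (freeBif w s) S (hf i) := by
        ext a
        constructor
        · intro ha
          exact ⟨e ⟨a, ha⟩, (hfY _).symm.trans (by simp)⟩
        · rintro ⟨i, rfl⟩
          change modSymbol (freeBif w s) S (hf i) ∈ (Y : Set _)
          rw [← hfY i]
          exact (e.symm i).2
      rw [h2] at h1
      obtain ⟨c, hc⟩ := (Submodule.mem_span_range_iff_exists_fun _).1 h1
      obtain ⟨P, hP, hlow⟩ := exists_sub_mem_grLow hx hf hc.symm
      have hlow' : x - ∑ i, P i • f i ∈ (freeBif w s).F (p - (1, 0)) := by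
        have : grLow S (freeBif w s).F p = (freeBif w s).F (p - (1, 0)) := by
          simp [grLow, S]
        rwa [this] at hlow
      obtain ⟨Q, hQ, hxQ⟩ := ih (p - (1, 0)) (x - ∑ i, P i • f i)
        ⟨K.sub_mem hxK (sum_mem fun i _ => K.smul_mem _ (hfK i)), hlow'⟩
        (by rw [Prod.fst_sub]; push_cast at hm ⊢; omega)
      refine ⟨P + Q, fun i => add_mem (hP i).1 (bifilt_mono w ?_ (hQ i)), ?_⟩
      · exact sub_le_sub_right (show p - (1, 0) ≤ p from ⟨by simp, by simp⟩) _
      · simp only [Pi.add_apply, add_smul, Finset.sum_add_distrib]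
        rw [← hxQ]
        abel
  · rintro ⟨P, hP, rfl⟩
    refine ⟨K.sum_mem fun i _ => K.smul_mem _ (hfK i), sum_mem fun i _ => ?_⟩
    exact sub_add_cancel p (t i) ▸ (freeBif w s).smul_mem (hP i) (hf i)

end Noetherian

/-! ### Induced complexes of associated bigraded modules -/

section Induced

variable {n : ℕ} {w : Weight n} {S : Set (ℤ × ℤ)}
  {L₂ L₁ L₀ N : Type*} [AddCommGroup L₂] [Module (D n) L₂] [AddCommGroup L₁] [Module (D n) L₁]
  [AddCommGroup L₀] [Module (D n) L₀] [AddCommGroup N] [Module (D n) N]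
  {B₂ : Bifiltration w L₂} {B₁ : Bifiltration w L₁} {B₀ : Bifiltration w L₀} {C : Bifiltration w N}

theorem grMap_symbol {f : L₁ →ₗ[D n] L₀} (hf : ∀ p, ∀ x ∈ B₁.F p, f x ∈ B₀.F p) {p : ℤ × ℤ}
    {x : L₁} (hx : x ∈ B₁.F p) :
    grMap B₁ B₀ S f hf (modSymbol B₁ S hx) = modSymbol B₀ S (hf p x hx) :=
  DirectSum.map_of (pieceMap B₁ B₀ S f hf) p _

theorem grMap_modPart {f : L₁ →ₗ[D n] L₀} (hf : ∀ p, ∀ x ∈ B₁.F p, f x ∈ B₀.F p) (p : ℤ × ℤ)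
    (a : GrMod B₁ S) : grMap B₁ B₀ S f hf (modPart B₁ S p a) =
      modPart B₀ S p (grMap B₁ B₀ S f hf a) := by
  induction a using modSymbol_induction with
  | zero => simp only [map_zero]
  | add a b ha hb => simp only [map_add, ha, hb]
  | symb q x hx =>
    by_cases h : q = p
    · subst h
      rw [modPart_symbol_self, grMap_symbol, modPart_symbol_self]
    · rw [modPart_symbol_of_ne hx h, grMap_symbol, modPart_symbol_of_ne _ h, map_zero]

theorem grLow_le (hS : S ⊆ bigrSteps) (B : Bifiltration w N) (p : ℤ × ℤ) :
    grLow S B.F p ≤ B.F p := by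
  refine iSup₂_le fun e he => ?_
  obtain ⟨d, k⟩ := p
  rcases hS he with rfl | rfl
  · have := B.mono_left (d - 1) k
    rw [sub_add_cancel] at this
    simpa using this
  · have := B.mono_right d (k - 1)
    rw [sub_add_cancel] at this
    simpa using this

/-- A filtered exact sequence whose second map is strict with respect to the lower order terms
induces an exact sequence of associated bigraded modules. -/
theorem grMap_exact (hS : S ⊆ bigrSteps) {f : L₂ →ₗ[D n] L₁} {g : L₁ →ₗ[D n] L₀}
    (hf : ∀ p, ∀ x ∈ B₂.F p, f x ∈ B₁.F p) (hg : ∀ p, ∀ x ∈ B₁.F p, g x ∈ B₀.F p)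
    (hgf : ∀ x, g (f x) = 0)
    (hex : ∀ p, ∀ x ∈ B₁.F p, g x = 0 → ∃ y ∈ B₂.F p, f y = x)
    (hst : ∀ p x, g x ∈ grLow S B₀.F p → ∃ y ∈ grLow S B₁.F p, g y = g x) :
    Function.Exact (grMap B₂ B₁ S f hf) (grMap B₁ B₀ S g hg) := by
  intro a
  constructor
  · intro ha
    obtain ⟨J, hJ⟩ := exists_sum_homPart (S := S) (F := B₁.F) a
    suffices a ∈ LinearMap.range (grMap B₂ B₁ S f hf) from this
    rw [hJ]
    refine Submodule.sum_mem _ fun p _ => ?_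
    obtain ⟨x, hx, hpx⟩ := exists_homPart_eq_symbol p a
    have h1 := grMap_modPart (S := S) hg p a
    rw [ha, map_zero] at h1
    have h2 : modPart B₁ S p a = modSymbol B₁ S hx := hpx
    rw [h2, grMap_symbol, modSymbol_eq_zero_iff] at h1
    obtain ⟨x', hx', hgx⟩ := hst p x h1
    have hx'F := grLow_le hS B₁ p hx'
    obtain ⟨y, hy, hfy⟩ := hex p (x - x') (sub_mem hx hx'F) (by rw [map_sub, hgx, sub_self])
    refine ⟨modSymbol B₂ S hy, ?_⟩
    rw [grMap_symbol]
    refine Eq.trans ?_ h2.symm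
    have h3 : modSymbol B₁ S hx = modSymbol B₁ S (add_mem (hf p y hy) hx'F) :=
      modSymbol_congr rfl (by rw [hfy, sub_add_cancel])
    rw [h3, modSymbol_add (hf p y hy) hx'F, (modSymbol_eq_zero_iff hx'F).2 hx', add_zero]
  · rintro ⟨b, rfl⟩
    induction b using modSymbol_induction with
    | zero => simp only [map_zero]
    | add a b ha hb => simp only [map_add, ha, hb, add_zero]
    | symb p x hx =>
      rw [grMap_symbol, grMap_symbol, modSymbol_eq_zero_iff, hgf]
      exact zero_mem _

theorem grMap_surjective {g : L₁ →ₗ[D n] L₀} (hg : ∀ p, ∀ x ∈ B₁.F p, g x ∈ B₀.F p)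
    (hsurj : ∀ p, ∀ x ∈ B₀.F p, ∃ y ∈ B₁.F p, g y = x) :
    Function.Surjective (grMap B₁ B₀ S g hg) := by
  intro a
  induction a using modSymbol_induction with
  | zero => exact ⟨0, map_zero _⟩
  | add a b ha hb =>
    obtain ⟨x, rfl⟩ := ha
    obtain ⟨y, rfl⟩ := hb
    exact ⟨x + y, map_add _ _ _⟩
  | symb p x hx =>
    obtain ⟨y, hy, rfl⟩ := hsurj p x hx
    exact ⟨modSymbol B₁ S hy, grMap_symbol hg hy⟩

theorem exists_mem_grLow_of_surjective {g : L₁ →ₗ[D n] L₀}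
    (hsurj : ∀ p, ∀ x ∈ B₀.F p, ∃ y ∈ B₁.F p, g y = x) {p : ℤ × ℤ} {z : L₀}
    (hz : z ∈ grLow S B₀.F p) : ∃ y ∈ grLow S B₁.F p, g y = z := by
  suffices grLow S B₀.F p ≤ (grLow S B₁.F p).map g.toAddMonoidHom from this hz
  refine iSup₂_le fun e he x hx => ?_
  obtain ⟨y, hy, hyx⟩ := hsurj _ x hx
  exact ⟨y, le_grLow he p hy, hyx⟩

theorem grLow_reesSteps (F : ℤ × ℤ → AddSubgroup N) (p : ℤ × ℤ) :
    grLow reesSteps F p = F (p - (0, 1)) := by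
  simp [grLow]

theorem grLow_bigrSteps (F : ℤ × ℤ → AddSubgroup N) (p : ℤ × ℤ) :
    grLow bigrSteps F p = F (p - (1, 0)) ⊔ F (p - (0, 1)) := by
  simp [grLow, iSup_or, iSup_sup_eq]

theorem strict_reesSteps {g : L₁ →ₗ[D n] L₀} {h : L₀ →ₗ[D n] N} (hgh : ∀ x, h (g x) = 0)
    (hex : ∀ p, ∀ y ∈ B₀.F p, h y = 0 → ∃ x ∈ B₁.F p, g x = y) (p : ℤ × ℤ) (x : L₁)
    (hx : g x ∈ grLow reesSteps B₀.F p) : ∃ y ∈ grLow reesSteps B₁.F p, g y = g x := by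
  rw [grLow_reesSteps] at hx ⊢
  exact hex _ _ hx (hgh x)

/-- In a filtered exact sequence `L₁ → L₀ → N` the first map is strict with respect to the sum
`F_{d-1,k} + F_{d,k-1}` if `F_{d-1,k}(N) ∩ F_{d,k-1}(N) = F_{d-1,k-1}(N)`: if `g x = a + b` then
`h a = - h b` lies in this intersection, and `a`, `b` can be corrected so as to lie in the kernel
of `h`. -/
theorem strict_bigrSteps {g : L₁ →ₗ[D n] L₀} {h : L₀ →ₗ[D n] N} (hgh : ∀ x, h (g x) = 0)
    (hex : ∀ p, ∀ y ∈ B₀.F p, h y = 0 → ∃ x ∈ B₁.F p, g x = y)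
    (hh : ∀ p, ∀ y ∈ B₀.F p, h y ∈ C.F p)
    (hsat : ∀ p, ∀ z ∈ C.F (p - (1, 0)), z ∈ C.F (p - (0, 1)) → z ∈ C.F (p - (1, 1)))
    (hlift : ∀ p y, h y ∈ C.F p → ∃ y' ∈ B₀.F p, h y' = h y) (p : ℤ × ℤ) (x : L₁)
    (hx : g x ∈ grLow bigrSteps B₀.F p) : ∃ y ∈ grLow bigrSteps B₁.F p, g y = g x := by
  have hle : ∀ e ∈ bigrSteps, B₀.F (p - (1, 1)) ≤ B₀.F (p - e) := by
    intro e he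
    obtain ⟨d, k⟩ := p
    rcases he with rfl | rfl
    · have := B₀.mono_right (d - 1) (k - 1)
      rw [sub_add_cancel] at this
      simpa using this
    · have := B₀.mono_left (d - 1) (k - 1)
      rw [sub_add_cancel] at this
      simpa using this
  rw [grLow_bigrSteps] at hx ⊢
  obtain ⟨a, ha, b, hb, hab⟩ := AddSubgroup.mem_sup.1 hx
  have h1 : h a = - h b := by
    rw [eq_neg_iff_add_eq_zero, ← map_add, hab, hgh]
  obtain ⟨c, hc, hca⟩ := hlift (p - (1, 1)) a
    (hsat p _ (hh _ a ha) (h1 ▸ neg_mem (hh _ b hb)))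
  obtain ⟨y, hy, hya⟩ := hex _ (a - c) (sub_mem ha (hle _ (Or.inl rfl) hc))
    (by rw [map_sub, hca, sub_self])
  obtain ⟨z, hz, hzb⟩ := hex _ (b + c) (add_mem hb (hle _ (Or.inr rfl) hc))
    (by rw [map_add, hca, h1, add_neg_cancel])
  refine ⟨y + z, AddSubgroup.add_mem_sup hy hz, ?_⟩
  rw [map_add, hya, hzb, ← hab]
  abel

end Induced

/-! ### Minimality in terms of matrix entries -/

section Resolution

variable {n : ℕ} {w : Weight n} {M : Type*} [AddCommGroup M] [Module (D n) M]
  {B : Bifiltration w M}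

/-- The maps of the resolution vanish modulo the maximal ideal: no matrix entry between summands
with equal shifts is a unit of `ℂ{x}`. -/
def BifilteredFreeResolution.IsResidueMinimal (R : BifilteredFreeResolution B) : Prop :=
  ∀ i p, ∀ x ∈ (freeBif w (R.shift (i + 1))).F p, ∀ j, R.shift i j = p → residue n (R.φ i x j) = 0

/-- The maps of the resolution are strict with respect to the lower order terms for the steps `S`. -/
def BifilteredFreeResolution.IsStrict (R : BifilteredFreeResolution B) (S : Set (ℤ × ℤ)) : Prop :=
  ∀ i p x, R.φ i x ∈ grLow S (freeBif w (R.shift i)).F p →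
    ∃ y ∈ grLow S (freeBif w (R.shift (i + 1))).F p, R.φ i y = R.φ i x

theorem BifilteredFreeResolution.isMinimalFamilyResolution (R : BifilteredFreeResolution B)
    (h : R.IsResidueMinimal) :
    IsMinimalFamilyResolution (bifilt w) (residue n) B.F R.shift R.φ R.ε where
  map_mem := R.map_mem
  aug_mem := R.aug_mem
  comp_eq_zero i x := (R.exact i (R.φ (i + 1) x)).2 ⟨x, rfl⟩
  aug_comp_eq_zero x := (R.exact_aug (R.φ 0 x)).2 ⟨x, rfl⟩
  exact := R.filt_exact
  exact_aug := R.filt_exact_aug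
  surjective := R.filt_surjective
  minimal := h

theorem BifilteredFreeResolution.isStrict_reesSteps (R : BifilteredFreeResolution B) :
    R.IsStrict reesSteps := by
  intro i
  cases i with
  | zero =>
    exact strict_reesSteps (h := R.ε) (fun x => (R.exact_aug (R.φ 0 x)).2 ⟨x, rfl⟩)
      R.filt_exact_aug
  | succ i =>
    exact strict_reesSteps (h := R.φ i) (fun x => (R.exact i (R.φ (i + 1) x)).2 ⟨x, rfl⟩)
      (R.filt_exact i)

theorem BifilteredFreeResolution.isStrict_bigrSteps (R : BifilteredFreeResolution B)
    (hFV : ∀ d k, (B.F (d, k) : Set M) = B.FPart d ∩ B.VPart k) : R.IsStrict bigrSteps := by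
  intro i
  cases i with
  | zero =>
    refine strict_bigrSteps (h := R.ε) (C := B) (fun x => (R.exact_aug (R.φ 0 x)).2 ⟨x, rfl⟩)
      R.filt_exact_aug R.aug_mem (fun p z hz hz' => ?_) (fun p y hy => R.filt_surjective p _ hy)
    obtain ⟨d, k⟩ := p
    have h1 : z ∈ (B.F (d - 1, k - 1) : Set M) := by
      rw [hFV]
      exact ⟨Set.mem_iUnion.2 ⟨k, by simpa using hz⟩, Set.mem_iUnion.2 ⟨d, by simpa using hz'⟩⟩
    exact h1
  | succ i =>
    refine strict_bigrSteps (h := R.φ i) (C := freeBif w (R.shift i))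
      (fun x => (R.exact i (R.φ (i + 1) x)).2 ⟨x, rfl⟩)
      (R.filt_exact i) (R.map_mem i) (fun p z hz hz' => mem_freeBif.2 fun j => ?_)
      (fun p y hy => ?_)
    · -- both filtrations of `𝒟` only see one of the two indices
      have h1 := mem_freeBif.1 hz j
      have h2 := mem_freeBif.1 hz' j
      refine ⟨?_, ?_⟩
      · have := h1.1
        simpa using this
      · have := h2.2
        simpa using this
    · cases i with
      | zero => exact R.filt_exact_aug p _ hy ((R.exact_aug (R.φ 0 y)).2 ⟨y, rfl⟩)
      | succ i => exact R.filt_exact i p _ hy ((R.exact i (R.φ (i + 1) y)).2 ⟨y, rfl⟩)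

variable {S : Set (ℤ × ℤ)}

theorem grResidue_freeEquiv_symbol (hS : S ⊆ bigrSteps) {r : ℕ} {s : Fin r → ℤ × ℤ} {p : ℤ × ℤ}
    {x : Fin r → D n} (hx : x ∈ (freeBif w s).F p) (j : Fin r) :
    grResidue w hS (freeEquiv w S s (modSymbol (freeBif w s) S hx) j) =
      if s j = p then residue n (x j) else 0 := by
  rw [freeEquiv_symbol]
  split_ifs with h
  · subst h
    change grResidue w hS (ringSymbol S (mem_freeBif.1 hx j)) = _
    have h1 : x j ∈ bifilt w 0 := sub_self (s j) ▸ mem_freeBif.1 hx j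
    rw [ringSymbol_congr (hQ := h1) (sub_self (s j)) rfl, grResidue_symbol_zero]
  · exact grResidue_symbol_of_ne hS _ fun h0 => h (sub_eq_zero.1 h0).symm

/-- `𝔪 X` consists of the elements of a free module `X` whose coordinates lie in `𝔪`. -/
theorem mem_span_maxIdeal_iff (hS : S ⊆ bigrSteps) (hS' : (0, 1) ∈ S) {X : Type*} [AddCommGroup X]
    [Module (GrRing w S) X] {r : ℕ} (e : X ≃ₗ[GrRing w S] (Fin r → GrRing w S)) {x : X} :
    x ∈ Submodule.span (GrRing w S) {y | ∃ a ∈ maxIdeal w S, ∃ z : X, y = a • z} ↔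
      ∀ j, grResidue w hS (e x j) = 0 := by
  constructor
  · intro hx
    induction hx using Submodule.span_induction with
    | mem y hy =>
      obtain ⟨a, ha, z, rfl⟩ := hy
      intro j
      rw [map_smul, Pi.smul_apply, smul_eq_mul, grResidue_mul, (mem_maxIdeal_iff hS hS').1 ha,
        zero_mul]
    | zero => intro j; rw [map_zero, Pi.zero_apply, map_zero]
    | add y z _ _ hy hz => intro j; rw [map_add, Pi.add_apply, map_add, hy, hz, add_zero]
    | smul a y _ hy =>
      intro j
      rw [map_smul, Pi.smul_apply, smul_eq_mul, grResidue_mul, hy, mul_zero]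
  · intro h
    have h1 : x = ∑ j, e x j • e.symm (stdVec (GrRing w S) j) := by
      apply e.injective
      rw [map_sum]
      simp only [map_smul, LinearEquiv.apply_symm_apply]
      exact (sum_smul_stdVec (e x)).symm
    rw [h1]
    exact sum_mem fun j _ => Submodule.subset_span ⟨_, (mem_maxIdeal_iff hS hS').2 (h j), _, rfl⟩

/-- Minimality of the induced complex does not depend on the associated bigraded object. -/
theorem BifilteredFreeResolution.inducesMinimal_iff (R : BifilteredFreeResolution B)
    (hS : S ⊆ bigrSteps) (hS' : (0, 1) ∈ S) (hst : R.IsStrict S) :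
    R.InducesMinimal S ↔ R.IsResidueMinimal := by
  constructor
  · intro h i p x hx j hj
    have h1 := (mem_span_maxIdeal_iff hS hS' (freeEquiv w S (R.shift i))).1
      (h.minimal i (modSymbol _ S hx)) j
    rw [grMap_symbol, grResidue_freeEquiv_symbol, if_pos hj] at h1
    exact h1
  · intro h
    refine ⟨fun i => ⟨freeEquiv w S (R.shift i), fun p x => mem_grModPart_freeBif_iff p x⟩,
      fun i p x hx => ?_, fun p x hx => ?_, fun i => ?_, ?_, grMap_surjective _ R.filt_surjective,
      fun i x => (mem_span_maxIdeal_iff hS hS' (freeEquiv w S (R.shift i))).2 fun j => ?_⟩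
    · obtain ⟨x, hx', rfl⟩ := mem_grModPart_iff.1 hx
      exact mem_grModPart_iff.2 ⟨_, _, grMap_symbol _ hx'⟩
    · obtain ⟨x, hx', rfl⟩ := mem_grModPart_iff.1 hx
      exact mem_grModPart_iff.2 ⟨_, _, grMap_symbol _ hx'⟩
    · exact grMap_exact hS _ _ (fun x => (R.exact i (R.φ (i + 1) x)).2 ⟨x, rfl⟩) (R.filt_exact i)
        (hst i)
    · exact grMap_exact hS _ _ (fun x => (R.exact_aug (R.φ 0 x)).2 ⟨x, rfl⟩) R.filt_exact_aug
        fun p x hx => exists_mem_grLow_of_surjective R.filt_surjective hx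
    · induction x using modSymbol_induction with
      | zero => rw [map_zero, map_zero, Pi.zero_apply, map_zero]
      | add a b ha hb => rw [map_add, map_add, Pi.add_apply, map_add, ha, hb, add_zero]
      | symb p x hx =>
        rw [grMap_symbol, grResidue_freeEquiv_symbol]
        split_ifs with hj
        · exact h i p x hx j hj
        · rfl

theorem BifilteredFreeResolution.inducesMinimalBigr_iff (R : BifilteredFreeResolution B)
    (hFV : ∀ d k, (B.F (d, k) : Set M) = B.FPart d ∩ B.VPart k) :
    R.InducesMinimalBigr ↔ R.IsResidueMinimal :=
  R.inducesMinimal_iff subset_rfl (Or.inr rfl) (R.isStrict_bigrSteps hFV)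

theorem BifilteredFreeResolution.isMinimal_iff (R : BifilteredFreeResolution B) :
    R.IsMinimal ↔ R.IsResidueMinimal :=
  R.inducesMinimal_iff (fun _ h => Or.inr h) rfl R.isStrict_reesSteps

/-- Existence of a minimal bifiltered resolution: minimal covers of the successive kernels. -/
theorem exists_isResidueMinimal (hB : B.IsGood) :
    ∃ R : BifilteredFreeResolution B, R.IsResidueMinimal := by
  have hA := isLocalFamily_bifilt w
  -- a stage of the construction: a free module and the kernel that is to be covered next
  let α : ℕ → Type := fun _ => Σ r : ℕ, (Fin r → ℤ × ℤ) × Submodule (D n) (Fin r → D n)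
  let E : ∀ i, α i → α (i + 1) → Prop := fun _ a b =>
    ∃ φ : (Fin b.1 → D n) →ₗ[D n] (Fin a.1 → D n),
      (∀ p x, x ∈ a.2.2.toAddSubgroup ⊓ (freeBif w a.2.1).F p ↔
        ∃ y ∈ shifted (bifilt w) b.2.1 p, φ y = x) ∧
      IsMinimalCover (bifilt w) (residue n) b.2.1 φ ∧ b.2.2 = LinearMap.ker φ
  obtain ⟨r₀, s₀, ε₀, hε₀, hmin₀⟩ := hA.exists_minimalCover hB
  obtain ⟨f, hf0, -, hf⟩ := exists_seq (α := α) (fun _ _ => True) E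
    ⟨r₀, s₀, LinearMap.ker ε₀⟩ trivial fun i a _ => by
      obtain ⟨r, s, φ, hφ, hmin⟩ := hA.exists_minimalCover
        (exists_generators_of_submodule (w := w) a.2.1 a.2.2)
      exact ⟨⟨r, s, LinearMap.ker φ⟩, trivial, φ, hφ, hmin, rfl⟩
  have h0 : ∃ ε : (Fin (f 0).1 → D n) →ₗ[D n] M,
      (∀ p x, x ∈ B.F p ↔ ∃ y ∈ shifted (bifilt w) (f 0).2.1 p, ε y = x) ∧
      IsMinimalCover (bifilt w) (residue n) (f 0).2.1 ε ∧ (f 0).2.2 = LinearMap.ker ε := by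
    rw [hf0]
    exact ⟨ε₀, hε₀, hmin₀, rfl⟩
  obtain ⟨ε, hε, hεmin, hεker⟩ := h0
  choose φ hφ hφmin hφker using hf
  have hmem : ∀ i p, ∀ x ∈ (freeBif w (f (i + 1)).2.1).F p,
      φ i x ∈ (f i).2.2 ∧ φ i x ∈ (freeBif w (f i).2.1).F p :=
    fun i p x hx => (hφ i p _).2 ⟨x, hx, rfl⟩
  have hmem' : ∀ i x, φ i x ∈ (f i).2.2 := fun i x => by
    obtain ⟨p, hp⟩ := (freeBif w (f (i + 1)).2.1).exhaust x
    exact (hmem i p x hp).1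
  have hlift : ∀ i p, ∀ x ∈ (freeBif w (f i).2.1).F p, x ∈ (f i).2.2 →
      ∃ y ∈ (freeBif w (f (i + 1)).2.1).F p, φ i y = x :=
    fun i p x hx hK => (hφ i p x).1 ⟨hK, hx⟩
  have hker : ∀ i x, x ∈ (f (i + 1)).2.2 ↔ φ i x = 0 := fun i x => by
    rw [hφker, LinearMap.mem_ker]
  have hkerε : ∀ x, x ∈ (f 0).2.2 ↔ ε x = 0 := fun x => by rw [hεker, LinearMap.mem_ker]
  refine ⟨
    { rank := fun i => (f i).1
      shift := fun i => (f i).2.1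
      φ := φ
      ε := ε
      exact := fun i x => ⟨fun hx => ?_, ?_⟩
      exact_aug := fun x => ⟨fun hx => ?_, ?_⟩
      surjective := fun x => ?_
      map_mem := fun i p x hx => (hmem i p x hx).2
      aug_mem := fun p x hx => (hε p _).2 ⟨x, hx, rfl⟩
      filt_exact := fun i p x hx hx0 => hlift (i + 1) p x hx ((hker i x).2 hx0)
      filt_exact_aug := fun p x hx hx0 => hlift 0 p x hx ((hkerε x).2 hx0)
      filt_surjective := fun p x hx => (hε p x).1 hx }, fun i p x hx j hj => ?_⟩
  · obtain ⟨p, hp⟩ := (freeBif w (f (i + 1)).2.1).exhaust x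
    obtain ⟨y, -, hy⟩ := hlift (i + 1) p x hp ((hker i x).2 hx)
    exact ⟨y, hy⟩
  · rintro ⟨y, rfl⟩
    exact (hker i _).1 (hmem' (i + 1) y)
  · obtain ⟨p, hp⟩ := (freeBif w (f 0).2.1).exhaust x
    obtain ⟨y, -, hy⟩ := hlift 0 p x hp ((hkerε x).2 hx)
    exact ⟨y, hy⟩
  · rintro ⟨y, rfl⟩
    exact (hkerε _).1 (hmem' 0 y)
  · obtain ⟨p, hp⟩ := B.exhaust x
    obtain ⟨y, -, hy⟩ := (hε p x).1 hp
    exact ⟨y, hy⟩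
  · change residue n (φ i x j) = 0
    cases i with
    | zero => exact hεmin p _ (hmem 0 p x hx).2 ((hkerε _).1 (hmem 0 p x hx).1) j hj
    | succ i => exact hφmin i p _ (hmem (i + 1) p x hx).2 ((hker i _).1 (hmem (i + 1) p x hx).1) j hj

/-! ### Minimal bigraded resolutions -/

/-- The projection of a shifted free module onto its part of degree `p`. -/
def freePart (w : Weight n) (S : Set (ℤ × ℤ)) {r : ℕ} (s : Fin r → ℤ × ℤ) (p : ℤ × ℤ) :
    (Fin r → GrRing w S) →+ (Fin r → GrRing w S) :=
  AddMonoidHom.mk' (fun x j => ringPart w S (p - s j) (x j))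
    fun x y => funext fun j => map_add (ringPart w S (p - s j)) (x j) (y j)

theorem freePart_mem {r : ℕ} (s : Fin r → ℤ × ℤ) (p : ℤ × ℤ) (x : Fin r → GrRing w S) :
    freePart w S s p x ∈ shifted (grRingPart w S) s p :=
  mem_shifted.2 fun j => by
    obtain ⟨P, hP, h⟩ := exists_ringPart_eq_symbol (p - s j) (x j)
    exact mem_grRingPart_iff.2 ⟨P, hP, h⟩

theorem freePart_self {r : ℕ} {s : Fin r → ℤ × ℤ} {p : ℤ × ℤ} {x : Fin r → GrRing w S}
    (hx : x ∈ shifted (grRingPart w S) s p) : freePart w S s p x = x :=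
  funext fun j => by
    obtain ⟨P, hP, h⟩ := mem_grRingPart_iff.1 (mem_shifted.1 hx j)
    change ringPart w S (p - s j) (x j) = x j
    rw [h, ringPart_symbol_self]

theorem freePart_of_ne {r : ℕ} {s : Fin r → ℤ × ℤ} {p q : ℤ × ℤ} (hpq : q ≠ p)
    {x : Fin r → GrRing w S} (hx : x ∈ shifted (grRingPart w S) s q) : freePart w S s p x = 0 :=
  funext fun j => by
    obtain ⟨P, hP, h⟩ := mem_grRingPart_iff.1 (mem_shifted.1 hx j)
    change ringPart w S (p - s j) (x j) = 0
    rw [h, ringPart_symbol_of_ne hP fun h' => hpq (sub_left_injective h')]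

/-- A bihomogeneous element in the image of a bihomogeneous map is the image of a bihomogeneous
element. Here `ρ` is the projection of the target onto its part of degree `p`. -/
theorem exists_homogeneous_preimage (hS : S ⊆ bigrSteps) {T : Type*} [AddCommGroup T]
    [Module (GrRing w S) T] {𝒯 : ℤ × ℤ → AddSubgroup T} {p : ℤ × ℤ} (ρ : T →+ T)
    (hρ : ∀ z ∈ 𝒯 p, ρ z = z) (hρ' : ∀ q, q ≠ p → ∀ z ∈ 𝒯 q, ρ z = 0) {r : ℕ}
    {s : Fin r → ℤ × ℤ} (φ : (Fin r → GrRing w S) →ₗ[GrRing w S] T)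
    (hφ : ∀ q, ∀ x ∈ shifted (grRingPart w S) s q, φ x ∈ 𝒯 q) {x : Fin r → GrRing w S}
    (hx : φ x ∈ 𝒯 p) : ∃ y ∈ shifted (grRingPart w S) s p, φ y = φ x := by
  have key : ∀ x, φ (freePart w S s p x) = ρ (φ x) := by
    intro x
    rw [← sum_smul_stdVec x]
    simp only [map_sum]
    refine Finset.sum_congr rfl fun j _ => ?_
    induction x j using ringSymbol_induction with
    | zero => simp only [zero_smul, map_zero]
    | add a b ha hb => simp only [add_smul, map_add, ha, hb]
    | symb q P hP =>
      have h1 : ringSymbol S hP • stdVec (GrRing w S) j ∈ shifted (grRingPart w S) s (q + s j) :=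
        (isLocalFamily_grRingPart w hS).isStable_shifted s _ _ _
          (mem_grRingPart_iff.2 ⟨P, hP, rfl⟩) _ ((isLocalFamily_grRingPart w hS).single_mem s j)
      by_cases h : q + s j = p
      · subst h
        rw [freePart_self h1, hρ _ (hφ _ _ h1)]
      · rw [freePart_of_ne h h1, map_zero, hρ' _ h _ (hφ _ _ h1)]
  exact ⟨freePart w S s p x, freePart_mem s p x, by rw [key, hρ _ hx]⟩

/-- A minimal bigraded free resolution is a minimal resolution of the family of bihomogeneous
parts, after a choice of coordinates on its free modules. -/
theorem IsMinimalResolution.exists_isMinimalFamilyResolution (hS : S ⊆ bigrSteps)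
    (hS' : (0, 1) ∈ S) {X : ℕ → Type*} [∀ i, AddCommGroup (X i)] [∀ i, Module (GrRing w S) (X i)]
    {𝒳 : ∀ i, ℤ × ℤ → AddSubgroup (X i)} {φ : ∀ i, X (i + 1) →ₗ[GrRing w S] X i}
    {ε : X 0 →ₗ[GrRing w S] GrMod B S} {r : ℕ → ℕ} {s : ∀ i, Fin (r i) → ℤ × ℤ}
    (h : IsMinimalResolution (grRingPart w S) (maxIdeal w S) (grModPart B S) 𝒳 φ ε s) :
    ∃ (φ' : ∀ i, (Fin (r (i + 1)) → GrRing w S) →ₗ[GrRing w S] (Fin (r i) → GrRing w S))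
      (ε' : (Fin (r 0) → GrRing w S) →ₗ[GrRing w S] GrMod B S),
      IsMinimalFamilyResolution (grRingPart w S) (grResidue w hS) (grModPart B S) s φ' ε' := by
  choose e he using h.free
  let φ' : ∀ i, (Fin (r (i + 1)) → GrRing w S) →ₗ[GrRing w S] (Fin (r i) → GrRing w S) :=
    fun i => (e i).toLinearMap ∘ₗ φ i ∘ₗ (e (i + 1)).symm.toLinearMap
  let ε' : (Fin (r 0) → GrRing w S) →ₗ[GrRing w S] GrMod B S := ε ∘ₗ (e 0).symm.toLinearMap
  have hφ' : ∀ i x, φ' i x = e i (φ i ((e (i + 1)).symm x)) := fun _ _ => rfl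
  have hε' : ∀ x, ε' x = ε ((e 0).symm x) := fun _ => rfl
  have hsymm : ∀ i p, ∀ x ∈ shifted (grRingPart w S) (s i) p, (e i).symm x ∈ 𝒳 i p :=
    fun i p x hx => (he i _ _).2 (by rwa [LinearEquiv.apply_symm_apply])
  have hmap : ∀ i p, ∀ x ∈ shifted (grRingPart w S) (s (i + 1)) p,
      φ' i x ∈ shifted (grRingPart w S) (s i) p :=
    fun i p x hx => (he i _ _).1 (h.map_mem i p _ (hsymm _ _ _ hx))
  have haug : ∀ p, ∀ x ∈ shifted (grRingPart w S) (s 0) p, ε' x ∈ grModPart B S p :=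
    fun p x hx => h.aug_mem p _ (hsymm _ _ _ hx)
  have hex : ∀ i x, φ' i x = 0 → ∃ y, φ' (i + 1) y = x := fun i x hx => by
    rw [hφ', (e i).map_eq_zero_iff] at hx
    obtain ⟨y, hy⟩ := (h.exact i _).1 hx
    exact ⟨e (i + 2) y, by
      rw [hφ', LinearEquiv.symm_apply_apply, hy, LinearEquiv.apply_symm_apply]⟩
  have hex0 : ∀ x, ε' x = 0 → ∃ y, φ' 0 y = x := fun x hx => by
    rw [hε'] at hx
    obtain ⟨y, hy⟩ := (h.exact_aug _).1 hx
    exact ⟨e 1 y, by rw [hφ', LinearEquiv.symm_apply_apply, hy, LinearEquiv.apply_symm_apply]⟩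
  have hhom : ∀ i p x, φ' i x ∈ shifted (grRingPart w S) (s i) p →
      ∃ y ∈ shifted (grRingPart w S) (s (i + 1)) p, φ' i y = φ' i x := fun i p x hx =>
    exists_homogeneous_preimage hS (freePart w S (s i) p) (fun z hz => freePart_self hz)
      (fun q hq z hz => freePart_of_ne hq hz) (φ' i) (hmap i) hx
  refine ⟨φ', ε', hmap, haug, fun i x => ?_, fun x => ?_, fun i p x hx hx0 => ?_,
    fun p x hx hx0 => ?_, fun p x hx => ?_, fun i p x hx j hj => ?_⟩
  · rw [hφ', hφ', LinearEquiv.symm_apply_apply, (h.exact i _).2 ⟨_, rfl⟩, map_zero]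
  · rw [hε', hφ', LinearEquiv.symm_apply_apply, (h.exact_aug _).2 ⟨_, rfl⟩]
  · obtain ⟨y, rfl⟩ := hex i x hx0
    exact hhom (i + 1) p y hx
  · obtain ⟨y, rfl⟩ := hex0 x hx0
    exact hhom 0 p y hx
  · obtain ⟨y, rfl⟩ := h.surjective x
    obtain ⟨z, hz, hzy⟩ := exists_homogeneous_preimage hS (modPart B S p)
      (fun z hz => by
        obtain ⟨x, hx, rfl⟩ := mem_grModPart_iff.1 hz
        exact modPart_symbol_self hx)
      (fun q hq z hz => by
        obtain ⟨x, hx, rfl⟩ := mem_grModPart_iff.1 hz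
        exact modPart_symbol_of_ne hx hq) ε' haug (x := e 0 y)
      (by rwa [hε', LinearEquiv.symm_apply_apply])
    exact ⟨z, hz, by rw [hzy, hε', LinearEquiv.symm_apply_apply]⟩
  · exact (mem_span_maxIdeal_iff hS hS' (e i)).1 (h.minimal i _) j

/-- The classes of a finite system of generators generate the associated bigraded module. -/
theorem finite_grMod (hB : B.IsGood) (S : Set (ℤ × ℤ)) : Module.Finite (GrRing w S) (GrMod B S) := by
  classical
  obtain ⟨l, f, s, hf⟩ := hB
  have hmem : ∀ i, f i ∈ B.F (s i) := fun i => (hf _ _).2 ⟨stdVec (D n) i,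
    mem_shifted.1 ((isLocalFamily_bifilt w).single_mem s i),
    ((Fintype.linearCombination_apply (D n) f (stdVec (D n) i)).symm.trans
      (linearCombination_stdVec f i)).symm⟩
  refine ⟨Finset.univ.image fun i => modSymbol B S (hmem i), eq_top_iff.2 fun a _ => ?_⟩
  induction a using modSymbol_induction with
  | zero => exact zero_mem _
  | add a b ha hb => exact add_mem (ha trivial) (hb trivial)
  | symb p x hx =>
    obtain ⟨P, hP, rfl⟩ := (hf p x).1 hx
    have h1 : ∀ i, P i • f i ∈ B.F p := fun i =>
      sub_add_cancel p (s i) ▸ B.smul_mem (hP i) (hmem i)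
    have h2 : modSymbol B S hx = modSymbol B S (sum_mem fun i (_ : i ∈ Finset.univ) => h1 i) := rfl
    rw [h2, modSymbol_sum Finset.univ h1]
    refine sum_mem fun i _ => ?_
    have h3 : modSymbol B S (h1 i) = ringSymbol S (hP i) • modSymbol B S (hmem i) := by
      rw [ringSymbol_smul]
      exact modSymbol_congr (sub_add_cancel p (s i)).symm rfl
    rw [h3]
    exact Submodule.smul_mem _ _ (Submodule.subset_span (by simp))

end Resolution

end BifilteredD

end

theorem theorem1 {n : ℕ} (w : BifilteredD.Weight n) (hw : ¬ (w.u = 0 ∧ w.v = 1))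
    {M : Type*} [AddCommGroup M] [Module (BifilteredD.D n) M]
    (B : BifilteredD.Bifiltration w M) (hB : B.IsGood)
    (hFV : ∀ d k, (B.F (d, k) : Set M) = B.FPart d ∩ B.VPart k) :
    -- `bigr 𝒟` is commutative and `bigr M` is finitely generated over it
    (∀ a b : BifilteredD.BigrRing w, a * b = b * a) ∧
    Module.Finite (BifilteredD.BigrRing w) (BifilteredD.BigrMod B) ∧
    -- existence and uniqueness of the resolution that induces a minimal resolution of `bigr M`
    (∃ R : BifilteredD.BifilteredFreeResolution B, R.InducesMinimalBigr) ∧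
    (∀ R R' : BifilteredD.BifilteredFreeResolution B,
      R.InducesMinimalBigr → R'.InducesMinimalBigr → R.Iso R') ∧
    -- it is the minimal bifiltered free resolution
    (∀ R : BifilteredD.BifilteredFreeResolution B, R.InducesMinimalBigr ↔ R.IsMinimal) ∧
    -- `M` and `bigr M` have the same Betti numbers and shifts
    (∀ R : BifilteredD.BifilteredFreeResolution B, R.IsMinimal →
      ∀ (r : ℕ → ℕ) (s : ∀ i, Fin (r i) → ℤ × ℤ)
        (φ : ∀ i, (Fin (r (i + 1)) → BifilteredD.BigrRing w) →ₗ[BifilteredD.BigrRing w]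
          (Fin (r i) → BifilteredD.BigrRing w))
        (ε : (Fin (r 0) → BifilteredD.BigrRing w) →ₗ[BifilteredD.BigrRing w]
          BifilteredD.BigrMod B),
        BifilteredD.IsMinimalResolution (BifilteredD.grRingPart w BifilteredD.bigrSteps)
          (BifilteredD.maxIdeal w BifilteredD.bigrSteps)
          (BifilteredD.grModPart B BifilteredD.bigrSteps)
          (fun i => BifilteredD.shifted (BifilteredD.grRingPart w BifilteredD.bigrSteps) (s i))
          φ ε s →
        ∀ i, ∃ σ : Fin (R.rank i) ≃ Fin (r i), ∀ j, s i (σ j) = R.shift i j) := by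
  refine ⟨BifilteredD.grRing_mul_comm (Or.inl rfl), BifilteredD.finite_grMod hB _, ?_, ?_, ?_, ?_⟩
  · obtain ⟨R, hR⟩ := BifilteredD.exists_isResidueMinimal hB
    exact ⟨R, (R.inducesMinimalBigr_iff hFV).2 hR⟩
  · intro R R' hR hR'
    exact BifilteredD.IsMinimalFamilyResolution.exists_iso (BifilteredD.isLocalFamily_bifilt w)
      (R.isMinimalFamilyResolution ((R.inducesMinimalBigr_iff hFV).1 hR))
      (R'.isMinimalFamilyResolution ((R'.inducesMinimalBigr_iff hFV).1 hR'))
  · exact fun R => (R.inducesMinimalBigr_iff hFV).trans R.isMinimal_iff.symm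
  · intro R hR r s φ ε h i
    have hR' : R.InducesMinimalBigr := (R.inducesMinimalBigr_iff hFV).2 (R.isMinimal_iff.1 hR)
    obtain ⟨φ₁, ε₁, h₁⟩ := BifilteredD.IsMinimalResolution.exists_isMinimalFamilyResolution
      subset_rfl (Or.inr rfl) hR'
    obtain ⟨φ₂, ε₂, h₂⟩ := BifilteredD.IsMinimalResolution.exists_isMinimalFamilyResolution
      subset_rfl (Or.inr rfl) h
    obtain ⟨e, he, -, -⟩ := h₁.exists_iso (BifilteredD.isLocalFamily_grRingPart w subset_rfl) h₂
    exact (BifilteredD.isLocalFamily_grRingPart w subset_rfl).exists_perm (e i) (he i)
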